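/- Let $\mathrm{Vir}=\bigoplus_{n\in\mathbb Z}\mathbb C L_n\oplus\mathbb C\,\underline c$ be the Virasoro algebra, with $\underline c$ central and $[L_m,L_n]=(m-n)L_{m+n}+\delta_{m+n,0}\frac{m^3-m}{12}\underline c$. For $h,c\in\mathbb C$ let $M(h,c)$ be the Verma module, i.e. the free module over $U(\bigoplus_{n\ge1}\mathbb C L_{-n})$ generated by a highest weight vector $v_{h,c}$ with $L_0v_{h,c}=h\,v_{h,c}$, $\underline c\,v_{h,c}=c\,v_{h,c}$ and $L_nv_{h,c}=0$ for $n>0$. Let $M_c$ be the quotient of $M(0,c)$ by the submodule generated by $L_{-1}v_{0,c}$. It is a vertex operator algebra with vacuum $\mathbf 1$ (the image of $v_{0,c}$) and Virasoro element $\omega=L_{-2}\mathbf 1$, and every $M(h,c)$ is an $M_c$-module whose vertex operators $Y(a,z)=\sum_{n\in\mathbb Z}a_nz^{-n-1}$ satisfy $Y(\omega,z)=\sum_{n\in\mathbb Z} L_nz^{-n-2}$. For an $M_c$-module $M=\bigoplus_{\mu}M_\mu$, graded by $L_0$-eigenvalues, the contragredient module is $M^*=\bigoplus_\mu M_\mu^*$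 with $$\langle Y^*(a,z)f,w\rangle=\langle f,\,Y(e^{zL_1}(-z^{-2})^{L_0}a,z^{-1})w\rangle .$$ For $M_c$-modules $M^1,M^2,M^3$ with vertex operators $Y_1,Y_2,Y_3$, an intertwining operator of type $\binom{M^3}{M^1\,M^2}$ is a linear map $v\mapsto I(v,z)=\sum_{n\in\mathbb C}v_n z^{-n-1}$ with $v_n\in\mathrm{Hom}_{\mathbb C}(M^2,M^3)$ for $v\in M^1$, such that 1. for all $v\in M^1$, $w\in M^2$, one has $v_nw=0$ whenever the real part of $n$ is sufficiently large; 2. $I(L_{-1}v,z)=\frac{d}{dz}I(v,z)$ for all $v\in M^1$; 3. for all $a\in M_c$, $v\in M^1$, the Jacobi identity holds: $$z_0^{-1}\delta\!\left(\tfrac{z_1-z_2}{z_0}\right)Y_3(a,z_1)I(v,z_2)-z_0^{-1}\delta\!\left(\tfrac{z_2-z_1}{-z_0}\right)I(v,z_2)Y_2(a,z_1)=z_2^{-1}\delta\!\left(\tfrac{z_1-z_0}{z_2}\right)I(Y_1(a,z_0)v,z_2).$$ Let $I_{M^1M^2}^{M^3}$ be the vector space of these operators. **Lemma.** For all $h_1,h_2,h_3,c\in\mathbb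 C$, $$\dim_{\mathbb C} I_{M(h_1,c)\,M(h_2,c)}^{M(h_3,c)^*}=1 .$$ -/

import Mathlib

namespace VirasoroFusion

noncomputable section

open Finset

/-! ### The Virasoro algebra -/

/-- The underlying space of the Virasoro algebra: `(f, t)` stands for `∑ₙ f n • Lₙ + t • C`. -/
def Vir : Type := (ℤ →₀ ℂ) × ℂ

instance : AddCommGroup Vir := inferInstanceAs (AddCommGroup ((ℤ →₀ ℂ) × ℂ))
instance : Module ℂ Vir := inferInstanceAs (Module ℂ ((ℤ →₀ ℂ) × ℂ))

namespace Vir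

/-- The basis element `Lₙ`. -/
def L (n : ℤ) : Vir := (Finsupp.single n 1, 0)

/-- The central basis element. -/
def C : Vir := (0, 1)

/-- The coefficients of the `Lₙ`. -/
def coeffL : Vir →ₗ[ℂ] (ℤ →₀ ℂ) := LinearMap.fst ℂ (ℤ →₀ ℂ) ℂ

/-- The coefficient of the central element. -/
def coeffC : Vir →ₗ[ℂ] ℂ := LinearMap.snd ℂ (ℤ →₀ ℂ) ℂ

@[simp] lemma coeffL_L (n : ℤ) : coeffL (L n) = Finsupp.single n 1 := rfl
@[simp] lemma coeffL_C : coeffL C = 0 := rfl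
@[simp] lemma coeffC_L (n : ℤ) : coeffC (L n) = 0 := rfl
@[simp] lemma coeffC_C : coeffC C = 1 := rfl

/-- The value of the bracket on `L m`, `L n`:
`[L m, L n] = (m - n) L (m + n) + δ_{m + n, 0} (m³ - m) / 12 C`. -/
def basisBracket (m n : ℤ) : Vir :=
  ((m - n : ℤ) : ℂ) • L (m + n) +
    (if m + n = 0 then (((m : ℂ) ^ 3 - m) / 12) else 0) • C

/-- The bilinear bracket of the Virasoro algebra, with `C` central. -/
def bracketMap : Vir →ₗ[ℂ] Vir →ₗ[ℂ] Vir :=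
  (Finsupp.linearCombination ℂ (fun m : ℤ =>
    (Finsupp.linearCombination ℂ (fun n : ℤ => basisBracket m n)).comp coeffL)).comp coeffL

instance : Bracket Vir Vir := ⟨fun x y => bracketMap x y⟩

lemma bracket_def (x y : Vir) : ⁅x, y⁆ = bracketMap x y := rfl

@[simp] lemma bracketMap_L_L (m n : ℤ) : bracketMap (L m) (L n) = basisBracket m n := by
  simp [bracketMap]

@[simp] lemma bracketMap_C_left (x : Vir) : bracketMap C x = 0 := by
  simp [bracketMap]

@[simp] lemma bracketMap_C_right (x : Vir) : bracketMap x C = 0 := by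
  simp only [bracketMap, LinearMap.comp_apply]
  generalize coeffL x = f
  induction f using Finsupp.induction_linear with
  | zero => simp
  | add f g hf hg => rw [map_add, LinearMap.add_apply, hf, hg, add_zero]
  | single m a => simp

/-- `L n` and `C` span the Virasoro algebra. -/
lemma induction_basis {p : Vir → Prop} (hL : ∀ n, p (L n)) (hC : p C)
    (hadd : ∀ x y, p x → p y → p (x + y)) (hsmul : ∀ (a : ℂ) x, p x → p (a • x)) (x : Vir) :
    p x := by
  have h0 : p 0 := by simpa using hsmul 0 _ hC
  obtain ⟨f, t⟩ := x
  have h1 : p ((f, 0) : (ℤ →₀ ℂ) × ℂ) := by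
    induction f using Finsupp.induction_linear with
    | zero => exact h0
    | add f g hf hg =>
      have := hadd _ _ hf hg
      have e : ((f, 0) : (ℤ →₀ ℂ) × ℂ) + (g, 0) = (f + g, 0) := by simp
      exact e ▸ this
    | single m a =>
      have := hsmul a _ (hL m)
      have e : a • ((Finsupp.single m 1, 0) : (ℤ →₀ ℂ) × ℂ) = (Finsupp.single m a, 0) := by simp
      exact e ▸ this
  have h2 : p ((0, t) : (ℤ →₀ ℂ) × ℂ) := by
    have := hsmul t _ hC
    have e : t • ((0, 1) : (ℤ →₀ ℂ) × ℂ) = (0, t) := by simp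
    exact e ▸ this
  have e : ((f, 0) : (ℤ →₀ ℂ) × ℂ) + (0, t) = (f, t) := by simp
  exact e ▸ hadd _ _ h1 h2

lemma basisBracket_skew (m n : ℤ) : basisBracket m n + basisBracket n m = 0 := by
  unfold basisBracket
  rw [add_comm n m]
  by_cases h : m + n = 0
  · obtain rfl : n = -m := by omega
    simp only [h, if_true]
    push_cast
    module
  · simp only [h, if_false]
    push_cast
    module

lemma bracketMap_skew (x y : Vir) : bracketMap x y + bracketMap y x = 0 := by
  induction x using induction_basis with
  | hL m =>
    induction y using induction_basis with
    | hL n => simpa using basisBracket_skew m n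
    | hC => simp
    | hadd a b ha hb =>
      simp only [map_add, LinearMap.add_apply]
      rw [← add_zero (0 : Vir), ← congrArg₂ (· + ·) ha hb]; abel
    | hsmul a b hb =>
      simp only [map_smul, LinearMap.smul_apply]; rw [← smul_add, hb, smul_zero]
  | hC => simp
  | hadd a b ha hb =>
    simp only [map_add, LinearMap.add_apply]
    rw [← add_zero (0 : Vir), ← congrArg₂ (· + ·) ha hb]; abel
  | hsmul a b hb =>
    simp only [map_smul, LinearMap.smul_apply]; rw [← smul_add, hb, smul_zero]

lemma jacobi_basis (m n k : ℤ) :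
    bracketMap (L m) (basisBracket n k) =
      bracketMap (basisBracket m n) (L k) + bracketMap (L n) (basisBracket m k) := by
  simp only [basisBracket, map_add, map_smul, LinearMap.add_apply, LinearMap.smul_apply,
    bracketMap_L_L, bracketMap_C_left, bracketMap_C_right, smul_zero, add_zero]
  rw [show m + n + k = m + (n + k) by ring, show n + (m + k) = m + (n + k) by ring]
  by_cases h : m + (n + k) = 0
  · obtain rfl : k = -m - n := by omega
    simp only [h, if_true]
    push_cast
    module
  · simp only [h, if_false]
    push_cast
    module

lemma jacobi (x y z : Vir) :
    bracketMap x (bracketMap y z) =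
      bracketMap (bracketMap x y) z + bracketMap y (bracketMap x z) := by
  induction x using induction_basis with
  | hL m =>
    induction y using induction_basis with
    | hL n =>
      induction z using induction_basis with
      | hL k => simpa using jacobi_basis m n k
      | hC => simp
      | hadd a b ha hb => simp only [map_add, ha, hb]; abel
      | hsmul a b hb => simp only [map_smul, hb, smul_add]
    | hC => simp
    | hadd a b ha hb => simp only [map_add, LinearMap.add_apply, ha, hb]; abel
    | hsmul a b hb => simp only [map_smul, LinearMap.smul_apply, hb, smul_add]
  | hC => simp
  | hadd a b ha hb => simp only [map_add, LinearMap.add_apply, ha, hb]; abel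
  | hsmul a b hb => simp only [map_smul, LinearMap.smul_apply, hb, smul_add]

instance : LieRing Vir where
  add_lie x y z := by simp [bracket_def]
  lie_add x y z := by simp [bracket_def]
  lie_self x := by
    have h := bracketMap_skew x x
    rw [← two_smul ℂ] at h
    exact (smul_eq_zero.mp h).resolve_left two_ne_zero
  leibniz_lie x y z := jacobi x y z

instance : LieAlgebra ℂ Vir where
  lie_smul t x y := by simp [bracket_def]

end Vir

attribute [local instance] LieRing.ofAssociativeRing

/-- The universal enveloping algebra `U(Vir)`. -/
abbrev UVir : Type := UniversalEnvelopingAlgebra ℂ Vir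

/-- `Lₙ` as an element of `U(Vir)`. -/
def Lu (n : ℤ) : UVir := UniversalEnvelopingAlgebra.ι ℂ (Vir.L n)

/-- The central element as an element of `U(Vir)`. -/
def Cu : UVir := UniversalEnvelopingAlgebra.ι ℂ Vir.C

lemma Lu_mul (m n : ℤ) : Lu m * Lu n = Lu n * Lu m +
    (((m - n : ℤ) : ℂ) • Lu (m + n) +
      (if m + n = 0 then (((m : ℂ) ^ 3 - m) / 12) else 0) • Cu) := by
  have h : UniversalEnvelopingAlgebra.ι ℂ ⁅Vir.L m, Vir.L n⁆ = ⁅Lu m, Lu n⁆ :=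
    LieHom.map_lie _ _ _
  rw [Vir.bracket_def, Vir.bracketMap_L_L, Vir.basisBracket, map_add, map_smul, map_smul,
    LieRing.of_associative_ring_bracket] at h
  change _ = _ + (_ • UniversalEnvelopingAlgebra.ι ℂ (Vir.L (m + n)) +
    _ • UniversalEnvelopingAlgebra.ι ℂ Vir.C)
  rw [h]; abel

lemma Cu_comm_Lu (n : ℤ) : Cu * Lu n = Lu n * Cu := by
  have h : UniversalEnvelopingAlgebra.ι ℂ ⁅Vir.C, Vir.L n⁆ = ⁅Cu, Lu n⁆ :=
    LieHom.map_lie _ _ _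
  rw [Vir.bracket_def, Vir.bracketMap_C_left, map_zero,
    LieRing.of_associative_ring_bracket] at h
  exact (sub_eq_zero.mp h.symm)

/-- A subalgebra of `U(Vir)` containing all `Lₙ` and the central element is everything. -/
lemma mem_subalgebra (S : Subalgebra ℂ UVir) (hL : ∀ n, Lu n ∈ S) (hC : Cu ∈ S) (u : UVir) :
    u ∈ S := by
  have hmem : ∀ x : Vir, UniversalEnvelopingAlgebra.ι ℂ x ∈ S := by
    intro x
    induction x using Vir.induction_basis with
    | hL n => exact hL n
    | hC => exact hC
    | hadd a b ha hb => rw [map_add]; exact S.add_mem ha hb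
    | hsmul a b hb => rw [map_smul]; exact S.smul_mem hb a
  let f : Vir →ₗ⁅ℂ⁆ S :=
    { toFun := fun x => ⟨UniversalEnvelopingAlgebra.ι ℂ x, hmem x⟩
      map_add' := fun x y => by ext; simp only [map_add]; rfl
      map_smul' := fun a x => by ext; simp only [map_smul]; rfl
      map_lie' := fun {x y} => by ext; simp only [LieHom.map_lie]; rfl }
  have h : S.val.comp (UniversalEnvelopingAlgebra.lift ℂ f) = AlgHom.id ℂ UVir := by
    apply UniversalEnvelopingAlgebra.hom_ext
    ext x
    change S.val (UniversalEnvelopingAlgebra.lift ℂ f (UniversalEnvelopingAlgebra.ι ℂ x)) = _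
    rw [UniversalEnvelopingAlgebra.lift_ι_apply]
    rfl
  have := congrArg (fun g : UVir →ₐ[ℂ] UVir => g u) h
  simp only [AlgHom.comp_apply, AlgHom.id_apply] at this
  rw [← this]
  exact Subtype.mem _

/-- A linear subspace of a `U(Vir)`-module that is stable under all `Lₙ` and the central element
is stable under `U(Vir)`. -/
lemma smul_mem_of_stable {W : Type*} [AddCommGroup W] [Module ℂ W] [Module UVir W]
    [IsScalarTower ℂ UVir W] (p : Submodule ℂ W) (hL : ∀ n, ∀ w ∈ p, Lu n • w ∈ p)
    (hC : ∀ w ∈ p, Cu • w ∈ p) (u : UVir) {w : W} (hw : w ∈ p) : u • w ∈ p := by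
  let S : Subalgebra ℂ UVir :=
    { carrier := {u | ∀ w ∈ p, u • w ∈ p}
      mul_mem' := fun {a b} ha hb w hw => by rw [mul_smul]; exact ha _ (hb _ hw)
      add_mem' := fun {a b} ha hb w hw => by rw [add_smul]; exact p.add_mem (ha _ hw) (hb _ hw)
      algebraMap_mem' := fun r w hw => by rw [algebraMap_smul]; exact p.smul_mem r hw }
  exact mem_subalgebra S hL hC u w hw

/-- Operators satisfying the Virasoro relations with central charge `k` define a representation. -/
def virRep {A : Type*} [Ring A] [Algebra ℂ A] (ell : ℤ → A) (k : ℂ)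
    (h : ∀ m n, ell m * ell n - ell n * ell m = ((m - n : ℤ) : ℂ) • ell (m + n) +
      (if m + n = 0 then (((m : ℂ) ^ 3 - m) / 12) else 0) • (k • (1 : A))) :
    Vir →ₗ⁅ℂ⁆ A where
  __ := (Finsupp.linearCombination ℂ ell).comp Vir.coeffL +
    (LinearMap.toSpanSingleton ℂ A (k • (1 : A))).comp Vir.coeffC
  map_lie' {x y} := by
    set F : Vir →ₗ[ℂ] A := (Finsupp.linearCombination ℂ ell).comp Vir.coeffL +
      (LinearMap.toSpanSingleton ℂ A (k • (1 : A))).comp Vir.coeffC with hF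
    have hFL : ∀ n, F (Vir.L n) = ell n := fun n => by simp [hF]
    have hFC : F Vir.C = k • (1 : A) := by simp [hF]
    change F (Vir.bracketMap x y) = F x * F y - F y * F x
    induction x using Vir.induction_basis with
    | hL m =>
      induction y using Vir.induction_basis with
      | hL n =>
        rw [Vir.bracketMap_L_L, Vir.basisBracket, map_add, map_smul, map_smul, hFL, hFL, hFL,
          hFC, h]
      | hC => simp [hFC]
      | hadd a b ha hb => simp only [map_add, ha, hb, mul_add, add_mul]; abel
      | hsmul a b hb => simp only [map_smul, hb, smul_sub, mul_smul_comm, smul_mul_assoc]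
    | hC => simp [hFC]
    | hadd a b ha hb =>
      simp only [map_add, LinearMap.add_apply, ha, hb, mul_add, add_mul]; abel
    | hsmul a b hb =>
      simp only [map_smul, LinearMap.smul_apply, hb, smul_sub, mul_smul_comm, smul_mul_assoc]

lemma virRep_L {A : Type*} [Ring A] [Algebra ℂ A] (ell : ℤ → A) (k : ℂ) (h) (n : ℤ) :
    virRep ell k h (Vir.L n) = ell n := by
  change ((Finsupp.linearCombination ℂ ell).comp Vir.coeffL +
    (LinearMap.toSpanSingleton ℂ A (k • (1 : A))).comp Vir.coeffC) _ = _
  simp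

lemma virRep_C {A : Type*} [Ring A] [Algebra ℂ A] (ell : ℤ → A) (k : ℂ) (h) :
    virRep ell k h Vir.C = k • (1 : A) := by
  change ((Finsupp.linearCombination ℂ ell).comp Vir.coeffL +
    (LinearMap.toSpanSingleton ℂ A (k • (1 : A))).comp Vir.coeffC) _ = _
  simp

/-! # Binomial identities and finite sums -/

/-- The binomial coefficient `m choose j` for an integer `m`, as a complex number. -/
def cb (m : ℤ) (j : ℕ) : ℂ := ((Ring.choose m j : ℤ) : ℂ)

lemma cb_zero (m : ℤ) : cb m 0 = 1 := by simp [cb]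

lemma cb_succ_left (m : ℤ) (j : ℕ) : ((j : ℂ) + 1) * cb m (j + 1) = m * cb (m - 1) j := by
  have h := Ring.choose_smul_choose m (n := j + 1) (k := 1) (by omega)
  simp only [Nat.choose_one_right, Ring.choose_one_right, Nat.cast_one, Nat.add_sub_cancel,
    nsmul_eq_mul] at h
  unfold cb
  exact_mod_cast h

lemma cb_succ_right (m : ℤ) (j : ℕ) : ((j : ℂ) + 1) * cb m (j + 1) = (m - j) * cb m j := by
  have h := Ring.choose_smul_choose m (n := j + 1) (k := j) (by omega)
  simp only [Nat.choose_succ_self_right, Nat.add_sub_cancel_left, Ring.choose_one_right,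
    nsmul_eq_mul] at h
  unfold cb
  rw [mul_comm ((m : ℂ) - j)]
  exact_mod_cast h

lemma cb_absorb (m : ℤ) (j : ℕ) : ((m : ℂ) - j) * cb m j = m * cb (m - 1) j := by
  rw [← cb_succ_left, cb_succ_right]

lemma cb_vandermonde (m n : ℤ) (s : ℕ) :
    ∑ p ∈ antidiagonal s, cb m p.1 * cb n p.2 = cb (m + n) s := by
  unfold cb
  rw [Ring.add_choose_eq s (Commute.all m n)]
  push_cast
  rfl

lemma cb_sum_left (m n : ℤ) (s : ℕ) :
    ∑ p ∈ antidiagonal s, (cb m p.1 * cb n p.2) * (((m : ℂ) - 1 - p.1) - ((n : ℂ) - 1 - p.2)) =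
      ((m : ℂ) - n) * cb (m + n - 1) s := by
  have h1 := cb_vandermonde (m - 1) n s
  have h2 := cb_vandermonde m (n - 1) s
  rw [show m - 1 + n = m + n - 1 by ring] at h1
  rw [show m + (n - 1) = m + n - 1 by ring] at h2
  rw [sub_mul]
  nth_rw 1 [← h1]
  rw [← h2, mul_sum, mul_sum, ← sum_sub_distrib]
  refine sum_congr rfl fun p _ => ?_
  linear_combination cb n p.2 * cb_absorb m p.1 - cb m p.1 * cb_absorb n p.2

lemma cb_sum_central (m n : ℤ) (s : ℕ) :
    ∑ p ∈ antidiagonal s, (cb m p.1 * cb n p.2) *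
      ((((m : ℂ) - 1 - p.1) ^ 3 - ((m : ℂ) - 1 - p.1)) / 12) =
      ((((m : ℂ) - 1) ^ 3 - ((m : ℂ) - 1)) / 12) * cb (m + n - 3) s := by
  have h1 := cb_vandermonde (m - 3) n s
  rw [show m - 3 + n = m + n - 3 by ring] at h1
  rw [← h1, mul_sum]
  refine sum_congr rfl fun p _ => ?_
  have e1 := cb_absorb m p.1
  have e2 := cb_absorb (m - 1) p.1
  have e3 := cb_absorb (m - 2) p.1
  rw [show m - 1 - 1 = m - 2 by ring] at e2
  rw [show m - 2 - 1 = m - 3 by ring] at e3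
  push_cast at e2 e3
  linear_combination (cb n p.2 / 12) * (((m : ℂ) - 1 - p.1) * ((m : ℂ) - 2 - p.1) * e1 +
    (m : ℂ) * ((m : ℂ) - 2 - p.1) * e2 + (m : ℂ) * ((m : ℂ) - 1) * e3)

lemma cb_pred_self (s : ℕ) : cb ((s : ℤ) - 1) s = if s = 0 then 1 else 0 := by
  cases s with
  | zero => simp [cb]
  | succ t =>
    have : ((t + 1 : ℕ) : ℤ) - 1 = (t : ℤ) := by push_cast; ring
    rw [this, cb, Ring.choose_natCast, Nat.choose_succ_self]
    simp

lemma cb_sum_right_aux (m n : ℤ) (s : ℕ) :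
    ∑ p ∈ antidiagonal (s + 1), (cb m p.1 * cb n p.2) * (p.1 : ℂ) =
      (m : ℂ) * cb (m + n - 1) s := by
  have h1 := cb_vandermonde (m - 1) n s
  rw [show m - 1 + n = m + n - 1 by ring] at h1
  rw [← h1, mul_sum, Nat.sum_antidiagonal_succ]
  simp only [Nat.cast_zero, mul_zero, zero_add]
  refine sum_congr rfl fun p _ => ?_
  push_cast
  linear_combination cb n p.2 * cb_succ_left m p.1

lemma cb_sum_right (m n : ℤ) (s : ℕ) :
    ∑ p ∈ antidiagonal (s + 1), (cb m p.1 * cb n p.2) * ((p.2 : ℂ) - p.1) =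
      -(((m : ℂ) - n) * cb (m + n - 1) s) := by
  have h1 := cb_sum_right_aux m n s
  have h2 := cb_sum_right_aux n m s
  rw [← Nat.sum_antidiagonal_swap] at h2
  rw [add_comm n m] at h2
  simp only [Prod.fst_swap, Prod.snd_swap] at h2
  have : ((m : ℂ) - n) * cb (m + n - 1) s = m * cb (m + n - 1) s - n * cb (m + n - 1) s := by ring
  rw [this, ← h1, ← h2, ← sum_sub_distrib, ← sum_neg_distrib]
  refine sum_congr rfl fun p _ => ?_
  ring

section FinsumLemmas

variable {W : Type*} [AddCommGroup W]

lemma finsum_swap {α β : Type*} (G : α → β → W)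
    (h : (Function.support fun p : α × β => G p.1 p.2).Finite) :
    ∑ᶠ i, ∑ᶠ j, G i j = ∑ᶠ j, ∑ᶠ i, G i j := by
  rw [← finsum_curry (fun p : α × β => G p.1 p.2) h,
    ← finsum_curry (fun p : β × α => G p.2 p.1),
    ← finsum_comp_equiv (Equiv.prodComm β α) (f := fun p : α × β => G p.1 p.2)]
  · rfl
  · have := h.preimage (Equiv.prodComm β α).injective.injOn
    exact this

lemma finsum_antidiagonal (G : ℕ → ℕ → W)
    (h : (Function.support fun p : ℕ × ℕ => G p.1 p.2).Finite) :
    ∑ᶠ i, ∑ᶠ j, G i j = ∑ᶠ s, ∑ p ∈ antidiagonal s, G p.1 p.2 := by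
  have h1 : ∀ s, ∑ p ∈ antidiagonal s, G p.1 p.2 =
      ∑ᶠ p : ℕ × ℕ, if p.1 + p.2 = s then G p.1 p.2 else 0 := by
    intro s
    rw [finsum_eq_sum_of_support_subset (s := antidiagonal s)]
    · refine sum_congr rfl fun p hp => ?_
      rw [if_pos (mem_antidiagonal.mp hp)]
    · intro p hp
      simp only [Function.mem_support, ne_eq, ite_eq_right_iff, not_forall] at hp
      exact mem_coe.mpr (mem_antidiagonal.mpr hp.1)
  simp_rw [h1]
  rw [finsum_swap (fun s (p : ℕ × ℕ) => if p.1 + p.2 = s then G p.1 p.2 else 0),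
    ← finsum_curry (fun p : ℕ × ℕ => G p.1 p.2) h]
  · refine finsum_congr fun p => ?_
    rw [finsum_eq_single _ (p.1 + p.2)]
    · simp
    · intro s hs
      rw [if_neg (fun e => hs e.symm)]
  · refine (h.image fun p : ℕ × ℕ => (p.1 + p.2, p)).subset ?_
    rintro ⟨s, p⟩ hp
    simp only [Function.mem_support, ne_eq, ite_eq_right_iff, not_forall] at hp
    exact ⟨p, hp.2, by simp [hp.1]⟩

lemma finsum_nat_succ (f : ℕ → W) (h0 : f 0 = 0) : ∑ᶠ s, f s = ∑ᶠ s, f (s + 1) := by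
  have : ∑ᶠ s, f (s + 1) = ∑ᶠ s ∈ Set.range Nat.succ, f s := by
    rw [finsum_mem_range Nat.succ_injective]
  rw [this, ← finsum_mem_univ]
  refine finsum_mem_inter_support_eq' _ _ _ fun s hs => ?_
  cases s with
  | zero => exact absurd h0 hs
  | succ t => simp

lemma finite_support_of_bound {f : ℕ → W} (N : ℕ) (h : ∀ j, N ≤ j → f j = 0) :
    (Function.support f).Finite :=
  (Set.finite_lt_nat N).subset fun j hj => by
    by_contra hlt
    exact hj (h j (not_lt.mp hlt))

lemma finite_support_prod {f : ℕ × ℕ → W} (J : ℕ → ℕ) (N : ℕ)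
    (h1 : ∀ i j, N ≤ i → f (i, j) = 0) (h2 : ∀ i j, J i ≤ j → f (i, j) = 0) :
    (Function.support f).Finite := by
  refine ((range N).sigma fun i => range (J i)).finite_toSet.image
    (fun x : (_ : ℕ) × ℕ => (x.1, x.2)) |>.subset ?_
  rintro ⟨i, j⟩ hp
  refine ⟨⟨i, j⟩, ?_, rfl⟩
  simp only [coe_sigma, Set.mem_sigma_iff, mem_coe, mem_range]
  exact ⟨not_le.mp fun h => hp (h1 i j h), not_le.mp fun h => hp (h2 i j h)⟩

end FinsumLemmas

/-! # Fields -/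

section Fields

variable {W : Type*} [AddCommGroup W] [Module ℂ W]

/-- The field with prescribed modes `f n`, i.e. `∑ₙ f n z ^ (-n - 1)`. -/
def mkField (f : ℤ → Module.End ℂ W) (h : ∀ w, ∃ N : ℤ, ∀ n, N ≤ n → f n w = 0) :
    VertexOperator ℂ W :=
  VertexOperator.of_coeff (fun n => f (-n - 1)) fun w => by
    obtain ⟨N, hN⟩ := h w
    refine ⟨-N - 1, fun n hn => ?_⟩
    by_contra hlt
    exact hn (hN _ (by omega))

open VertexOperator

@[simp] lemma ncoeff_mkField (f : ℤ → Module.End ℂ W) (h) (n : ℤ) : ncoeff (mkField f h) n = f n := by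
  rw [mkField, ncoeff_of_coeff]
  congr 1
  ring

lemma field_ext {φ ψ : VertexOperator ℂ W} (h : ∀ n w, ncoeff φ n w = ncoeff ψ n w) : φ = ψ := by
  apply HVertexOperator.coeff_inj
  funext n
  have := h (-n - 1)
  rw [VertexOperator.coeff_eq_ncoeff, VertexOperator.coeff_eq_ncoeff]
  exact LinearMap.ext this

lemma field_trunc (φ : VertexOperator ℂ W) (w : W) : ∃ N : ℤ, ∀ n, N ≤ n → ncoeff φ n w = 0 := by
  refine ⟨-(HahnSeries.order ((HahnModule.of ℂ).symm (φ w))), fun n hn => ?_⟩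
  exact ncoeff_eq_zero_of_lt_order φ n w (by omega)

/-- The pointwise finite sum of a sequence of endomorphisms. -/
def finsumEnd (F : ℕ → Module.End ℂ W) (h : ∀ w, (Function.support fun j => F j w).Finite) :
    Module.End ℂ W where
  toFun w := ∑ᶠ j, F j w
  map_add' v w := by
    simp only [map_add]
    exact finsum_add_distrib (h v) (h w)
  map_smul' a w := by
    simp only [map_smul, RingHom.id_apply]
    exact (smul_finsum' a (h w)).symm

@[simp] lemma finsumEnd_apply (F : ℕ → Module.End ℂ W) (h) (w : W) :
    finsumEnd F h w = ∑ᶠ j, F j w := rfl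

/-- A family of operators `ell n` such that each vector is killed by `ell n` for large `n`. -/
def IsRestricted (ell : ℤ → Module.End ℂ W) : Prop := ∀ w, ∃ N : ℤ, ∀ n, N ≤ n → ell n w = 0

variable (ell : ℤ → Module.End ℂ W)

lemma leftProd_bound (φ : VertexOperator ℂ W) (w : W) : ∃ N : ℤ, ∀ k : ℤ, ∀ j : ℕ,
    N ≤ k + j → ncoeff φ (k + j) w = 0 := by
  obtain ⟨N, hN⟩ := field_trunc φ w
  exact ⟨N, fun k j h => hN _ h⟩

/-- With `T(z) = ∑ₙ ell n z ^ (-n - 2)`, the field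
`Res_z T(z) φ(x) (z - x) ^ m`, where `(z - x) ^ m` is expanded in nonnegative powers of `x`. -/
def leftProd (m : ℤ) : Module.End ℂ (VertexOperator ℂ W) where
  toFun φ := mkField
    (fun k => finsumEnd (fun j => ((-1) ^ j * cb m j) • (ell (m - 1 - j) * ncoeff φ (k + j))) fun w => by
      obtain ⟨N, hN⟩ := leftProd_bound φ w
      refine finite_support_of_bound (N - k).toNat fun j hj => ?_
      simp [hN k j (by omega)])
    fun w => by
      obtain ⟨N, hN⟩ := leftProd_bound φ w
      refine ⟨N, fun k hk => ?_⟩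
      simp only [finsumEnd_apply, LinearMap.smul_apply, Module.End.mul_apply]
      rw [finsum_eq_zero_of_forall_eq_zero]
      intro j
      simp [hN k j (by omega)]
  map_add' φ ψ := by
    refine field_ext fun k w => ?_
    obtain ⟨N, hN⟩ := leftProd_bound φ w
    obtain ⟨N', hN'⟩ := leftProd_bound ψ w
    simp only [ncoeff_mkField, map_add, Pi.add_apply, LinearMap.add_apply, finsumEnd_apply,
      mul_add, smul_add]
    refine finsum_add_distrib (finite_support_of_bound (N - k).toNat fun j hj => ?_)
      (finite_support_of_bound (N' - k).toNat fun j hj => ?_)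
    · simp [hN k j (by omega)]
    · simp [hN' k j (by omega)]
  map_smul' a φ := by
    refine field_ext fun k w => ?_
    obtain ⟨N, hN⟩ := leftProd_bound φ w
    simp only [ncoeff_mkField, map_smul, Pi.smul_apply, LinearMap.smul_apply, finsumEnd_apply,
      mul_smul_comm, RingHom.id_apply]
    rw [smul_finsum']
    · simp only [smul_comm a]
    · refine finite_support_of_bound (N - k).toNat fun j hj => ?_
      simp [hN k j (by omega)]

lemma leftProd_apply (m k : ℤ) (φ : VertexOperator ℂ W) (w : W) :
    ncoeff (leftProd ell m φ) k w =
      ∑ᶠ j : ℕ, ((-1) ^ j * cb m j) • ell (m - 1 - j) (ncoeff φ (k + j) w) := by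
  simp [leftProd]

variable {ell}

lemma IsRestricted.bound (hell : IsRestricted ell) (w : W) :
    ∃ N : ℕ, ∀ j : ℕ, N ≤ j → ell ((j : ℤ) - 1) w = 0 := by
  obtain ⟨N, hN⟩ := hell w
  exact ⟨(N + 1).toNat, fun j hj => hN _ (by omega)⟩

/-- With `T(z) = ∑ₙ ell n z ^ (-n - 2)`, the field
`Res_z φ(x) T(z) (z - x) ^ m`, where `(z - x) ^ m` is expanded in nonnegative powers of `z`. -/
def rightProd (hell : IsRestricted ell) (m : ℤ) : Module.End ℂ (VertexOperator ℂ W) where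
  toFun φ := mkField
    (fun k => finsumEnd
      (fun j => ((-1) ^ m * ((-1) ^ j * cb m j)) • (ncoeff φ (m + k - j) * ell (j - 1))) fun w => by
      obtain ⟨N, hN⟩ := hell.bound w
      refine finite_support_of_bound N fun j hj => ?_
      simp [hN j hj])
    fun w => by
      obtain ⟨N, hN⟩ := hell.bound w
      choose M hM using fun j : ℕ => field_trunc φ (ell (j - 1) w)
      obtain ⟨B, hB⟩ := ((range N).image M).bddAbove
      refine ⟨B + N - m, fun k hk => ?_⟩
      simp only [finsumEnd_apply, LinearMap.smul_apply, Module.End.mul_apply]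
      rw [finsum_eq_zero_of_forall_eq_zero]
      intro j
      rcases le_or_gt N j with hj | hj
      · simp [hN j hj]
      · have : M j ≤ B := hB (by
          simp only [coe_image, Set.mem_image, mem_coe, mem_range]; exact ⟨j, hj, rfl⟩)
        rw [hM j _ (by omega), smul_zero]
  map_add' φ ψ := by
    refine field_ext fun k w => ?_
    obtain ⟨N, hN⟩ := hell.bound w
    simp only [ncoeff_mkField, map_add, Pi.add_apply, LinearMap.add_apply, finsumEnd_apply,
      add_mul, smul_add]
    refine finsum_add_distrib (finite_support_of_bound N fun j hj => ?_)
      (finite_support_of_bound N fun j hj => ?_) <;> simp [hN j hj]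
  map_smul' a φ := by
    refine field_ext fun k w => ?_
    obtain ⟨N, hN⟩ := hell.bound w
    simp only [ncoeff_mkField, map_smul, Pi.smul_apply, LinearMap.smul_apply, finsumEnd_apply,
      smul_mul_assoc, RingHom.id_apply]
    rw [smul_finsum']
    · simp only [smul_comm a]
    · refine finite_support_of_bound N fun j hj => ?_
      simp [hN j hj]

lemma rightProd_apply (hell : IsRestricted ell) (m k : ℤ) (φ : VertexOperator ℂ W) (w : W) :
    ncoeff (rightProd hell m φ) k w =
      ∑ᶠ j : ℕ, ((-1) ^ m * ((-1) ^ j * cb m j)) • ncoeff φ (m + k - j) (ell (j - 1) w) := by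
  simp [rightProd]

lemma leftProd_leftProd (m n k : ℤ) (φ : VertexOperator ℂ W) (w : W) :
    ncoeff (leftProd ell m (leftProd ell n φ)) k w = ∑ᶠ s : ℕ, ∑ p ∈ antidiagonal s,
      ((-1) ^ s * (cb m p.1 * cb n p.2)) •
        ell (m - 1 - p.1) (ell (n - 1 - p.2) (ncoeff φ (k + s) w)) := by
  obtain ⟨N, hN⟩ := field_trunc φ w
  have h1 : ∀ i : ℕ, ((-1) ^ i * cb m i) • ell (m - 1 - i) (ncoeff (leftProd ell n φ) (k + i) w) =
      ∑ᶠ j : ℕ, ((-1) ^ (i + j) * (cb m i * cb n j)) •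
        ell (m - 1 - i) (ell (n - 1 - j) (ncoeff φ (k + (i + j : ℕ)) w)) := by
    intro i
    rw [leftProd_apply, map_finsum (ell (m - 1 - i)), smul_finsum']
    · refine finsum_congr fun j => ?_
      rw [map_smul, smul_smul, pow_add]
      push_cast
      rw [add_assoc]
      congr 1
      ring
    · refine finite_support_of_bound (N - k).toNat fun j hj => ?_
      simp [hN (k + i + j) (by omega)]
    · refine finite_support_of_bound (N - k).toNat fun j hj => ?_
      simp [hN (k + i + j) (by omega)]
  rw [leftProd_apply, finsum_congr h1, finsum_antidiagonal]
  · refine finsum_congr fun s => sum_congr rfl fun p hp => ?_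
    rw [mem_antidiagonal.mp hp]
  · refine finite_support_prod (fun _ => (N - k).toNat) (N - k).toNat ?_ ?_ <;>
    · intro i j h
      dsimp only
      rw [hN (k + (i + j : ℕ)) (by omega)]
      simp

lemma rightProd_rightProd (hell : IsRestricted ell) (m n k : ℤ) (φ : VertexOperator ℂ W) (w : W) :
    ncoeff (rightProd hell m (rightProd hell n φ)) k w = ∑ᶠ s : ℕ, ∑ p ∈ antidiagonal s,
      ((-1) ^ (m + n) * ((-1) ^ s * (cb m p.1 * cb n p.2))) •
        ncoeff φ (m + n + k - s) (ell (p.2 - 1) (ell (p.1 - 1) w)) := by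
  obtain ⟨N, hN⟩ := hell.bound w
  choose M hM using fun i : ℕ => hell.bound (ell (i - 1) w)
  have h1 : ∀ i : ℕ, ((-1) ^ m * ((-1) ^ i * cb m i)) •
      ncoeff (rightProd hell n φ) (m + k - i) (ell (i - 1) w) =
      ∑ᶠ j : ℕ, ((-1) ^ (m + n) * ((-1) ^ (i + j) * (cb m i * cb n j))) •
        ncoeff φ (m + n + k - (i + j : ℕ)) (ell (j - 1) (ell (i - 1) w)) := by
    intro i
    rw [rightProd_apply, smul_finsum']
    · refine finsum_congr fun j => ?_
      rw [smul_smul, pow_add, zpow_add₀ (by norm_num)]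
      push_cast
      rw [show n + (m + k - (i : ℤ)) - j = m + n + k - (i + j) by ring]
      congr 1
      ring
    · refine finite_support_of_bound (M i) fun j hj => ?_
      simp [hM i j hj]
  rw [rightProd_apply, finsum_congr h1, finsum_antidiagonal]
  · refine finsum_congr fun s => sum_congr rfl fun p hp => ?_
    rw [mem_antidiagonal.mp hp]
  · refine finite_support_prod M N ?_ ?_
    · intro i j h
      simp [hN i h]
    · intro i j h
      simp [hM i j h]

lemma leftProd_rightProd_comm (hell : IsRestricted ell) (m n : ℤ) :
    leftProd ell m * rightProd hell n = rightProd hell n * leftProd ell m := by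
  ext φ : 1
  refine field_ext fun k w => ?_
  obtain ⟨N, hN⟩ := hell.bound w
  choose M hM using fun j : ℕ => field_trunc φ (ell (j - 1) w)
  rw [Module.End.mul_apply, Module.End.mul_apply, leftProd_apply, rightProd_apply]
  have h1 : ∀ i : ℕ, ((-1) ^ i * cb m i) • ell (m - 1 - i) (ncoeff (rightProd hell n φ) (k + i) w) =
      ∑ᶠ j : ℕ, (((-1) ^ i * cb m i) * ((-1) ^ n * ((-1) ^ j * cb n j))) •
        ell (m - 1 - i) (ncoeff φ (n + k + i - j) (ell (j - 1) w)) := by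
    intro i
    rw [rightProd_apply, map_finsum (ell (m - 1 - i)), smul_finsum']
    · refine finsum_congr fun j => ?_
      rw [map_smul, smul_smul, ← add_assoc]
    · refine finite_support_of_bound N fun j hj => ?_
      simp [hN j hj]
    · refine finite_support_of_bound N fun j hj => ?_
      simp [hN j hj]
  have h2 : ∀ j : ℕ, ((-1) ^ n * ((-1) ^ j * cb n j)) •
      ncoeff (leftProd ell m φ) (n + k - j) (ell (j - 1) w) =
      ∑ᶠ i : ℕ, (((-1) ^ i * cb m i) * ((-1) ^ n * ((-1) ^ j * cb n j))) •
        ell (m - 1 - i) (ncoeff φ (n + k + i - j) (ell (j - 1) w)) := by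
    intro j
    rw [leftProd_apply, smul_finsum']
    · refine finsum_congr fun i => ?_
      rw [smul_smul, mul_comm ((-1) ^ n * _), show n + k - (j : ℤ) + i = n + k + i - j by ring]
    · refine finite_support_of_bound (M j - (n + k - j)).toNat fun i hi => ?_
      rw [hM j _ (by omega), map_zero, smul_zero]
  rw [finsum_congr h1, finsum_congr h2, ← finsum_swap]
  refine finite_support_prod (fun j => (M j - (n + k - j)).toNat) N ?_ ?_
  · intro j i h
    simp [hN j h]
  · intro j i h
    dsimp only
    rw [hM j _ (by omega), map_zero, smul_zero]

lemma commutator_leftProd {c : ℂ} (hvir : ∀ m n, ell m * ell n - ell n * ell m =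
      ((m - n : ℤ) : ℂ) • ell (m + n) +
      (if m + n = 0 then (((m : ℂ) ^ 3 - m) / 12) else 0) • (c • (1 : Module.End ℂ W))) (m n : ℤ) :
    leftProd ell m * leftProd ell n - leftProd ell n * leftProd ell m =
      ((m - n : ℤ) : ℂ) • leftProd ell (m + n - 1) +
      (if m + n = 2 then ((((m : ℂ) - 1) ^ 3 - ((m : ℂ) - 1)) / 12) else 0) •
        (c • (1 : Module.End ℂ (VertexOperator ℂ W))) := by
  ext φ : 1
  refine field_ext fun k w => ?_
  obtain ⟨N, hN⟩ := field_trunc φ w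
  simp only [LinearMap.sub_apply, LinearMap.add_apply, LinearMap.smul_apply, map_sub, map_add,
    map_smul, Pi.sub_apply, Pi.add_apply, Pi.smul_apply, Module.End.mul_apply,
    Module.End.one_apply]
  rw [leftProd_leftProd, leftProd_leftProd, leftProd_apply]
  have hz : ∀ s : ℕ, (N - k).toNat ≤ s → ncoeff φ (k + s) w = 0 := fun s hs => hN _ (by omega)
  have hdelta : (if m + n = 2 then ((((m : ℂ) - 1) ^ 3 - ((m : ℂ) - 1)) / 12) else 0) •
      (c • ncoeff φ k w) = ∑ᶠ s : ℕ, (if s = 0 ∧ m + n = 2 then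
        ((((m : ℂ) - 1) ^ 3 - ((m : ℂ) - 1)) / 12) else 0) • (c • ncoeff φ (k + s) w) := by
    rw [finsum_eq_single _ 0]
    · simp
    · intro s hs
      simp [hs]
  rw [hdelta, smul_finsum', ← finsum_sub_distrib, ← finsum_add_distrib]
  · refine finsum_congr fun s => ?_
    rw [← Nat.sum_antidiagonal_swap (n := s) (f := fun p : ℕ × ℕ =>
      ((-1) ^ s * (cb n p.1 * cb m p.2)) •
        ell (n - 1 - p.1) (ell (m - 1 - p.2) (ncoeff φ (k + s) w))), ← sum_sub_distrib]
    set u := ncoeff φ (k + s) w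
    have key : ∀ p ∈ antidiagonal s,
        ((-1) ^ s * (cb m p.1 * cb n p.2)) • ell (m - 1 - p.1) (ell (n - 1 - p.2) u) -
        ((-1) ^ s * (cb n p.swap.1 * cb m p.swap.2)) •
          ell (n - 1 - p.swap.1) (ell (m - 1 - p.swap.2) u) =
        ((-1) ^ s * ((cb m p.1 * cb n p.2) * (((m : ℂ) - 1 - p.1) - ((n : ℂ) - 1 - p.2)))) •
          ell (m + n - 2 - s) u +
        ((-1) ^ s * ((cb m p.1 * cb n p.2) *
          ((((m : ℂ) - 1 - p.1) ^ 3 - ((m : ℂ) - 1 - p.1)) / 12))) •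
          ((if m + n - 2 = s then (1 : ℂ) else 0) • (c • u)) := by
      intro p hp
      have hs : (p.1 : ℤ) + p.2 = s := by exact_mod_cast mem_antidiagonal.mp hp
      have h := congrArg (fun A : Module.End ℂ W => A u) (hvir (m - 1 - p.1) (n - 1 - p.2))
      simp only [LinearMap.sub_apply, LinearMap.add_apply, LinearMap.smul_apply,
        Module.End.mul_apply, Module.End.one_apply] at h
      rw [show m - 1 - (p.1 : ℤ) + (n - 1 - p.2) = m + n - 2 - s by rw [← hs]; ring] at h
      rw [Prod.fst_swap, Prod.snd_swap, mul_comm (cb n p.2), ← smul_sub, h]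
      by_cases e : m + n - 2 = s
      · simp only [e, sub_self, if_true]
        push_cast
        module
      · rw [if_neg e, if_neg (fun h' => e (by omega))]
        push_cast
        module
    rw [sum_congr rfl key, sum_add_distrib, ← sum_smul, ← sum_smul, ← mul_sum, ← mul_sum,
      cb_sum_left, cb_sum_central]
    congr 1
    · rw [smul_smul, show m + n - 1 - 1 - (s : ℤ) = m + n - 2 - s by ring]
      push_cast
      congr 1
      ring
    · rw [smul_smul]
      congr 1
      by_cases e : m + n - 2 = s
      · rw [if_pos e, show m + n - 3 = (s : ℤ) - 1 by omega, cb_pred_self]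
        by_cases e0 : s = 0
        · subst e0
          rw [if_pos rfl, if_pos ⟨rfl, by simpa [sub_eq_zero] using e⟩]
          simp
        · simp [e0]
      · rw [if_neg e, if_neg, mul_zero]
        rintro ⟨rfl, h2⟩
        exact e (by simp [h2])
  · refine finite_support_of_bound (N - k).toNat fun s hs => ?_
    simp [hz s hs]
  · refine finite_support_of_bound (N - k).toNat fun s hs => ?_
    simp [hz s hs]
  · refine finite_support_of_bound (N - k).toNat fun s hs => ?_
    simp [hz s hs]
  · refine finite_support_of_bound (N - k).toNat fun s hs => ?_
    simp [hz s hs]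
  · refine finite_support_of_bound (N - k).toNat fun s hs => ?_
    simp [hz s hs]

lemma commutator_rightProd {c : ℂ} (hell : IsRestricted ell)
    (hvir : ∀ m n, ell m * ell n - ell n * ell m = ((m - n : ℤ) : ℂ) • ell (m + n) +
      (if m + n = 0 then (((m : ℂ) ^ 3 - m) / 12) else 0) • (c • (1 : Module.End ℂ W))) (m n : ℤ) :
    rightProd hell m * rightProd hell n - rightProd hell n * rightProd hell m =
      -(((m - n : ℤ) : ℂ) • rightProd hell (m + n - 1)) := by
  ext φ : 1
  refine field_ext fun k w => ?_
  obtain ⟨N, hN⟩ := hell.bound w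
  choose M hM using fun i : ℕ => hell.bound (ell (i - 1) w)
  obtain ⟨B, hB⟩ := ((range N).image M).bddAbove
  have hz : ∀ i j : ℕ, N + B ≤ i + j → ell (j - 1) (ell (i - 1) w) = 0 := by
    intro i j hij
    rcases le_or_gt N i with hi | hi
    · simp [hN i hi]
    · have : M i ≤ B := hB (by
        simp only [coe_image, Set.mem_image, mem_coe, mem_range]; exact ⟨i, hi, rfl⟩)
      exact hM i j (by omega)
  simp only [LinearMap.sub_apply, LinearMap.neg_apply, LinearMap.smul_apply, map_sub, map_neg,
    map_smul, Pi.sub_apply, Pi.neg_apply, Pi.smul_apply, Module.End.mul_apply]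
  rw [rightProd_rightProd, rightProd_rightProd, rightProd_apply]
  have hfin : ∀ m n : ℤ, (Function.support fun s : ℕ => ∑ p ∈ antidiagonal s,
      ((-1) ^ (m + n) * ((-1) ^ s * (cb m p.1 * cb n p.2))) •
        ncoeff φ (m + n + k - s) (ell (p.2 - 1) (ell (p.1 - 1) w))).Finite := by
    intro m n
    refine finite_support_of_bound (N + B) fun s hs => sum_eq_zero fun p hp => ?_
    rw [hz p.1 p.2 (by rw [mem_antidiagonal.mp hp]; exact hs)]
    simp
  rw [← finsum_sub_distrib (hfin m n) (hfin n m), finsum_nat_succ, smul_finsum',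
    ← finsum_neg_distrib]
  · refine finsum_congr fun s => ?_
    rw [← Nat.sum_antidiagonal_swap (n := s + 1) (f := fun p : ℕ × ℕ =>
      ((-1) ^ (n + m) * ((-1) ^ (s + 1) * (cb n p.1 * cb m p.2))) •
        ncoeff φ (n + m + k - (s + 1 : ℕ)) (ell (p.2 - 1) (ell (p.1 - 1) w))),
      ← sum_sub_distrib]
    have key : ∀ p ∈ antidiagonal (s + 1),
        ((-1) ^ (m + n) * ((-1) ^ (s + 1) * (cb m p.1 * cb n p.2))) •
          ncoeff φ (m + n + k - (s + 1 : ℕ)) (ell (p.2 - 1) (ell (p.1 - 1) w)) -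
        ((-1) ^ (n + m) * ((-1) ^ (s + 1) * (cb n p.swap.1 * cb m p.swap.2))) •
          ncoeff φ (n + m + k - (s + 1 : ℕ)) (ell (p.swap.2 - 1) (ell (p.swap.1 - 1) w)) =
        ((-1) ^ (m + n) * ((-1) ^ (s + 1) * ((cb m p.1 * cb n p.2) * ((p.2 : ℂ) - p.1)))) •
          ncoeff φ (m + n + k - (s + 1 : ℕ)) (ell (s - 1) w) := by
      intro p hp
      have hs : (p.1 : ℤ) + p.2 = s + 1 := by exact_mod_cast mem_antidiagonal.mp hp
      have h := congrArg (fun A : Module.End ℂ W => A w) (hvir (p.2 - 1) (p.1 - 1))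
      simp only [LinearMap.sub_apply, LinearMap.add_apply, LinearMap.smul_apply,
        Module.End.mul_apply, Module.End.one_apply] at h
      rw [show (p.2 : ℤ) - 1 + (p.1 - 1) = s - 1 by omega] at h
      have h0 : (if (s : ℤ) - 1 = 0 then ((((p.2 - 1 : ℤ) : ℂ) ^ 3 - (p.2 - 1 : ℤ)) / 12) else 0)
          = 0 := by
        split_ifs with e
        · have : p.2 = 0 ∨ p.2 = 1 ∨ p.2 = 2 := by omega
          rcases this with e | e | e <;> rw [e] <;> norm_num
        · rfl
      rw [h0, zero_smul, add_zero] at h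
      rw [Prod.fst_swap, Prod.snd_swap, mul_comm (cb n p.2), add_comm n m, ← smul_sub, ← map_sub,
        h, map_smul, smul_smul]
      congr 1
      push_cast
      ring
    rw [sum_congr rfl key, ← sum_smul, ← mul_sum, ← mul_sum, cb_sum_right, smul_smul, ← neg_smul]
    rw [show m + n + k - ((s + 1 : ℕ) : ℤ) = m + n - 1 + k - s by push_cast; ring]
    congr 1
    rw [show m + n = (m + n - 1) + 1 by ring, zpow_add₀ (by norm_num)]
    simp only [add_sub_cancel_right, zpow_one, pow_succ]
    push_cast
    ring
  · refine finite_support_of_bound N fun j hj => ?_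
    simp [hN j hj]
  · simp only [Nat.antidiagonal_zero, sum_singleton, cb_zero]
    rw [add_comm n m, sub_self]

end Fields

/-! ### Modules over the Virasoro algebra -/

section VirModules

open VertexOperator

/-- The action of `Lₙ` on a `U(Vir)`-module. -/
def opL (W : Type*) [AddCommGroup W] [Module ℂ W] [Module UVir W] [IsScalarTower ℂ UVir W]
    (n : ℤ) : Module.End ℂ W :=
  Algebra.lsmul ℂ ℂ W (Lu n)

/-- The `L₀`-eigenspace with eigenvalue `μ`. -/
def weightSpace (W : Type*) [AddCommGroup W] [Module ℂ W] [Module UVir W]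
    [IsScalarTower ℂ UVir W] (μ : ℂ) : Submodule ℂ W :=
  Module.End.eigenspace (opL W 0) μ

/-- `W` has central charge `c` and is the sum of its `L₀`-eigenspaces with eigenvalues in
`h + ℕ`, for some `h`. -/
class IsGradedVirModule (c : ℂ) (W : Type*) [AddCommGroup W] [Module ℂ W] [Module UVir W]
    [IsScalarTower ℂ UVir W] : Prop where
  central : ∀ w : W, Cu • w = c • w
  graded : ∃ h : ℂ, ⨆ n : ℕ, weightSpace W (h + n) = ⊤

variable {W : Type*} [AddCommGroup W] [Module ℂ W] [Module UVir W] [IsScalarTower ℂ UVir W]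

@[simp] lemma opL_apply (n : ℤ) (w : W) : opL W n w = Lu n • w := rfl

lemma mem_weightSpace {μ : ℂ} {w : W} : w ∈ weightSpace W μ ↔ Lu 0 • w = μ • w :=
  Module.End.mem_eigenspace_iff

lemma Lu_smul_smul (m n : ℤ) (w : W) : Lu m • Lu n • w = Lu n • Lu m • w +
    (((m - n : ℤ) : ℂ) • Lu (m + n) • w +
      (if m + n = 0 then (((m : ℂ) ^ 3 - m) / 12) else 0) • Cu • w) := by
  rw [← mul_smul, Lu_mul, add_smul, add_smul, mul_smul, smul_assoc (((m - n : ℤ) : ℂ)),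
    smul_assoc (if m + n = 0 then (((m : ℂ) ^ 3 - m) / 12) else 0)]

lemma Lu_smul_comm (n : ℤ) (a : ℂ) (w : W) : Lu n • a • w = a • Lu n • w :=
  (opL W n).map_smul a w

lemma Lu_mem_weightSpace (n : ℤ) {μ : ℂ} {w : W} (hw : w ∈ weightSpace W μ) :
    Lu n • w ∈ weightSpace W (μ - n) := by
  rw [mem_weightSpace] at hw ⊢
  rw [Lu_smul_smul, hw, Lu_smul_comm, zero_add]
  have : (if n = 0 then ((((0 : ℤ) : ℂ) ^ 3 - (0 : ℤ)) / 12) else 0) = 0 := by simp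
  rw [this]
  generalize Lu n • w = x
  generalize Cu • w = y
  push_cast
  module

lemma iSupIndep_weightSpace : iSupIndep (weightSpace W) :=
  Module.End.eigenspaces_iSupIndep (opL W 0)

lemma weightSpace_eq_bot {h : ℂ} (hW : ⨆ n : ℕ, weightSpace W (h + n) = ⊤) {μ : ℂ}
    (hμ : ∀ n : ℕ, μ ≠ h + n) : weightSpace W μ = ⊥ := by
  have h1 := iSupIndep_weightSpace (W := W) μ
  have h2 : (⊤ : Submodule ℂ W) ≤ ⨆ ν, ⨆ (_ : ν ≠ μ), weightSpace W ν := by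
    rw [← hW]
    exact iSup_le fun n => le_iSup₂_of_le (h + n) (hμ n).symm le_rfl
  rw [top_le_iff.mp h2, disjoint_top] at h1
  exact h1

end VirModules

section CentralCharge

open VertexOperator

variable (c : ℂ) (W : Type*) [AddCommGroup W] [Module ℂ W] [Module UVir W]
  [IsScalarTower ℂ UVir W] [IsGradedVirModule c W]

lemma opL_commutator (m n : ℤ) : opL W m * opL W n - opL W n * opL W m =
    ((m - n : ℤ) : ℂ) • opL W (m + n) +
      (if m + n = 0 then (((m : ℂ) ^ 3 - m) / 12) else 0) • (c • (1 : Module.End ℂ W)) := by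
  ext w
  have h := Lu_smul_smul m n w
  rw [IsGradedVirModule.central (c := c) w] at h
  simp only [LinearMap.sub_apply, Module.End.mul_apply, opL_apply, LinearMap.add_apply,
    LinearMap.smul_apply, Module.End.one_apply]
  rw [h]
  abel

lemma isRestricted_opL (c : ℂ) (W : Type*) [AddCommGroup W] [Module ℂ W] [Module UVir W]
    [IsScalarTower ℂ UVir W] [IsGradedVirModule c W] : IsRestricted (opL W) := by
  obtain ⟨h, hW⟩ := IsGradedVirModule.graded (c := c) (W := W)
  intro w
  have hw : w ∈ ⨆ n : ℕ, weightSpace W (h + n) := hW ▸ Submodule.mem_top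
  induction hw using Submodule.iSup_induction' with
  | mem k w hw =>
    refine ⟨k + 1, fun n hn => ?_⟩
    have h1 := Lu_mem_weightSpace n hw
    rw [weightSpace_eq_bot hW] at h1
    · exact (Submodule.mem_bot ℂ).mp h1
    · intro r hr
      have : (k : ℂ) - n = r := by linear_combination hr
      have : (k : ℤ) - n = r := by exact_mod_cast this
      omega
  | zero => exact ⟨0, by simp⟩
  | add v w _ _ hv hw =>
    obtain ⟨N, hN⟩ := hv
    obtain ⟨M, hM⟩ := hw
    refine ⟨max N M, fun n hn => ?_⟩
    rw [map_add, hN n (by omega), hM n (by omega), add_zero]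

/-- The action of `Lₘ` on fields by `φ ↦ Res_z (z - x) ^ (m + 1) [T(z), φ(x)]`, where
`T(z) = ∑ₙ Lₙ z ^ (-n - 2)`. This is the `(m + 1)`-st residue product of `T` with `φ`. -/
def fieldL (m : ℤ) : Module.End ℂ (VertexOperator ℂ W) :=
  leftProd (opL W) (m + 1) - rightProd (isRestricted_opL c W) (m + 1)

lemma commutator_sub {A : Type*} [Ring A] {P P' Q Q' : A} (e1 : P * Q' = Q' * P)
    (e2 : P' * Q = Q * P') : (P - Q) * (P' - Q') - (P' - Q') * (P - Q) =
      (P * P' - P' * P) + (Q * Q' - Q' * Q) := by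
  rw [sub_mul, sub_mul, mul_sub, mul_sub, mul_sub, mul_sub, e1, e2]
  abel

lemma fieldL_commutator (m n : ℤ) : fieldL c W m * fieldL c W n - fieldL c W n * fieldL c W m =
    ((m - n : ℤ) : ℂ) • fieldL c W (m + n) +
      (if m + n = 0 then (((m : ℂ) ^ 3 - m) / 12) else 0) •
        (c • (1 : Module.End ℂ (VertexOperator ℂ W))) := by
  have h1 := commutator_leftProd (opL_commutator c W) (m + 1) (n + 1)
  have h2 := commutator_rightProd (isRestricted_opL c W) (opL_commutator c W) (m + 1) (n + 1)
  have h3 := leftProd_rightProd_comm (isRestricted_opL c W) (m + 1) (n + 1)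
  have h4 := leftProd_rightProd_comm (isRestricted_opL c W) (n + 1) (m + 1)
  unfold fieldL
  rw [show m + 1 + (n + 1) - 1 = m + n + 1 by ring] at h1 h2
  rw [show m + 1 - (n + 1) = m - n by ring] at h1 h2
  have e : (m + 1 + (n + 1) = 2) ↔ (m + n = 0) := by omega
  simp only [e] at h1
  push_cast at h1
  rw [add_sub_cancel_right] at h1
  push_cast at h2 ⊢
  refine (commutator_sub (A := Module.End ℂ (VertexOperator ℂ W)) h3 h4).trans ?_
  rw [h1, h2]
  module

/-- The space of fields on `W`, as a `U(Vir)`-module through `fieldL`. -/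
def FieldModule (_c : ℂ) (W : Type*) [AddCommGroup W] [Module ℂ W] : Type _ := VertexOperator ℂ W

instance : AddCommGroup (FieldModule c W) := inferInstanceAs (AddCommGroup (VertexOperator ℂ W))
instance : Module ℂ (FieldModule c W) := inferInstanceAs (Module ℂ (VertexOperator ℂ W))

/-- The representation of `U(Vir)` on the space of fields. -/
def fieldRep : UVir →ₐ[ℂ] Module.End ℂ (VertexOperator ℂ W) :=
  UniversalEnvelopingAlgebra.lift ℂ (virRep (fieldL c W) c (fieldL_commutator c W))

lemma fieldRep_Lu (m : ℤ) : fieldRep c W (Lu m) = fieldL c W m := by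
  rw [fieldRep, Lu, UniversalEnvelopingAlgebra.lift_ι_apply, virRep_L]

lemma fieldRep_Cu : fieldRep c W Cu = c • 1 := by
  rw [fieldRep, Cu, UniversalEnvelopingAlgebra.lift_ι_apply, virRep_C]

instance : Module UVir (FieldModule c W) :=
  Module.compHom (VertexOperator ℂ W) (fieldRep c W).toRingHom

lemma UVir_smul_field (u : UVir) (φ : FieldModule c W) : u • φ = fieldRep c W u φ := rfl

instance : IsScalarTower ℂ UVir (FieldModule c W) where
  smul_assoc a u φ := by
    rw [UVir_smul_field, map_smul]
    rfl

lemma Lu_smul_field (m : ℤ) (φ : FieldModule c W) : Lu m • φ = fieldL c W m φ := by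
  rw [UVir_smul_field, fieldRep_Lu]

lemma Cu_smul_field (φ : FieldModule c W) : Cu • φ = c • φ := by
  rw [UVir_smul_field, fieldRep_Cu]
  rfl

/-- The constant field `id_W`. -/
def idField (W : Type*) [AddCommGroup W] [Module ℂ W] : VertexOperator ℂ W :=
  mkField (fun n => if n = -1 then 1 else 0) fun w => ⟨0, fun n hn => by
    rw [if_neg (by omega)]; rfl⟩

/-- The field `id_W` as an element of `FieldModule c W`. -/
def FieldModule.one (c : ℂ) (W : Type*) [AddCommGroup W] [Module ℂ W] : FieldModule c W :=
  idField W

lemma fieldL_idField (m : ℕ) : fieldL c W ((m : ℤ) - 1) (idField W) = 0 := by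
  refine field_ext fun k w => ?_
  simp only [fieldL, LinearMap.sub_apply, map_sub, Pi.sub_apply, map_zero, Pi.zero_apply,
    LinearMap.zero_apply, leftProd_apply, rightProd_apply, idField, ncoeff_mkField,
    sub_add_cancel]
  rw [sub_eq_zero]
  have hcb : ∀ j : ℕ, m < j → cb m j = 0 := by
    intro j hj
    rw [cb, Ring.choose_natCast, Nat.choose_eq_zero_of_lt hj]
    simp
  by_cases hk : ∃ j : ℕ, j ≤ m ∧ k = -1 - j
  · obtain ⟨j, hj, rfl⟩ := hk
    rw [finsum_eq_single _ j, finsum_eq_single _ (m - j)]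
    · rw [if_pos (by ring), if_pos (by push_cast [hj]; ring)]
      simp only [Module.End.one_apply]
      have e1 : (m : ℤ) - 1 - j = ((m - j : ℕ) : ℤ) - 1 := by push_cast [hj]; ring
      have e2 : cb m (m - j) = cb m j := by
        rw [cb, cb, Ring.choose_natCast, Ring.choose_natCast, Nat.choose_symm hj]
      rw [e1, e2]
      congr 1
      rw [zpow_natCast, ← mul_assoc, ← pow_add]
      congr 1
      obtain ⟨d, rfl⟩ := Nat.exists_eq_add_of_le hj
      rw [show j + d + (j + d - j) = j + (2 * d) by omega, pow_add, pow_mul]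
      simp
    · intro i hi
      rw [if_neg (by omega)]
      simp
    · intro i hi
      rw [if_neg (by omega)]
      simp
  · rw [finsum_eq_zero_of_forall_eq_zero, finsum_eq_zero_of_forall_eq_zero]
    · intro j
      rcases lt_or_ge m j with hj | hj
      · simp [hcb j hj]
      · rw [if_neg]
        · simp
        · intro h
          exact hk ⟨m - j, by omega, by push_cast [hj]; omega⟩
    · intro j
      rcases lt_or_ge m j with hj | hj
      · simp [hcb j hj]
      · rw [if_neg]
        · simp
        · intro h
          exact hk ⟨j, by omega, by omega⟩

end CentralCharge

section Modules

open VertexOperator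

variable {W : Type*} [AddCommGroup W] [Module ℂ W] [Module UVir W] [IsScalarTower ℂ UVir W]

/-! ### Verma modules and the Virasoro vertex operator algebra -/

/-- The left ideal of `U(Vir)` generated by `Lₙ` for `n > 0`, `L₀ - h` and `C - c`. -/
def vermaIdeal (h c : ℂ) : Submodule UVir UVir :=
  Submodule.span UVir ({u | ∃ n : ℤ, 0 < n ∧ u = Lu n} ∪
    {Lu 0 - algebraMap ℂ UVir h, Cu - algebraMap ℂ UVir c})

/-- The Verma module `M(h, c)`. -/
abbrev Verma (h c : ℂ) : Type := UVir ⧸ vermaIdeal h c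

/-- The highest weight vector of `M(h, c)`. -/
def Verma.hwVector (h c : ℂ) : Verma h c := (vermaIdeal h c).mkQ 1

/-- The quotient `M_c` of `M(0, c)` by the submodule generated by `L₋₁ v`, where `v` is the
highest weight vector of `M(0, c)`. -/
abbrev VirVOA (c : ℂ) : Type :=
  Verma 0 c ⧸ Submodule.span UVir {Lu (-1) • Verma.hwVector 0 c}

/-- The vacuum vector of `M_c`. -/
def VirVOA.vacuum (c : ℂ) : VirVOA c := Submodule.mkQ _ (Verma.hwVector 0 c)

/-- The conformal vector `ω = L₋₂ 1` of `M_c`. -/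
def VirVOA.omega (c : ℂ) : VirVOA c := Lu (-2) • VirVOA.vacuum c

lemma mk_smul_one (h c : ℂ) (u : UVir) :
    u • Verma.hwVector h c = (vermaIdeal h c).mkQ u := by
  rw [Verma.hwVector, ← map_smul, smul_eq_mul, mul_one]

lemma Verma.Lu_hw (h c : ℂ) {n : ℤ} (hn : 0 < n) : Lu n • Verma.hwVector h c = 0 := by
  rw [mk_smul_one, Submodule.mkQ_apply, Submodule.Quotient.mk_eq_zero]
  exact Submodule.subset_span (Or.inl ⟨n, hn, rfl⟩)

lemma Verma.Lu_zero_hw (h c : ℂ) : Lu 0 • Verma.hwVector h c = h • Verma.hwVector h c := by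
  rw [← sub_eq_zero, ← algebraMap_smul UVir h, ← sub_smul, mk_smul_one, Submodule.mkQ_apply,
    Submodule.Quotient.mk_eq_zero]
  exact Submodule.subset_span (Or.inr (Or.inl rfl))

lemma Verma.Cu_hw (h c : ℂ) : Cu • Verma.hwVector h c = c • Verma.hwVector h c := by
  rw [← sub_eq_zero, ← algebraMap_smul UVir c, ← sub_smul, mk_smul_one, Submodule.mkQ_apply,
    Submodule.Quotient.mk_eq_zero]
  exact Submodule.subset_span (Or.inr (Or.inr rfl))

lemma Verma.exists_smul (h c : ℂ) (w : Verma h c) : ∃ u : UVir, u • Verma.hwVector h c = w := by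
  obtain ⟨u, rfl⟩ := Submodule.mkQ_surjective _ w
  exact ⟨u, mk_smul_one h c u⟩

lemma VirVOA.smul_vacuum (c : ℂ) (u : UVir) :
    u • VirVOA.vacuum c = Submodule.mkQ _ (u • Verma.hwVector 0 c) := by
  rw [VirVOA.vacuum, ← map_smul]

/-- The monomials `L₋ⱼ₁ ⋯ L₋ⱼᵣ v` with all `jᵢ > 0`, indexed by `j₁ + ⋯ + jᵣ`. -/
inductive Monomial (v : W) : ℤ → W → Prop
  | base : Monomial v 0 v
  | step {k : ℤ} {w : W} {j : ℤ} : Monomial v k w → 0 < j → Monomial v (k + j) (Lu (-j) • w)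

lemma Monomial.nonneg {W : Type*} [AddCommGroup W] [Module UVir W] {v : W} {k : ℤ} {w : W} (hw : Monomial v k w) : 0 ≤ k := by
  induction hw with
  | base => exact le_rfl
  | step _ hj ih => omega

lemma Monomial.mem_weightSpace {h : ℂ} {v : W} (hv : Lu 0 • v = h • v) {k : ℤ} {w : W}
    (hw : Monomial v k w) : w ∈ weightSpace W (h + k) := by
  induction hw with
  | base => simpa [VirasoroFusion.mem_weightSpace] using hv
  | @step k w j _ hj ih =>
    have := Lu_mem_weightSpace (-j) ih
    convert this using 2
    push_cast
    ring

lemma Monomial.Lu_mem {h c : ℂ} {v : W} (hC : ∀ w : W, Cu • w = c • w) (h0 : Lu 0 • v = h • v)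
    (hpos : ∀ n : ℤ, 0 < n → Lu n • v = 0) {k : ℤ} {w : W} (hw : Monomial v k w) :
    ∀ n : ℤ, Lu n • w ∈ Submodule.span ℂ {x | Monomial v (k - n) x} := by
  have hneg : ∀ {k : ℤ} {j : ℤ}, 0 < j → ∀ x ∈ Submodule.span ℂ {x | Monomial v k x},
      Lu (-j) • x ∈ Submodule.span ℂ {x | Monomial v (k + j) x} := by
    intro k j hj x hx
    have : Submodule.span ℂ {x | Monomial v k x} ≤
        (Submodule.span ℂ {x | Monomial v (k + j) x}).comap (opL W (-j)) := by
      rw [Submodule.span_le]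
      intro y hy
      exact Submodule.subset_span (Monomial.step hy hj)
    exact this hx
  induction hw with
  | base =>
    intro n
    rcases lt_trichotomy n 0 with hn | rfl | hn
    · have := hneg (k := 0) (j := -n) (by omega) v (Submodule.subset_span Monomial.base)
      simpa using this
    · rw [h0]
      exact Submodule.smul_mem _ _ (Submodule.subset_span Monomial.base)
    · rw [hpos n hn]
      exact Submodule.zero_mem _
  | @step k w j hw hj ih =>
    intro n
    rw [Lu_smul_smul, hC]
    refine Submodule.add_mem _ ?_ (Submodule.add_mem _ (Submodule.smul_mem _ _ ?_) ?_)
    · have := hneg hj _ (ih n)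
      rwa [show k - n + j = k + j - n by ring] at this
    · have := ih (n + -j)
      rwa [show k - (n + -j) = k + j - n by ring] at this
    · split_ifs with e
      · obtain rfl : n = j := by omega
        refine Submodule.smul_mem _ _ (Submodule.smul_mem _ _ (Submodule.subset_span ?_))
        simpa using hw
      · simp

lemma graded_of_cyclic {h c : ℂ} {v : W} (hC : ∀ w : W, Cu • w = c • w) (h0 : Lu 0 • v = h • v)
    (hpos : ∀ n : ℤ, 0 < n → Lu n • v = 0) (hcyc : ∀ w : W, ∃ u : UVir, u • v = w) :
    ⨆ n : ℕ, weightSpace W (h + n) = ⊤ := by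
  rw [eq_top_iff]
  have hle : Submodule.span ℂ {x | ∃ k, Monomial v k x} ≤ ⨆ n : ℕ, weightSpace W (h + n) := by
    rw [Submodule.span_le]
    rintro x ⟨k, hx⟩
    obtain ⟨n, rfl⟩ := Int.eq_ofNat_of_zero_le hx.nonneg
    have := hx.mem_weightSpace h0
    exact Submodule.mem_iSup_of_mem n (by simpa using this)
  refine le_trans ?_ hle
  rintro w -
  obtain ⟨u, rfl⟩ := hcyc w
  refine smul_mem_of_stable _ ?_ ?_ u (Submodule.subset_span ⟨0, Monomial.base⟩)
  · intro n w hw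
    have : Submodule.span ℂ {x | ∃ k, Monomial v k x} ≤
        (Submodule.span ℂ {x | ∃ k, Monomial v k x}).comap (opL W n) := by
      rw [Submodule.span_le]
      rintro y ⟨k, hy⟩
      have hsub : {x | Monomial v (k - n) x} ⊆ {x | ∃ k, Monomial v k x} :=
        fun x hx => ⟨k - n, hx⟩
      exact Submodule.span_mono hsub (hy.Lu_mem hC h0 hpos n)
    exact this hw
  · intro w hw
    rw [hC]
    exact Submodule.smul_mem _ _ hw

lemma Cu_smul_of_cyclic {c : ℂ} {v : W} (hC : Cu • v = c • v)
    (hcyc : ∀ w : W, ∃ u : UVir, u • v = w) (w : W) : Cu • w = c • w := by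
  obtain ⟨u, rfl⟩ := hcyc w
  let p : Submodule ℂ W := LinearMap.ker
    ((Algebra.lsmul ℂ ℂ W Cu : Module.End ℂ W) - c • (1 : Module.End ℂ W))
  have hp : ∀ w : W, w ∈ p ↔ Cu • w = c • w := fun w => by
    rw [LinearMap.mem_ker]
    change Cu • w - c • w = 0 ↔ _
    exact sub_eq_zero
  rw [← hp]
  refine smul_mem_of_stable p ?_ ?_ u ((hp v).mpr hC)
  · intro n w hw
    rw [hp] at hw ⊢
    rw [← mul_smul, Cu_comm_Lu, mul_smul, hw, Lu_smul_comm]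
  · intro w hw
    have := (hp w).mp hw
    rw [this]
    exact p.smul_mem c hw

instance (h c : ℂ) : IsGradedVirModule c (Verma h c) where
  central := Cu_smul_of_cyclic (Verma.Cu_hw h c) (Verma.exists_smul h c)
  graded := ⟨h, graded_of_cyclic (Cu_smul_of_cyclic (Verma.Cu_hw h c) (Verma.exists_smul h c))
    (Verma.Lu_zero_hw h c) (fun _ => Verma.Lu_hw h c) (Verma.exists_smul h c)⟩

lemma VirVOA.exists_smul (c : ℂ) (w : VirVOA c) : ∃ u : UVir, u • VirVOA.vacuum c = w := by
  obtain ⟨w, rfl⟩ := Submodule.mkQ_surjective _ w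
  obtain ⟨u, rfl⟩ := Verma.exists_smul 0 c w
  exact ⟨u, VirVOA.smul_vacuum c u⟩

lemma VirVOA.central (c : ℂ) (w : VirVOA c) : Cu • w = c • w := by
  refine Cu_smul_of_cyclic (v := VirVOA.vacuum c) ?_ (VirVOA.exists_smul c) w
  rw [VirVOA.smul_vacuum, Verma.Cu_hw, ← algebraMap_smul UVir c, map_smul, algebraMap_smul]
  rfl

lemma VirVOA.iSup_weightSpace (c : ℂ) : ⨆ n : ℕ, weightSpace (VirVOA c) n = ⊤ := by
  have := graded_of_cyclic (h := 0) (v := VirVOA.vacuum c) (VirVOA.central c) ?_ ?_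
    (VirVOA.exists_smul c)
  · simpa using this
  · rw [VirVOA.smul_vacuum, Verma.Lu_zero_hw, zero_smul, zero_smul, map_zero]
  · intro n hn
    rw [VirVOA.smul_vacuum, Verma.Lu_hw 0 c hn, map_zero]

instance (c : ℂ) : IsGradedVirModule c (VirVOA c) where
  central := VirVOA.central c
  graded := ⟨0, by simpa using VirVOA.iSup_weightSpace c⟩

/-! ### Vertex operators of `M_c` on its modules -/

/-- The homomorphism of `U(Vir)`-modules from `M(0, c)` to the fields on `W` that maps the
highest weight vector to `id_W`. -/
def vermaToFields (c : ℂ) (W : Type*) [AddCommGroup W] [Module ℂ W] [Module UVir W]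
    [IsScalarTower ℂ UVir W] [IsGradedVirModule c W] : Verma 0 c →ₗ[UVir] FieldModule c W :=
  (vermaIdeal 0 c).liftQ (LinearMap.toSpanSingleton UVir (FieldModule c W) (FieldModule.one c W)) <| by
    have h0 : ∀ m : ℕ, Lu ((m : ℤ) - 1) • FieldModule.one c W = 0 := fun m => by
      rw [Lu_smul_field]; exact fieldL_idField c W m
    rw [vermaIdeal, Submodule.span_le]
    rintro u (⟨n, hn, rfl⟩ | rfl | rfl)
    · obtain ⟨m, rfl⟩ : ∃ m : ℕ, n = (m : ℤ) - 1 := ⟨(n + 1).toNat, by omega⟩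
      exact h0 m
    · have := h0 1
      simpa [sub_smul] using this
    · change (Cu - algebraMap ℂ UVir c) • FieldModule.one c W = 0
      rw [sub_smul, Cu_smul_field, algebraMap_smul, sub_self]

/-- The homomorphism of `U(Vir)`-modules from `M_c` to the fields on `W` that maps the
vacuum to `id_W`. -/
def voaToFields (c : ℂ) (W : Type*) [AddCommGroup W] [Module ℂ W] [Module UVir W]
    [IsScalarTower ℂ UVir W] [IsGradedVirModule c W] : VirVOA c →ₗ[UVir] FieldModule c W :=
  Submodule.liftQ _ (vermaToFields c W) <| by
    rw [Submodule.span_le]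
    rintro _ rfl
    change vermaToFields c W (Lu (-1) • Verma.hwVector 0 c) = 0
    rw [map_smul, Verma.hwVector, vermaToFields, Submodule.mkQ_apply, Submodule.liftQ_apply,
      LinearMap.toSpanSingleton_apply, one_smul, Lu_smul_field]
    exact fieldL_idField c W 0

/-- The vertex operator map `a ↦ Y(a, z)` of `M_c` on the module `W`: the linear map with
`Y(1, z) = id` and `Y(Lₘ a, x) = Res_z (z - x) ^ (m + 1) [T(z), Y(a, x)]`; in particular
`Y(ω, z) = T(z) = ∑ₙ Lₙ z ^ (-n - 2)`. -/
def vertexMap (c : ℂ) (W : Type*) [AddCommGroup W] [Module ℂ W] [Module UVir W]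
    [IsScalarTower ℂ UVir W] [IsGradedVirModule c W] : VirVOA c →ₗ[ℂ] VertexOperator ℂ W :=
  (voaToFields c W).restrictScalars ℂ

lemma vertexMap_vacuum (c : ℂ) [IsGradedVirModule c W] :
    vertexMap c W (VirVOA.vacuum c) = idField W := by
  change (1 : UVir) • FieldModule.one c W = _
  rw [one_smul]
  rfl

lemma vertexMap_Lu (c : ℂ) [IsGradedVirModule c W] (m : ℤ) (a : VirVOA c) :
    vertexMap c W (Lu m • a) = fieldL c W m (vertexMap c W a) := by
  change voaToFields c W _ = _
  rw [map_smul, Lu_smul_field]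
  rfl

end Modules

/-! ### Contragredient modules -/

section Contragredient

open VertexOperator

variable {W : Type*} [AddCommGroup W] [Module ℂ W] [Module UVir W] [IsScalarTower ℂ UVir W]

/-- The restricted dual `⨁_μ (W_μ)*`: the functionals on `W` that vanish on all but finitely many
of the `L₀`-eigenspaces `W_μ`. -/
def restrictedDual (W : Type*) [AddCommGroup W] [Module ℂ W] [Module UVir W]
    [IsScalarTower ℂ UVir W] : Submodule ℂ (Module.Dual ℂ W) where
  carrier := {f | {μ : ℂ | ∃ w ∈ weightSpace W μ, f w ≠ 0}.Finite}
  zero_mem' := by simp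
  add_mem' {f g} hf hg := by
    refine (hf.union hg).subset ?_
    rintro μ ⟨w, hw, hfg⟩
    by_cases h : f w = 0
    · exact Or.inr ⟨w, hw, fun h' => hfg (by simp [h, h'])⟩
    · exact Or.inl ⟨w, hw, h⟩
  smul_mem' a f hf := by
    refine Set.Finite.subset hf ?_
    rintro μ ⟨w, hw, haf⟩
    exact ⟨w, hw, fun h => haf (by simp [h])⟩

lemma mem_restrictedDual {f : Module.Dual ℂ W} :
    f ∈ restrictedDual W ↔ {μ : ℂ | ∃ w ∈ weightSpace W μ, f w ≠ 0}.Finite := Iff.rfl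

/-- The field `φ` has degree `k`: its mode `φ_n` maps `W_μ` to `W_{μ + k - n - 1}`. -/
def HasDegree (k : ℤ) (φ : VertexOperator ℂ W) : Prop :=
  ∀ (n : ℤ) (μ : ℂ), ∀ w ∈ weightSpace W μ, ncoeff φ n w ∈ weightSpace W (μ + k - n - 1)

/-- The span of the fields that have a degree. -/
def gradedFields (W : Type*) [AddCommGroup W] [Module ℂ W] [Module UVir W]
    [IsScalarTower ℂ UVir W] : Submodule ℂ (VertexOperator ℂ W) :=
  Submodule.span ℂ {φ | ∃ k, HasDegree k φ}

lemma finsum_mem_submodule {V : Type*} [AddCommGroup V] [Module ℂ V] (p : Submodule ℂ V)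
    (f : ℕ → V) (h : ∀ j, f j ∈ p) : ∑ᶠ j, f j ∈ p :=
  finsum_induction (· ∈ p) p.zero_mem (fun _ _ => p.add_mem) h

lemma HasDegree.idField : HasDegree 0 (idField W) := by
  intro n μ w hw
  rw [VirasoroFusion.idField, ncoeff_mkField]
  split_ifs with h
  · subst h
    simpa using hw
  · exact Submodule.zero_mem _

lemma HasDegree.fieldL {c : ℂ} [IsGradedVirModule c W] {k : ℤ} {φ : VertexOperator ℂ W}
    (hφ : HasDegree k φ) (m : ℤ) : HasDegree (k - m) (fieldL c W m φ) := by
  intro n μ w hw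
  simp only [VirasoroFusion.fieldL, LinearMap.sub_apply, map_sub, Pi.sub_apply, leftProd_apply,
    rightProd_apply]
  refine Submodule.sub_mem _ (finsum_mem_submodule _ _ fun j => Submodule.smul_mem _ _ ?_)
    (finsum_mem_submodule _ _ fun j => Submodule.smul_mem _ _ ?_)
  · have := Lu_mem_weightSpace (m + 1 - 1 - j) (hφ (n + j) μ w hw)
    convert this using 2
    · push_cast
      ring
    · rfl
  · have := hφ (m + 1 + n - j) _ _ (Lu_mem_weightSpace (j - 1) hw)
    convert this using 2
    · push_cast
      ring
    · rfl

lemma vertexMap_mem_gradedFields (c : ℂ) (W : Type*) [AddCommGroup W] [Module ℂ W]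
    [Module UVir W] [IsScalarTower ℂ UVir W] [IsGradedVirModule c W] (a : VirVOA c) :
    vertexMap c W a ∈ gradedFields W := by
  have h : a ∈ (gradedFields W).comap (vertexMap c W) := by
    obtain ⟨u, rfl⟩ := VirVOA.exists_smul c a
    refine smul_mem_of_stable _ ?_ ?_ u ?_
    · intro n a ha
      rw [Submodule.mem_comap] at ha ⊢
      rw [vertexMap_Lu]
      have : gradedFields W ≤ (gradedFields W).comap (fieldL c W n) := by
        conv_lhs => rw [gradedFields]
        rw [Submodule.span_le]
        rintro φ ⟨k, hk⟩
        exact Submodule.subset_span ⟨_, hk.fieldL n⟩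
      exact this ha
    · intro a ha
      rw [VirVOA.central]
      exact Submodule.smul_mem _ _ ha
    · rw [Submodule.mem_comap, vertexMap_vacuum]
      exact Submodule.subset_span ⟨0, HasDegree.idField⟩
  exact h

lemma dualMap_mem_restrictedDual {φ : VertexOperator ℂ W} (hφ : φ ∈ gradedFields W) (n : ℤ)
    {f : Module.Dual ℂ W} (hf : f ∈ restrictedDual W) :
    (ncoeff φ n).dualMap f ∈ restrictedDual W := by
  induction hφ using Submodule.span_induction with
  | mem φ h =>
    obtain ⟨k, hk⟩ := h
    rw [mem_restrictedDual] at hf ⊢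
    refine (Set.Finite.image (fun ν : ℂ => ν - k + n + 1) hf).subset ?_
    rintro μ ⟨w, hw, hne⟩
    exact ⟨μ + k - n - 1, ⟨_, hk n μ w hw, hne⟩, by ring⟩
  | zero =>
    have : (ncoeff (0 : VertexOperator ℂ W) n).dualMap f = 0 := by
      ext w
      simp
    rw [this]
    exact Submodule.zero_mem _
  | add φ ψ _ _ h1 h2 =>
    have : (ncoeff (φ + ψ) n).dualMap f = (ncoeff φ n).dualMap f + (ncoeff ψ n).dualMap f := by
      ext w
      simp
    rw [this]
    exact Submodule.add_mem _ h1 h2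
  | smul a φ _ h =>
    have : (ncoeff (a • φ) n).dualMap f = a • (ncoeff φ n).dualMap f := by
      ext w
      simp
    rw [this]
    exact Submodule.smul_mem _ _ h

lemma dualMap_eq_zero (c : ℂ) [IsGradedVirModule c W] {φ : VertexOperator ℂ W}
    (hφ : φ ∈ gradedFields W) {f : Module.Dual ℂ W} (hf : f ∈ restrictedDual W) :
    ∃ N : ℤ, ∀ n, n ≤ N → (ncoeff φ n).dualMap f = 0 := by
  obtain ⟨h, hW⟩ := IsGradedVirModule.graded (c := c) (W := W)
  induction hφ using Submodule.span_induction with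
  | mem φ hk =>
    obtain ⟨k, hk⟩ := hk
    obtain ⟨R, hR⟩ := (hf.image Complex.re).bddAbove
    refine ⟨⌊h.re + k - 2 - R⌋, fun n hn => LinearMap.ext fun w => ?_⟩
    have hn' : (n : ℝ) ≤ h.re + k - 2 - R := Int.le_floor.mp hn
    have hw : w ∈ ⨆ r : ℕ, weightSpace W (h + r) := hW ▸ Submodule.mem_top
    induction hw using Submodule.iSup_induction' with
    | mem r w hw =>
      by_contra hne
      have hle : (h + r + k - n - 1).re ≤ R :=
        hR ⟨_, ⟨_, hk n _ w hw, hne⟩, rfl⟩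
      simp at hle
      have : (0 : ℝ) ≤ r := Nat.cast_nonneg r
      linarith
    | zero => simp
    | add v w _ _ hv hw =>
      rw [map_add, hv, hw, map_add]
  | zero => exact ⟨0, fun n _ => by ext; simp⟩
  | add φ ψ _ _ h1 h2 =>
    obtain ⟨N, hN⟩ := h1
    obtain ⟨M, hM⟩ := h2
    refine ⟨min N M, fun n hn => ?_⟩
    have : (ncoeff (φ + ψ) n).dualMap f = (ncoeff φ n).dualMap f + (ncoeff ψ n).dualMap f := by
      ext w
      simp
    rw [this, hN n (by omega), hM n (by omega), add_zero]
  | smul a φ _ h1 =>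
    obtain ⟨N, hN⟩ := h1
    refine ⟨N, fun n hn => ?_⟩
    have : (ncoeff (a • φ) n).dualMap f = a • (ncoeff φ n).dualMap f := by
      ext w
      simp
    rw [this, hN n hn, smul_zero]

/-- The field on the restricted dual whose `n`-th mode is the transpose of the `(s - n)`-th mode
of `φ`, that is, `z ^ (-s - 2)` times the transpose of `φ(z⁻¹)`. -/
def transposeField (c : ℂ) (W : Type*) [AddCommGroup W] [Module ℂ W] [Module UVir W]
    [IsScalarTower ℂ UVir W] [IsGradedVirModule c W] (s : ℤ) :
    gradedFields W →ₗ[ℂ] VertexOperator ℂ (restrictedDual W) where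
  toFun φ := mkField
    (fun n => (ncoeff φ.1 (s - n)).dualMap.restrict
      fun _ hf => dualMap_mem_restrictedDual φ.2 (s - n) hf)
    fun f => by
      obtain ⟨N, hN⟩ := dualMap_eq_zero c φ.2 f.2
      exact ⟨s - N, fun n hn => Subtype.ext (hN _ (by omega))⟩
  map_add' φ ψ := by
    refine field_ext fun n f => Subtype.ext (LinearMap.ext fun w => ?_)
    simp
  map_smul' a φ := by
    refine field_ext fun n f => Subtype.ext (LinearMap.ext fun w => ?_)
    simp

lemma isInternal_weightSpace (c : ℂ) :
    DirectSum.IsInternal fun k : ℕ => weightSpace (VirVOA c) (k : ℂ) :=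
  DirectSum.isInternal_submodule_of_iSupIndep_of_iSup_eq_top
    (iSupIndep_weightSpace.comp Nat.cast_injective) (VirVOA.iSup_weightSpace c)

/-- The restriction of `vertexMap` to fields with a degree. -/
def vertexMapGraded (c : ℂ) (W : Type*) [AddCommGroup W] [Module ℂ W] [Module UVir W]
    [IsScalarTower ℂ UVir W] [IsGradedVirModule c W] : VirVOA c →ₗ[ℂ] gradedFields W :=
  (vertexMap c W).codRestrict _ (vertexMap_mem_gradedFields c W)

/-- For `a ∈ M_c` with `L₀ a = k a`, the field on the restricted dual of `W` given by the transpose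
of `Y(e ^ (z L₁) (-z⁻²) ^ L₀ a, z⁻¹) = ∑ⱼ (-1) ^ k / j! z ^ (j - 2 k) Y(L₁ ^ j a, z⁻¹)`;
here `L₁ ^ j a = 0` for `j > k`. -/
def contragredientHom (c : ℂ) (W : Type*) [AddCommGroup W] [Module ℂ W] [Module UVir W]
    [IsScalarTower ℂ UVir W] [IsGradedVirModule c W] (k : ℕ) :
    weightSpace (VirVOA c) (k : ℂ) →ₗ[ℂ] VertexOperator ℂ (restrictedDual W) :=
  ∑ j ∈ range (k + 1), ((-1 : ℂ) ^ k / (j.factorial : ℂ)) •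
    (transposeField c W (2 * k - j - 2) ∘ₗ vertexMapGraded c W ∘ₗ (opL (VirVOA c) 1 ^ j : Module.End ℂ (VirVOA c)) ∘ₗ
      (weightSpace (VirVOA c) (k : ℂ)).subtype)

/-- The vertex operator map `a ↦ Y*(a, z)` of `M_c` on the contragredient module of `W`:
`⟨Y*(a, z) f, w⟩ = ⟨f, Y(e ^ (z L₁) (-z⁻²) ^ L₀ a, z⁻¹) w⟩`. -/
def contragredientMap (c : ℂ) (W : Type*) [AddCommGroup W] [Module ℂ W] [Module UVir W]
    [IsScalarTower ℂ UVir W] [IsGradedVirModule c W] :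
    VirVOA c →ₗ[ℂ] VertexOperator ℂ (restrictedDual W) :=
  DirectSum.toModule ℂ ℕ _ (contragredientHom c W) ∘ₗ
    (LinearEquiv.ofBijective (DirectSum.coeLinearMap fun k : ℕ => weightSpace (VirVOA c) (k : ℂ))
      (isInternal_weightSpace c)).symm.toLinearMap

end Contragredient

/-! ### Intertwining operators -/

section Intertwining

open VertexOperator

variable {V W₁ W₂ W₃ : Type*} [AddCommGroup V] [Module ℂ V] [AddCommGroup W₁] [Module ℂ W₁]
  [AddCommGroup W₂] [Module ℂ W₂] [AddCommGroup W₃] [Module ℂ W₃]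

/-- Let `W₁`, `W₂`, `W₃` be modules of a vertex operator algebra `V` with conformal vector `ω`, with
vertex operator maps `Y₁`, `Y₂`, `Y₃`. A linear map `v ↦ I(v, z) = ∑_{n ∈ ℂ} v_n z ^ (-n - 1)`, with
modes `v_n = I v n : W₂ → W₃` indexed by complex numbers, is an intertwining operator of type
`W₃ / (W₁ W₂)`. -/
structure IsIntertwining (ω : V) (Y₁ : V →ₗ[ℂ] VertexOperator ℂ W₁)
    (Y₂ : V →ₗ[ℂ] VertexOperator ℂ W₂) (Y₃ : V →ₗ[ℂ] VertexOperator ℂ W₃)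
    (I : W₁ →ₗ[ℂ] (ℂ → (W₂ →ₗ[ℂ] W₃))) : Prop where
  /-- Lower truncation: `v_n w = 0` if the real part of `n` is sufficiently large. -/
  trunc : ∀ v w, ∃ N : ℝ, ∀ n : ℂ, N ≤ n.re → I v n w = 0
  /-- The `L₋₁`-derivative property `I(L₋₁ v, z) = d/dz I(v, z)`, where `L₋₁ = ω₀` on `W₁`. -/
  derivative : ∀ v n, I (ncoeff (Y₁ ω) 0 v) n = -n • I v (n - 1)
  /-- The Jacobi identity, by components: the coefficients of
  `z₀⁻¹ δ((z₁ - z₂) / z₀) Y₃(a, z₁) I(v, z₂) w - z₀⁻¹ δ((z₂ - z₁) / (-z₀)) I(v, z₂) Y₂(a, z₁) w`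
  and of `z₂⁻¹ δ((z₁ - z₀) / z₂) I(Y₁(a, z₀) v, z₂) w` at
  `z₀ ^ (-l - 1) z₁ ^ (-m - 1) z₂ ^ (-n - 1)` are equal. All sums are finite. -/
  jacobi : ∀ (a : V) (v : W₁) (w : W₂) (l m : ℤ) (n : ℂ),
    ∑ᶠ j : ℕ, ((-1) ^ j * cb l j) •
      (ncoeff (Y₃ a) (m + l - j) (I v (n + j) w) -
        (-1 : ℂ) ^ l • I v (n + l - j) (ncoeff (Y₂ a) (m + j) w)) =
    ∑ᶠ j : ℕ, cb m j • I (ncoeff (Y₁ a) (l + j) v) (m + n - j) w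

lemma bounded_mode {I : W₁ →ₗ[ℂ] (ℂ → (W₂ →ₗ[ℂ] W₃))} {v : W₁} {w : W₂}
    (h : ∃ N : ℝ, ∀ n : ℂ, N ≤ n.re → I v n w = 0) (n : ℂ) :
    ∃ N : ℕ, ∀ j : ℕ, N ≤ j → I v (n + j) w = 0 := by
  obtain ⟨N, hN⟩ := h
  refine ⟨⌈N - n.re⌉₊, fun j hj => hN _ ?_⟩
  have := Nat.ceil_le.mp hj
  simp only [Complex.add_re, Complex.natCast_re]
  linarith

lemma IsIntertwining.finite_left {ω : V} {Y₁ : V →ₗ[ℂ] VertexOperator ℂ W₁}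
    {Y₂ : V →ₗ[ℂ] VertexOperator ℂ W₂} {Y₃ : V →ₗ[ℂ] VertexOperator ℂ W₃}
    {I : W₁ →ₗ[ℂ] (ℂ → (W₂ →ₗ[ℂ] W₃))} (hI : IsIntertwining ω Y₁ Y₂ Y₃ I)
    (a : V) (v : W₁) (w : W₂) (l m : ℤ) (n : ℂ) :
    (Function.support fun j : ℕ => ((-1) ^ j * cb l j) •
      (ncoeff (Y₃ a) (m + l - j) (I v (n + j) w) -
        (-1 : ℂ) ^ l • I v (n + l - j) (ncoeff (Y₂ a) (m + j) w))).Finite := by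
  obtain ⟨N, hN⟩ := bounded_mode (hI.trunc v w) n
  obtain ⟨M, hM⟩ := field_trunc (Y₂ a) w
  refine finite_support_of_bound (max N (M - m).toNat) fun j hj => ?_
  rw [hN j (by omega), hM (m + j) (by omega)]
  simp

lemma IsIntertwining.finite_right (Y₁ : V →ₗ[ℂ] VertexOperator ℂ W₁)
    (I : W₁ →ₗ[ℂ] (ℂ → (W₂ →ₗ[ℂ] W₃))) (a : V) (v : W₁) (w : W₂) (l m : ℤ) (n : ℂ) :
    (Function.support fun j : ℕ =>
      cb m j • I (ncoeff (Y₁ a) (l + j) v) (m + n - j) w).Finite := by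
  obtain ⟨M, hM⟩ := field_trunc (Y₁ a) v
  refine finite_support_of_bound (M - l).toNat fun j hj => ?_
  rw [hM (l + j) (by omega)]
  simp

/-- The space of intertwining operators of type `W₃ / (W₁ W₂)`. -/
def intertwiningOperators (ω : V) (Y₁ : V →ₗ[ℂ] VertexOperator ℂ W₁)
    (Y₂ : V →ₗ[ℂ] VertexOperator ℂ W₂) (Y₃ : V →ₗ[ℂ] VertexOperator ℂ W₃) :
    Submodule ℂ (W₁ →ₗ[ℂ] (ℂ → (W₂ →ₗ[ℂ] W₃))) where
  carrier := {I | IsIntertwining ω Y₁ Y₂ Y₃ I}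
  zero_mem' :=
    { trunc := fun v w => ⟨0, fun n _ => rfl⟩
      derivative := fun v n => by simp
      jacobi := fun a v w l m n => by simp }
  add_mem' {I J} hI hJ :=
    { trunc := fun v w => by
        obtain ⟨N, hN⟩ := hI.trunc v w
        obtain ⟨M, hM⟩ := hJ.trunc v w
        refine ⟨max N M, fun n hn => ?_⟩
        simp [hN n (le_trans (le_max_left _ _) hn), hM n (le_trans (le_max_right _ _) hn)]
      derivative := fun v n => by simp [hI.derivative, hJ.derivative]
      jacobi := fun a v w l m n => by
        have h := congrArg₂ (· + ·) (hI.jacobi a v w l m n) (hJ.jacobi a v w l m n)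
        rw [← finsum_add_distrib (hI.finite_left a v w l m n) (hJ.finite_left a v w l m n),
          ← finsum_add_distrib (IsIntertwining.finite_right Y₁ I a v w l m n)
            (IsIntertwining.finite_right Y₁ J a v w l m n)] at h
        refine Eq.trans (finsum_congr fun j => ?_) (h.trans (finsum_congr fun j => ?_))
        · simp only [LinearMap.add_apply, Pi.add_apply, map_add]
          module
        · simp }
  smul_mem' t I hI :=
    { trunc := fun v w => by
        obtain ⟨N, hN⟩ := hI.trunc v w
        exact ⟨N, fun n hn => by simp [hN n hn]⟩
      derivative := fun v n => by
        simp only [LinearMap.smul_apply, Pi.smul_apply, hI.derivative, smul_comm t]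
      jacobi := fun a v w l m n => by
        have h := congrArg (t • ·) (hI.jacobi a v w l m n)
        rw [smul_finsum' t (hI.finite_left a v w l m n),
          smul_finsum' t (IsIntertwining.finite_right Y₁ I a v w l m n)] at h
        refine Eq.trans (finsum_congr fun j => ?_) (h.trans (finsum_congr fun j => ?_))
        · simp only [LinearMap.smul_apply, Pi.smul_apply, map_smul]
          module
        · simp only [LinearMap.smul_apply, Pi.smul_apply]
          module }

end Intertwining

end

end VirasoroFusion

/-! Intertwining operators of this type are conformal blocks on the sphere with three punctures.
Setting z = 1 in ⟨I(v, z) w, u⟩ gives a trilinear form F(v, w, u), with v placed at 1, w at 0 and u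
at ∞. The Jacobi identity for ω says that F is annihilated by every vector field g(z) ∂_z whose
poles lie at 0, 1, ∞; the field acts at each puncture through its expansion in a local coordinate t,
where tⁿ ∂_t acts as L_{n-1} up to a common sign. Conversely the L₀-grading recovers the powers of z
from F: the mode vₙ w is the part of F(v, w, ·) living on one weight. So the claim is that an
invariant form exists with any prescribed value on the three highest weight vectors, and that an
intertwining operator is determined by this one value.

Uniqueness (`IsIntertwining.eq_zero`): the associator and commutator formulas for ω move an L₋ₖ
applied to one argument onto the other two. Removing lowering operators from v, then from w, then
from u reduces every matrix coefficient to those between highest weight vectors, and the weight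
condition leaves only one of these.

Existence of F (`exists_invariant_form`): Verma modules have universal properties, so F can be built
one argument at a time. M(h₃) is free over the negative part of the Virasoro algebra
(`exists_verma_lift_nonpos`), which gives a map from M(h₃) to Laurent polynomials playing the role
of ⟨I(v₁, z) v₂, ·⟩. The universal property of M(h₂) extends it to a bilinear form B on M(h₂) ×
M(h₃) (`exists_primary_form`). Bilinear forms carry an action of the fields (z - 1)^(n+1) ∂_z with
central charge c: by the residue theorem the cocycles at 0, 1, ∞ add up to zero (`serCocycle_sum`).
In this Virasoro module B is a highest weight vector of weight h₁, so M(h₁) maps to it, and this map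
is F.

From ω to all of M_c (`triCoef_mem`): for an invariant F the matrix coefficients of Y(b, z) acting
at 0, at 1 and, through the contragredient, at ∞ are the three expansions of a single rational
function. This is proved by induction on b: replacing b by L₋q b is a contour integral around the
position of b, which is deformed to the punctures. The component form of the Jacobi identity is then
the vanishing of the sum of the residues of z^m (z - 1)^l times this rational function
(`IsInvariantForm.sum_residues`). -/

namespace VirasoroFusion

noncomputable section

set_option linter.unusedSectionVars false

open Finset

/-! ### Rational functions on the sphere with poles at `0`, `1`, `∞` -/

section RationalFunctions

/-- Laurent series over `ℂ`. -/
abbrev Ser : Type := LaurentSeries ℂ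

instance : IsScalarTower ℂ Ser Ser where
  smul_assoc a f g := by
    rw [smul_eq_mul, smul_eq_mul, ← HahnSeries.C_mul_eq_smul, ← HahnSeries.C_mul_eq_smul, mul_assoc]

instance : SMulCommClass ℂ Ser Ser where
  smul_comm a f g := by
    rw [smul_eq_mul, smul_eq_mul, ← HahnSeries.C_mul_eq_smul, ← HahnSeries.C_mul_eq_smul,
      mul_left_comm]

/-- The series `(1 + s X) ^ n`. -/
def bino (s : ℂ) (n : ℤ) : Ser :=
  HahnSeries.ofPowerSeries ℤ ℂ (PowerSeries.mk fun j => s ^ j * cb n j)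

/-- The monomial `X ^ n`. -/
def mono (n : ℤ) : Ser := HahnSeries.single n 1

lemma bino_coeff_nat (s : ℂ) (n : ℤ) (j : ℕ) : (bino s n).coeff j = s ^ j * cb n j := by
  rw [bino, LaurentSeries.coeff_coe_powerSeries, PowerSeries.coeff_mk]

lemma bino_coeff_neg (s : ℂ) (n : ℤ) {k : ℤ} (hk : k < 0) : (bino s n).coeff k = 0 := by
  rw [bino, PowerSeries.coeff_coe, if_pos hk]

lemma mono_coeff (n k : ℤ) : (mono n).coeff k = if k = n then 1 else 0 := by
  rw [mono, HahnSeries.coeff_single]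
  congr

lemma mono_mul_coeff (n k : ℤ) (f : Ser) : (mono n * f).coeff k = f.coeff (k - n) := by
  rw [mono, HahnSeries.coeff_single_mul, one_mul]

lemma mono_mul_mono (m n : ℤ) : mono m * mono n = mono (m + n) := by
  rw [mono, mono, HahnSeries.single_mul_single, one_mul, mono]

lemma mono_zero : mono 0 = 1 := rfl

lemma ser_coeff_add (f g : Ser) (k : ℤ) : (f + g).coeff k = f.coeff k + g.coeff k := rfl
lemma ser_coeff_sub (f g : Ser) (k : ℤ) : (f - g).coeff k = f.coeff k - g.coeff k := rfl
lemma ser_coeff_neg (f : Ser) (k : ℤ) : (-f).coeff k = -f.coeff k := rfl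
lemma ser_coeff_smul (a : ℂ) (f : Ser) (k : ℤ) : (a • f).coeff k = a * f.coeff k := rfl

lemma ser_bounded (f : Ser) : ∃ N : ℤ, ∀ n, n < N → f.coeff n = 0 :=
  ⟨f.order, fun _ hn => HahnSeries.coeff_eq_zero_of_lt_order hn⟩

lemma mul_coeff_eq_zero {f g : Ser} {a k : ℤ} (hf : ∀ n, n < a → f.coeff n = 0)
    (hg : ∀ n, n ≤ k - a → g.coeff n = 0) : (f * g).coeff k = 0 := by
  rw [HahnSeries.coeff_mul]
  refine sum_eq_zero fun p hp => ?_
  obtain ⟨h1, h2, h3⟩ := Finset.mem_antidiagonal.mp hp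
  rcases lt_or_ge p.1 a with h | h
  · rw [hf _ h, zero_mul]
  · rw [hg _ (by omega), mul_zero]

/-- Only finitely many terms of the convolution survive because `f` is bounded below. The bound `J`
is a free parameter so that several products can later be summed over one common range. -/
lemma bino_mul_coeff (s : ℂ) (n : ℤ) (f : Ser) (k : ℤ) (J : ℕ)
    (hJ : ∀ j : ℕ, J ≤ j → f.coeff (k - j) = 0) :
    (bino s n * f).coeff k = ∑ j ∈ range J, s ^ j * cb n j * f.coeff (k - j) := by
  set g : Ser := ∑ j ∈ range J, (s ^ j * cb n j) • mono j with hg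
  have hgc : ∀ i : ℤ, i < J → (bino s n - g).coeff i = 0 := by
    intro i hi
    rw [ser_coeff_sub, hg, HahnSeries.coeff_sum]
    simp only [ser_coeff_smul, mono_coeff]
    rcases lt_or_ge i 0 with h | h
    · rw [bino_coeff_neg _ _ h, sum_eq_zero, sub_zero]
      intro j _
      rw [if_neg (by omega), mul_zero]
    · obtain ⟨i, rfl⟩ := Int.eq_ofNat_of_zero_le h
      rw [bino_coeff_nat, sum_eq_single i]
      · simp
      · intro j _ hj
        rw [if_neg (by omega), mul_zero]
      · intro h'
        exact absurd (mem_range.mpr (by omega)) h'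
  -- `g` is the binomial series truncated at order `J`; the remainder has order at least `J` and
  -- meets only vanishing coefficients of `f`.
  have h0 : ((bino s n - g) * f).coeff k = 0 := by
    refine mul_coeff_eq_zero (a := J) hgc fun i hi => ?_
    have := hJ (k - i).toNat (by omega)
    rwa [show k - ((k - i).toNat : ℤ) = i by omega] at this
  rw [sub_mul, ser_coeff_sub, sub_eq_zero] at h0
  rw [h0, hg, sum_mul, HahnSeries.coeff_sum]
  refine sum_congr rfl fun j _ => ?_
  rw [smul_mul_assoc, ser_coeff_smul, mono_mul_coeff]

lemma bino_mul_bino (s : ℂ) (m n : ℤ) : bino s m * bino s n = bino s (m + n) := by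
  ext k
  rcases lt_or_ge k 0 with h | h
  · rw [bino_coeff_neg _ _ h, bino_mul_coeff _ _ _ _ 0]
    · simp
    · intro j _
      exact bino_coeff_neg _ _ (by omega)
  · obtain ⟨k, rfl⟩ := Int.eq_ofNat_of_zero_le h
    rw [bino_mul_coeff _ _ _ _ (k + 1), bino_coeff_nat, ← cb_vandermonde,
      Nat.sum_antidiagonal_eq_sum_range_succ_mk, mul_sum]
    · refine sum_congr rfl fun j hj => ?_
      have hj' : j ≤ k := by have := mem_range.mp hj; omega
      rw [← Int.ofNat_sub hj', bino_coeff_nat]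
      obtain ⟨d, rfl⟩ := Nat.exists_eq_add_of_le hj'
      simp only [Nat.add_sub_cancel_left, pow_add]
      ring
    · intro j hj
      exact bino_coeff_neg _ _ (by omega)

lemma bino_zero (s : ℂ) : bino s 0 = 1 := by
  have h : ∀ j : ℕ, cb 0 j = if j = 0 then 1 else 0 := by
    intro j
    cases j with
    | zero => simp [cb]
    | succ j => simp [cb, Ring.choose_zero_succ]
  ext k
  rw [← mono_zero, mono_coeff]
  rcases lt_or_ge k 0 with hk | hk
  · rw [bino_coeff_neg _ _ hk, if_neg (by omega)]
  · obtain ⟨k, rfl⟩ := Int.eq_ofNat_of_zero_le hk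
    rw [bino_coeff_nat, h]
    by_cases e : k = 0
    · simp [e]
    · simp [e]

lemma bino_one (s : ℂ) : bino s 1 = 1 + s • mono 1 := by
  ext k
  rw [ser_coeff_add, ser_coeff_smul, ← mono_zero, mono_coeff, mono_coeff]
  rcases lt_or_ge k 0 with hk | hk
  · rw [bino_coeff_neg _ _ hk, if_neg (by omega), if_neg (by omega)]; simp
  · obtain ⟨k, rfl⟩ := Int.eq_ofNat_of_zero_le hk
    rw [bino_coeff_nat, cb, show (1 : ℤ) = ((1 : ℕ) : ℤ) from rfl, Ring.choose_natCast]
    rcases k with _ | _ | k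
    · simp
    · simp
    · rw [Nat.choose_eq_zero_of_lt (by omega), if_neg (by push_cast; omega),
        if_neg (by push_cast; omega)]
      simp

/-- The formal derivative of a Laurent series. -/
def dser : Ser →ₗ[ℂ] Ser := LaurentSeries.derivative ℂ

lemma dser_coeff (f : Ser) (k : ℤ) : (dser f).coeff k = (k + 1) * f.coeff (k + 1) := by
  rw [dser, LaurentSeries.derivative_apply, LaurentSeries.hasseDeriv_coeff]
  simp

lemma dser_mono (n : ℤ) : dser (mono n) = (n : ℂ) • mono (n - 1) := by
  ext k
  rw [dser_coeff, ser_coeff_smul, mono_coeff, mono_coeff]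
  by_cases h : k + 1 = n
  · rw [if_pos h, if_pos (by omega), ← h]; push_cast; ring
  · rw [if_neg h, if_neg (by omega)]; ring

lemma dser_bino (s : ℂ) (n : ℤ) : dser (bino s n) = (s * n) • bino s (n - 1) := by
  ext k
  rw [dser_coeff, ser_coeff_smul]
  rcases lt_or_ge k 0 with hk | hk
  · rw [bino_coeff_neg _ _ hk, mul_zero]
    rcases eq_or_ne k (-1) with rfl | h
    · simp
    · rw [bino_coeff_neg _ _ (by omega), mul_zero]
  · obtain ⟨k, rfl⟩ := Int.eq_ofNat_of_zero_le hk
    have h := bino_coeff_nat s n (k + 1)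
    push_cast at h
    rw [h, bino_coeff_nat]
    push_cast
    linear_combination s ^ (k + 1) * cb_succ_left n k

lemma dser_mono_mul (n : ℤ) (f : Ser) :
    dser (mono n * f) = (n : ℂ) • (mono (n - 1) * f) + mono n * dser f := by
  ext k
  rw [dser_coeff, ser_coeff_add, ser_coeff_smul, mono_mul_coeff, mono_mul_coeff, mono_mul_coeff,
    dser_coeff, show k + 1 - n = k - n + 1 by ring, show k - (n - 1) = k - n + 1 by ring]
  push_cast
  ring

/-- Expansions of a function at the points `0`, `1`, `∞`, in the coordinates `z`, `z - 1`,
`z⁻¹`. -/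
abbrev Tri : Type := Ser × Ser × Ser

/-- The expansions of `z ^ n`. -/
def zfun (n : ℤ) : Tri := (mono n, bino 1 n, mono (-n))

/-- The expansions of `(z - 1) ^ n`. -/
def wfun (n : ℤ) : Tri := ((-1 : ℂ) ^ n • bino (-1) n, mono n, mono (-n) * bino (-1) n)

lemma zfun_mul (m n : ℤ) : zfun m * zfun n = zfun (m + n) := by
  simp only [zfun, Prod.mk_mul_mk, mono_mul_mono, bino_mul_bino, neg_add]

lemma wfun_mul (m n : ℤ) : wfun m * wfun n = wfun (m + n) := by
  simp only [wfun, Prod.mk_mul_mk, mono_mul_mono, neg_add, smul_mul_smul_comm, bino_mul_bino,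
    zpow_add₀ (show (-1 : ℂ) ≠ 0 by norm_num)]
  rw [mul_mul_mul_comm, mono_mul_mono, bino_mul_bino]

lemma zfun_zero : zfun 0 = 1 := by
  simp only [zfun, neg_zero, mono_zero, bino_zero]; rfl

lemma wfun_zero : wfun 0 = 1 := by
  simp only [wfun, neg_zero, mono_zero, bino_zero, zpow_zero, one_smul, mul_one]; rfl

/-- The identity z = (z - 1) + 1, checked in all three expansions. It is the only relation between
the two families that the partial fraction argument uses. -/
lemma zfun_one : zfun 1 = wfun 1 + 1 := by
  simp only [zfun, wfun, bino_one, zpow_one]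
  refine Prod.ext ?_ (Prod.ext ?_ ?_)
  · change mono 1 = (-1 : ℂ) • (1 + (-1 : ℂ) • mono 1) + 1
    module
  · change 1 + (1 : ℂ) • mono 1 = mono 1 + 1
    module
  · change mono (-1) = mono (-1) * (1 + (-1 : ℂ) • mono 1) + 1
    rw [mul_add, mul_smul_comm, mono_mul_mono, mul_one, show (-1 : ℤ) + 1 = 0 by norm_num,
      mono_zero]
    module

/-- The span of the functions `z ^ n` and `(z - 1) ^ n`. -/
def ratSpan : Submodule ℂ Tri := Submodule.span ℂ (Set.range zfun ∪ Set.range wfun)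

lemma zfun_mem (n : ℤ) : zfun n ∈ ratSpan := Submodule.subset_span (Or.inl ⟨n, rfl⟩)
lemma wfun_mem (n : ℤ) : wfun n ∈ ratSpan := Submodule.subset_span (Or.inr ⟨n, rfl⟩)

lemma int_induction_two_sided {p : ℤ → Prop} (h0 : p 0) (h1 : ∀ n, p n ↔ p (n + 1)) (n : ℤ) :
    p n := by
  induction n using Int.induction_on with
  | zero => exact h0
  | succ n ih => exact (h1 _).mp ih
  | pred n ih => exact (h1 _).mpr (by simpa using ih)

/-- Partial fractions, by a two-sided induction based on z^(m+1) (z-1)^n = z^m (z-1)^(n+1) + z^m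
(z-1)^n. -/
lemma zfun_mul_wfun_mem (m n : ℤ) : zfun m * wfun n ∈ ratSpan := by
  have hz : ∀ m, zfun (m + 1) = wfun 1 * zfun m + zfun m := fun m => by
    rw [← zfun_mul, zfun_one]; ring
  have hw : ∀ n, wfun (n + 1) = wfun 1 * wfun n := fun n => by rw [← wfun_mul, mul_comm]
  have key : ∀ m n, zfun (m + 1) * wfun n = zfun m * wfun (n + 1) + zfun m * wfun n := by
    intro m n
    rw [hz, hw]; ring
  refine int_induction_two_sided (p := fun m => ∀ n, zfun m * wfun n ∈ ratSpan) ?_ ?_ m n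
  · intro n
    rw [zfun_zero, one_mul]
    exact wfun_mem n
  · intro m
    constructor
    · intro h n
      rw [key]
      exact add_mem (h _) (h _)
    · intro h n
      -- Descending in `m`: the case m + 1 says that the sum of the products for n and n + 1 lies in
      -- the span, so either one follows from the other, starting from n = 0.
      refine int_induction_two_sided (p := fun n => zfun m * wfun n ∈ ratSpan) ?_ ?_ n
      · rw [wfun_zero, mul_one]
        exact zfun_mem m
      · intro n
        have := h n
        rw [key] at this
        exact ⟨fun h' => (Submodule.add_mem_iff_left _ h').mp this,
          fun h' => (Submodule.add_mem_iff_right _ h').mp this⟩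

lemma ratSpan_mul_mem {f g : Tri} (hf : f ∈ ratSpan) (hg : g ∈ ratSpan) : f * g ∈ ratSpan := by
  induction hf, hg using Submodule.span_induction₂ with
  | mem_mem x y hx hy =>
    rcases hx with ⟨m, rfl⟩ | ⟨m, rfl⟩ <;> rcases hy with ⟨n, rfl⟩ | ⟨n, rfl⟩
    · rw [zfun_mul]; exact zfun_mem _
    · exact zfun_mul_wfun_mem _ _
    · rw [mul_comm]; exact zfun_mul_wfun_mem _ _
    · rw [wfun_mul]; exact wfun_mem _
  | zero_left y hy => rw [zero_mul]; exact zero_mem _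
  | zero_right x hx => rw [mul_zero]; exact zero_mem _
  | add_left x y z _ _ _ h1 h2 => rw [add_mul]; exact add_mem h1 h2
  | add_right x y z _ _ _ h1 h2 => rw [mul_add]; exact add_mem h1 h2
  | smul_left r x y _ _ h => rw [smul_mul_assoc]; exact Submodule.smul_mem _ _ h
  | smul_right r x y _ _ h => rw [mul_smul_comm]; exact Submodule.smul_mem _ _ h

/-- The derivative with respect to `z`. -/
def dtri : Tri →ₗ[ℂ] Tri :=
  dser.prodMap (dser.prodMap (-(LinearMap.mulLeft ℂ (mono 2) ∘ₗ dser)))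

lemma dtri_apply (g : Tri) : dtri g = (dser g.1, dser g.2.1, -(mono 2 * dser g.2.2)) := rfl

lemma dtri_zfun (n : ℤ) : dtri (zfun n) = (n : ℂ) • zfun (n - 1) := by
  rw [dtri_apply]
  refine Prod.ext ?_ (Prod.ext ?_ ?_)
  · exact dser_mono n
  · have h := dser_bino 1 n
    rw [one_mul] at h
    exact h
  · change -(mono 2 * dser (mono (-n))) = (n : ℂ) • mono (-(n - 1))
    rw [dser_mono, mul_smul_comm, mono_mul_mono, show 2 + (-n - 1) = -(n - 1) by ring]
    push_cast
    module

lemma dtri_wfun (n : ℤ) : dtri (wfun n) = (n : ℂ) • wfun (n - 1) := by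
  have hb : bino (-1) n = bino (-1) (n - 1) - mono 1 * bino (-1) (n - 1) := by
    have h := bino_mul_bino (-1) 1 (n - 1)
    rw [bino_one, add_sub_cancel] at h
    rw [← h, add_mul, one_mul, smul_mul_assoc]
    module
  rw [dtri_apply]
  refine Prod.ext ?_ (Prod.ext ?_ ?_)
  · change dser ((-1 : ℂ) ^ n • bino (-1) n) = (n : ℂ) • (-1 : ℂ) ^ (n - 1) • bino (-1) (n - 1)
    rw [map_smul, dser_bino, smul_smul, smul_smul, zpow_sub_one₀ (by norm_num)]
    congr 1
    norm_num
    ring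
  · exact dser_mono n
  · change -(mono 2 * dser (mono (-n) * bino (-1) n)) =
      (n : ℂ) • (mono (-(n - 1)) * bino (-1) (n - 1))
    rw [dser_mono_mul, dser_bino, mul_smul_comm, mul_add, mul_smul_comm, mul_smul_comm,
      ← mul_assoc, ← mul_assoc, mono_mul_mono, mono_mul_mono, hb, mul_sub, ← mul_assoc,
      mono_mul_mono, show 2 + (-n - 1) = -(n - 1) by ring, show 2 + -n = -(n - 1) + 1 by ring]
    push_cast
    module

lemma dtri_mem {g : Tri} (hg : g ∈ ratSpan) : dtri g ∈ ratSpan := by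
  have : ratSpan ≤ ratSpan.comap dtri := by
    conv_lhs => rw [ratSpan]
    rw [Submodule.span_le]
    rintro _ (⟨n, rfl⟩ | ⟨n, rfl⟩)
    · rw [SetLike.mem_coe, Submodule.mem_comap, dtri_zfun]
      exact Submodule.smul_mem _ _ (zfun_mem _)
    · rw [SetLike.mem_coe, Submodule.mem_comap, dtri_wfun]
      exact Submodule.smul_mem _ _ (wfun_mem _)
  exact this hg

/-- The component at infinity of the vector field `g ∂_z`, in the coordinate `t = z⁻¹`. -/
def vecInf (g : Ser) : Ser := -(mono 2 * g)

/-- The coefficient functional at `k`. -/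
def coeffL (k : ℤ) : Ser →ₗ[ℂ] ℂ where
  toFun f := f.coeff k
  map_add' _ _ := rfl
  map_smul' _ _ := rfl

/-- The sum of the residues of `g dz` at `0`, `1`, `∞`. -/
def resSum : Tri →ₗ[ℂ] ℂ :=
  (coeffL (-1)).coprod ((coeffL (-1)).coprod (-(coeffL 1)))

lemma resSum_apply (g : Tri) : resSum g = g.1.coeff (-1) + (g.2.1.coeff (-1) - g.2.2.coeff 1) := by
  simp [resSum, coeffL, sub_eq_add_neg]

/-- The residue theorem needs checking only on zⁿ and (z - 1)ⁿ, where a residue occurs for n = -1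
alone and is cancelled at infinity. There dz = -t⁻² dt, so the residue is minus the coefficient of
t. -/
lemma resSum_eq_zero {g : Tri} (hg : g ∈ ratSpan) : resSum g = 0 := by
  have : ratSpan ≤ LinearMap.ker resSum := by
    rw [ratSpan, Submodule.span_le]
    rintro _ (⟨n, rfl⟩ | ⟨n, rfl⟩)
    · rw [SetLike.mem_coe, LinearMap.mem_ker, resSum_apply]
      simp only [zfun, mono_coeff]
      rw [bino_coeff_neg _ _ (by norm_num)]
      by_cases h : n = -1
      · simp [h]
      · rw [if_neg (by omega), if_neg (by omega)]; simp
    · rw [SetLike.mem_coe, LinearMap.mem_ker, resSum_apply]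
      simp only [wfun, mono_coeff, ser_coeff_smul, mono_mul_coeff]
      rw [bino_coeff_neg _ _ (by norm_num)]
      rcases lt_or_ge n (-1) with h | h
      · rw [if_neg (by omega), bino_coeff_neg _ _ (by omega)]; simp
      · obtain ⟨j, hj⟩ := Int.eq_ofNat_of_zero_le (show 0 ≤ n + 1 by omega)
        rw [show 1 - -n = (j : ℤ) by omega, bino_coeff_nat, show n = (j : ℤ) - 1 by omega,
          cb_pred_self]
        by_cases e : j = 0
        · simp [e]
        · rw [if_neg (by omega), if_neg e]; simp
  exact this hg

end RationalFunctions

/-! ### The action of formal vector fields on restricted modules -/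

section VectorFields

variable {W : Type*} [AddCommGroup W] [Module ℂ W] {ell : ℤ → Module.End ℂ W}

lemma modes_finite (hell : IsRestricted ell) (f : Ser) (w : W) :
    (Function.support fun n : ℤ => f.coeff n • ell (n - 1) w).Finite := by
  obtain ⟨N, hN⟩ := hell w
  obtain ⟨M, hM⟩ := ser_bounded f
  refine (Set.finite_Ico M (N + 1)).subset fun n hn => ?_
  by_contra h
  apply hn
  rw [Set.mem_Ico, not_and_or] at h
  rcases h with h | h
  · simp [hM n (by omega)]
  · simp [hN (n - 1) (by omega)]

/-- The action `∑ₙ fₙ Lₙ₋₁` of the vector field `∑ₙ fₙ tⁿ ∂ₜ`, up to sign. -/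
def vecAct (hell : IsRestricted ell) : Ser →ₗ[ℂ] Module.End ℂ W where
  toFun f :=
    { toFun := fun w => ∑ᶠ n : ℤ, f.coeff n • ell (n - 1) w
      map_add' := fun v w => by
        simp only [map_add, smul_add]
        exact finsum_add_distrib (modes_finite hell f v) (modes_finite hell f w)
      map_smul' := fun a w => by
        simp only [map_smul, RingHom.id_apply]
        rw [smul_finsum' a (modes_finite hell f w)]
        simp only [smul_comm a] }
  map_add' f g := by
    ext w
    simp only [LinearMap.coe_mk, AddHom.coe_mk, LinearMap.add_apply, ser_coeff_add, add_smul]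
    exact finsum_add_distrib (modes_finite hell f w) (modes_finite hell g w)
  map_smul' a f := by
    ext w
    simp only [LinearMap.coe_mk, AddHom.coe_mk, LinearMap.smul_apply, ser_coeff_smul, mul_smul,
      RingHom.id_apply]
    exact (smul_finsum' a (modes_finite hell f w)).symm

lemma vecAct_apply (hell : IsRestricted ell) (f : Ser) (w : W) :
    vecAct hell f w = ∑ᶠ n : ℤ, f.coeff n • ell (n - 1) w := rfl

lemma vecAct_mono (hell : IsRestricted ell) (n : ℤ) : vecAct hell (mono n) = ell (n - 1) := by
  ext w
  rw [vecAct_apply, finsum_eq_single _ n]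
  · rw [mono_coeff, if_pos rfl, one_smul]
  · intro k hk
    rw [mono_coeff, if_neg hk, zero_smul]

/-- Continuity in the vector field: for a fixed vector, series of high order act by zero. With
`linear_eq_zero_of_mono` this reduces identities between formal vector fields to monomials. -/
lemma vecAct_tail (hell : IsRestricted ell) (w : W) :
    ∃ N : ℤ, ∀ f : Ser, (∀ n, n < N → f.coeff n = 0) → vecAct hell f w = 0 := by
  obtain ⟨N, hN⟩ := hell w
  refine ⟨N + 1, fun f hf => ?_⟩
  rw [vecAct_apply]
  refine finsum_eq_zero_of_forall_eq_zero fun n => ?_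
  rcases lt_or_ge n (N + 1) with h | h
  · rw [hf n h, zero_smul]
  · rw [hN _ (by omega), smul_zero]

/-- The action of `t ^ m (1 + s t) ^ n ∂ₜ` as a finite sum. -/
lemma vecAct_mono_mul_bino (hell : IsRestricted ell) (s : ℂ) (m n : ℤ) (w : W) (N : ℕ)
    (hN : ∀ i : ℕ, N ≤ i → ell (m + i - 1) w = 0) :
    vecAct hell (mono m * bino s n) w =
      ∑ i ∈ range N, (s ^ i * cb n i) • ell (m + i - 1) w := by
  have hinj : Function.Injective fun i : ℕ => m + (i : ℤ) := fun i j h => by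
    simpa using h
  rw [vecAct_apply, finsum_eq_sum_of_support_subset (s := (range N).map ⟨_, hinj⟩), sum_map]
  · refine sum_congr rfl fun i _ => ?_
    simp only [Function.Embedding.coeFn_mk]
    rw [mono_mul_coeff, add_sub_cancel_left, bino_coeff_nat]
  · intro k hk
    rw [Function.mem_support, mono_mul_coeff] at hk
    rw [coe_map, Set.mem_image]
    rcases lt_or_ge (k - m) 0 with h | h
    · rw [bino_coeff_neg _ _ h, zero_smul] at hk
      exact absurd rfl hk
    · obtain ⟨i, hi⟩ := Int.eq_ofNat_of_zero_le h
      refine ⟨i, ?_, by simp only [Function.Embedding.coeFn_mk]; omega⟩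
      rw [mem_coe, mem_range]
      by_contra hlt
      apply hk
      rw [show k - 1 = m + i - 1 by omega, hN i (by omega), smul_zero]

/-- A linear map on Laurent series that vanishes on the monomials and on the series of high
order is zero. -/
lemma linear_eq_zero_of_mono {V : Type*} [AddCommGroup V] [Module ℂ V] (φ : Ser →ₗ[ℂ] V)
    (hm : ∀ n, φ (mono n) = 0)
    (ht : ∃ N : ℤ, ∀ f : Ser, (∀ n, n < N → f.coeff n = 0) → φ f = 0) (f : Ser) : φ f = 0 := by
  obtain ⟨N, hN⟩ := ht
  obtain ⟨M, hM⟩ := ser_bounded f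
  set g : Ser := ∑ n ∈ Finset.Ico M N, f.coeff n • mono n with hg
  have h1 : φ (f - g) = 0 := by
    refine hN _ fun n hn => ?_
    rw [ser_coeff_sub, hg, HahnSeries.coeff_sum]
    simp only [ser_coeff_smul, mono_coeff, mul_ite, mul_one, mul_zero, sum_ite_eq]
    split_ifs with h
    · simp
    · rw [Finset.mem_Ico] at h
      rw [hM n (by omega), sub_zero]
  have h2 : φ g = 0 := by
    rw [hg, map_sum]
    exact sum_eq_zero fun n _ => by rw [map_smul, hm, smul_zero]
  rwa [map_sub, h2, sub_zero] at h1

/-- The bracket `f' g - f g'`. -/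
def serBracket : Ser →ₗ[ℂ] Ser →ₗ[ℂ] Ser :=
  LinearMap.mk₂ ℂ (fun f g => dser f * g - f * dser g)
    (fun f f' g => by rw [map_add]; ring)
    (fun a f g => by rw [map_smul, smul_mul_assoc, smul_mul_assoc, smul_sub])
    (fun f g g' => by rw [map_add]; ring)
    (fun a f g => by rw [map_smul, mul_smul_comm, mul_smul_comm, smul_sub])

lemma serBracket_apply (f g : Ser) : serBracket f g = dser f * g - f * dser g := rfl

/-- The cocycle `Res f''' g`. -/
def serCocycle : Ser →ₗ[ℂ] Ser →ₗ[ℂ] ℂ :=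
  ((LinearMap.mul ℂ Ser).comp (dser ∘ₗ dser ∘ₗ dser)).compr₂ (coeffL (-1))

lemma serCocycle_apply (f g : Ser) :
    serCocycle f g = (dser (dser (dser f)) * g).coeff (-1) := rfl

lemma serBracket_mono (m n : ℤ) :
    serBracket (mono m) (mono n) = ((m - n : ℤ) : ℂ) • mono (m + n - 1) := by
  rw [serBracket_apply, dser_mono, dser_mono, smul_mul_assoc, mul_smul_comm, mono_mul_mono,
    mono_mul_mono, show m - 1 + n = m + n - 1 by ring, show m + (n - 1) = m + n - 1 by ring]
  push_cast
  module

lemma serCocycle_mono (m n : ℤ) : serCocycle (mono m) (mono n) =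
    if m + n = 2 then ((m : ℂ) - 1) ^ 3 - ((m : ℂ) - 1) else 0 := by
  rw [serCocycle_apply, dser_mono, map_smul, map_smul, dser_mono, map_smul, dser_mono]
  simp only [smul_mul_assoc, ser_coeff_smul, mono_mul_mono, mono_coeff]
  by_cases h : m + n = 2
  · rw [if_pos (by omega), if_pos h]; push_cast; ring
  · rw [if_neg (by omega), if_neg h]; simp

lemma dser_order {f : Ser} {N : ℤ} (hf : ∀ n, n < N → f.coeff n = 0) :
    ∀ n, n < N - 1 → (dser f).coeff n = 0 := fun n hn => by
  rw [dser_coeff, hf _ (by omega), mul_zero]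

lemma mul_order {f g : Ser} {M N : ℤ} (hf : ∀ n, n < M → f.coeff n = 0)
    (hg : ∀ n, n < N → g.coeff n = 0) : ∀ n, n < M + N → (f * g).coeff n = 0 := fun n hn =>
  mul_coeff_eq_zero hf fun k hk => hg k (by omega)

lemma serBracket_order {f g : Ser} {M N : ℤ} (hf : ∀ n, n < M → f.coeff n = 0)
    (hg : ∀ n, n < N → g.coeff n = 0) : ∀ n, n < M + N - 1 → (serBracket f g).coeff n = 0 :=
  fun n hn => by
    rw [serBracket_apply, ser_coeff_sub, mul_order (dser_order hf) hg n (by omega),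
      mul_order hf (dser_order hg) n (by omega), sub_zero]

lemma serCocycle_order {f g : Ser} {M N : ℤ} (hf : ∀ n, n < M → f.coeff n = 0)
    (hg : ∀ n, n < N → g.coeff n = 0) (h : 2 < M + N) : serCocycle f g = 0 := by
  rw [serCocycle_apply]
  exact mul_order (dser_order (dser_order (dser_order hf))) hg _ (by omega)

/-- The defect of the commutation relation of two formal vector fields. -/
def vecDefect (hell : IsRestricted ell) (c : ℂ) (w : W) : Ser →ₗ[ℂ] Ser →ₗ[ℂ] W :=
  LinearMap.mk₂ ℂ (fun f g => vecAct hell f (vecAct hell g w) - vecAct hell g (vecAct hell f w) -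
      (vecAct hell (serBracket f g) w + (c / 12 * serCocycle f g) • w))
    (fun f f' g => by simp only [map_add, LinearMap.add_apply]; module)
    (fun a f g => by simp only [map_smul, LinearMap.smul_apply, smul_eq_mul]; module)
    (fun f g g' => by simp only [map_add, LinearMap.add_apply]; module)
    (fun a f g => by simp only [map_smul, LinearMap.smul_apply, smul_eq_mul]; module)

lemma vecDefect_apply (hell : IsRestricted ell) (c : ℂ) (w : W) (f g : Ser) :
    vecDefect hell c w f g = vecAct hell f (vecAct hell g w) - vecAct hell g (vecAct hell f w) -
      (vecAct hell (serBracket f g) w + (c / 12 * serCocycle f g) • w) := rfl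

lemma vecDefect_tail_right (hell : IsRestricted ell) (c : ℂ) (w : W) (f : Ser) :
    ∃ N : ℤ, ∀ g : Ser, (∀ n, n < N → g.coeff n = 0) → vecDefect hell c w f g = 0 := by
  obtain ⟨N₁, h1⟩ := vecAct_tail hell w
  obtain ⟨N₂, h2⟩ := vecAct_tail hell (vecAct hell f w)
  obtain ⟨M, hM⟩ := ser_bounded f
  -- The first two bounds make `g` kill `w` and `f w`. The bracket lowers the total order by one,
  -- whence N₁ - M + 1; the cocycle vanishes once the total order exceeds 2, whence 3 - M.
  refine ⟨max (max N₁ N₂) (max (N₁ - M + 1) (3 - M)), fun g hg => ?_⟩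
  have hg' : ∀ K, K ≤ max (max N₁ N₂) (max (N₁ - M + 1) (3 - M)) → ∀ n, n < K → g.coeff n = 0 :=
    fun K hK n hn => hg n (by omega)
  rw [vecDefect_apply, h1 g (hg' _ (by omega)), h2 g (hg' _ (by omega)),
    h1 _ (fun n hn => serBracket_order hM (hg' (N₁ - M + 1) (by omega)) n (by omega)),
    serCocycle_order hM (hg' (3 - M) (by omega)) (by omega)]
  simp

lemma vecDefect_tail_left (hell : IsRestricted ell) (c : ℂ) (w : W) (g : Ser) :
    ∃ N : ℤ, ∀ f : Ser, (∀ n, n < N → f.coeff n = 0) → vecDefect hell c w f g = 0 := by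
  obtain ⟨N₁, h1⟩ := vecAct_tail hell w
  obtain ⟨N₂, h2⟩ := vecAct_tail hell (vecAct hell g w)
  obtain ⟨M, hM⟩ := ser_bounded g
  refine ⟨max (max N₁ N₂) (max (N₁ - M + 1) (3 - M)), fun f hf => ?_⟩
  have hf' : ∀ K, K ≤ max (max N₁ N₂) (max (N₁ - M + 1) (3 - M)) → ∀ n, n < K → f.coeff n = 0 :=
    fun K hK n hn => hf n (by omega)
  rw [vecDefect_apply, h1 f (hf' _ (by omega)), h2 f (hf' _ (by omega)),
    h1 _ (fun n hn => serBracket_order (hf' (N₁ - M + 1) (by omega)) hM n (by omega)),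
    serCocycle_order (hf' (3 - M) (by omega)) hM (by omega)]
  simp

/-- The commutation relation of two formal vector fields. -/
lemma vecAct_commutator {c : ℂ} (hell : IsRestricted ell)
    (hvir : ∀ m n, ell m * ell n - ell n * ell m = ((m - n : ℤ) : ℂ) • ell (m + n) +
      (if m + n = 0 then (((m : ℂ) ^ 3 - m) / 12) else 0) • (c • (1 : Module.End ℂ W)))
    (f g : Ser) (w : W) :
    vecAct hell f (vecAct hell g w) - vecAct hell g (vecAct hell f w) =
      vecAct hell (serBracket f g) w + (c / 12 * serCocycle f g) • w := by
  rw [← sub_eq_zero, ← vecDefect_apply]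
  -- On monomials the relation is the Virasoro relation for L_{m-1}, L_{n-1}; it is then extended to
  -- arbitrary series in one argument at a time.
  have hmm : ∀ m n, vecDefect hell c w (mono m) (mono n) = 0 := by
    intro m n
    have h := congrArg (fun A : Module.End ℂ W => A w) (hvir (m - 1) (n - 1))
    simp only [LinearMap.sub_apply, LinearMap.add_apply, LinearMap.smul_apply,
      Module.End.mul_apply, Module.End.one_apply] at h
    rw [vecDefect_apply, serBracket_mono, serCocycle_mono, map_smul, vecAct_mono, vecAct_mono,
      vecAct_mono, h, LinearMap.smul_apply, show m - 1 - (n - 1) = m - n by ring,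
      show m - 1 + (n - 1) = m + n - 1 - 1 by ring]
    by_cases e : m + n = 2
    · rw [if_pos (by omega), if_pos e]; push_cast; module
    · rw [if_neg (by omega), if_neg e]; module
  have hmg : ∀ m g, vecDefect hell c w (mono m) g = 0 := fun m g =>
    linear_eq_zero_of_mono (vecDefect hell c w (mono m)) (hmm m)
      (vecDefect_tail_right hell c w (mono m)) g
  exact linear_eq_zero_of_mono ((vecDefect hell c w).flip g) (fun m => hmg m g)
    (vecDefect_tail_left hell c w g) f

end VectorFields

/-! ### Freeness of Verma modules over the negative part -/

section VermaFree

attribute [local instance] LieRing.ofAssociativeRing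

/-- The universal property of Verma modules. -/
lemma exists_verma_lift {V : Type*} [AddCommGroup V] [Module ℂ V] {ell : ℤ → Module.End ℂ V}
    {h c : ℂ}
    (hvir : ∀ m n, ell m * ell n - ell n * ell m = ((m - n : ℤ) : ℂ) • ell (m + n) +
      (if m + n = 0 then (((m : ℂ) ^ 3 - m) / 12) else 0) • (c • (1 : Module.End ℂ V)))
    {v : V} (hpos : ∀ n, 0 < n → ell n v = 0) (h0 : ell 0 v = h • v) :
    ∃ f : Verma h c →ₗ[ℂ] V, f (Verma.hwVector h c) = v ∧
      ∀ n w, f (Lu n • w) = ell n (f w) := by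
  set ρ : UVir →ₐ[ℂ] Module.End ℂ V :=
    UniversalEnvelopingAlgebra.lift ℂ (virRep ell c hvir) with hρ
  have hL : ∀ n, ρ (Lu n) = ell n := fun n => by
    rw [hρ, Lu, UniversalEnvelopingAlgebra.lift_ι_apply, virRep_L]
  have hC : ρ Cu = c • 1 := by
    rw [hρ, Cu, UniversalEnvelopingAlgebra.lift_ι_apply, virRep_C]
  let _ : Module UVir V := Module.compHom V ρ.toRingHom
  have hs : ∀ (u : UVir) (x : V), u • x = ρ u x := fun _ _ => rfl
  have _ : IsScalarTower ℂ UVir V := ⟨fun a u x => by rw [hs, hs, map_smul]; rfl⟩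
  -- With `V` viewed as a U(Vir)-module through `ρ`, the generators of the ideal annihilate `v`, so
  -- u ↦ u v descends to the Verma module.
  have hle : vermaIdeal h c ≤ LinearMap.ker (LinearMap.toSpanSingleton UVir V v) := by
    rw [vermaIdeal, Submodule.span_le]
    rintro u (⟨n, hn, rfl⟩ | rfl | rfl)
    · change Lu n • v = 0
      rw [hs, hL, hpos n hn]
    · change (Lu 0 - algebraMap ℂ UVir h) • v = 0
      rw [sub_smul, hs, hL, h0, algebraMap_smul, sub_self]
    · change (Cu - algebraMap ℂ UVir c) • v = 0
      rw [sub_smul, hs, hC, algebraMap_smul]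
      exact sub_self _
  refine ⟨((vermaIdeal h c).liftQ _ hle).restrictScalars ℂ, ?_, fun n w => ?_⟩
  · change (1 : UVir) • v = v
    rw [one_smul]
  · change (vermaIdeal h c).liftQ _ hle _ = _
    rw [map_smul, hs, hL]
    rfl

/-- The space of noncommutative polynomials in generators `y₀, y₁, …`, where `yₖ` stands for
`L₋ₖ₋₁`. -/
abbrev Words : Type := List ℕ →₀ ℂ

/-- Left multiplication with a generator. -/
def consWord (k : ℕ) : Words →ₗ[ℂ] Words := Finsupp.lmapDomain ℂ ℂ (List.cons k)

lemma consWord_single (k : ℕ) (t : List ℕ) (a : ℂ) :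
    consWord k (Finsupp.single t a) = Finsupp.single (k :: t) a := by
  simp [consWord]

/-- The value of the central cocycle on `Lₙ`, `L₋ₖ₋₁`, times `c`. -/
def wordCoc (c : ℂ) (n : ℤ) (k : ℕ) : ℂ :=
  if n = k + 1 then ((n : ℂ) ^ 3 - n) / 12 * c else 0

/-- The action of `Lₙ` on words applied to a highest weight vector. -/
def wordActBasis (h c : ℂ) : List ℕ → ℤ → Words
  | [], n => if n < 0 then Finsupp.single [(-n - 1).toNat] 1 else
      if n = 0 then Finsupp.single [] h else 0
  | k :: t, n => if n < 0 then Finsupp.single ((-n - 1).toNat :: k :: t) 1 else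
      consWord k (wordActBasis h c t n) + ((n : ℂ) + (k + 1)) • wordActBasis h c t (n - (k + 1)) +
        wordCoc c n k • Finsupp.single t 1

/-- The action of `Lₙ` on words applied to a highest weight vector. -/
def wordAct (h c : ℂ) (n : ℤ) : Words →ₗ[ℂ] Words :=
  Finsupp.linearCombination ℂ fun t => wordActBasis h c t n

variable (h c : ℂ)

lemma wordAct_single (n : ℤ) (t : List ℕ) :
    wordAct h c n (Finsupp.single t 1) = wordActBasis h c t n := by
  rw [wordAct, Finsupp.linearCombination_single, one_smul]

lemma words_ext {V : Type*} [AddCommGroup V] [Module ℂ V] {φ ψ : Words →ₗ[ℂ] V}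
    (hφ : ∀ t, φ (Finsupp.single t 1) = ψ (Finsupp.single t 1)) : φ = ψ :=
  Finsupp.lhom_ext fun t a => by
    have := congrArg (a • ·) (hφ t)
    simpa only [← map_smul, Finsupp.smul_single, smul_eq_mul, mul_one] using this

lemma wordAct_neg (k : ℕ) (x : Words) : wordAct h c (-(k + 1)) x = consWord k x := by
  revert x
  refine LinearMap.congr_fun (words_ext fun t => ?_)
  rw [wordAct_single, consWord_single]
  have hn : -((k : ℤ) + 1) < 0 := by omega
  have he : (-(-((k : ℤ) + 1)) - 1).toNat = k := by omega
  cases t with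
  | nil => rw [wordActBasis, if_pos hn, he]
  | cons j t => rw [wordActBasis, if_pos hn, he]

lemma wordAct_consWord {n : ℤ} (hn : 0 ≤ n) (k : ℕ) (x : Words) :
    wordAct h c n (consWord k x) = consWord k (wordAct h c n x) +
      ((n : ℂ) + (k + 1)) • wordAct h c (n - (k + 1)) x + wordCoc c n k • x := by
  have : wordAct h c n ∘ₗ consWord k = consWord k ∘ₗ wordAct h c n +
      ((n : ℂ) + (k + 1)) • wordAct h c (n - (k + 1)) + wordCoc c n k • LinearMap.id := by
    refine words_ext fun t => ?_
    simp only [LinearMap.comp_apply, LinearMap.add_apply, LinearMap.smul_apply, LinearMap.id_apply,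
      consWord_single, wordAct_single]
    rw [wordActBasis, if_neg (by omega)]
  exact LinearMap.congr_fun this x

/-- The defining relation of the negative part of the Virasoro algebra. -/
def wordRel (j k : ℕ) (x : Words) : Words :=
  consWord j (consWord k x) - consWord k (consWord j x) -
    ((k : ℂ) - j) • consWord (j + k + 1) x

/-- Words followed by a relation. -/
inductive IsWordRel : Words → Prop
  | base (j k : ℕ) (x : Words) : IsWordRel (wordRel j k x)
  | step (k : ℕ) {y : Words} : IsWordRel y → IsWordRel (consWord k y)

/-- The ideal of relations of the negative part of the Virasoro algebra. -/
def wordRels : Submodule ℂ Words := Submodule.span ℂ {y | IsWordRel y}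

lemma consWord_mem (k : ℕ) {y : Words} (hy : y ∈ wordRels) : consWord k y ∈ wordRels := by
  have : wordRels ≤ wordRels.comap (consWord k) := by
    conv_lhs => rw [wordRels]
    rw [Submodule.span_le]
    intro y hy
    exact Submodule.subset_span (IsWordRel.step k hy)
  exact this hy

/-- The negative part of the enveloping algebra, as the quotient of the words by the
relations. -/
abbrev NegPart : Type := Words ⧸ wordRels

/-- Left multiplication with a generator. -/
def negCons (k : ℕ) : NegPart →ₗ[ℂ] NegPart :=
  wordRels.mapQ wordRels (consWord k) fun _ hy => consWord_mem k hy

lemma negCons_mk (k : ℕ) (x : Words) :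
    negCons k (wordRels.mkQ x) = wordRels.mkQ (consWord k x) := rfl

lemma negCons_comm (j k : ℕ) (q : NegPart) :
    negCons j (negCons k q) = negCons k (negCons j q) +
      ((k : ℂ) - j) • negCons (j + k + 1) q := by
  obtain ⟨x, rfl⟩ := wordRels.mkQ_surjective q
  have : wordRels.mkQ (wordRel j k x) = 0 := by
    rw [Submodule.mkQ_apply, Submodule.Quotient.mk_eq_zero]
    exact Submodule.subset_span (IsWordRel.base j k x)
  rw [wordRel, map_sub, map_sub, map_smul, sub_sub, sub_eq_zero] at this
  simpa only [negCons_mk] using this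

/-- For n ≥ 0 the rule is the recursion defining the action. For n < 0 both operators are letters
and the rule is one of the imposed relations, so it holds only after passing to the quotient. -/
lemma mk_wordAct_consWord (n : ℤ) (k : ℕ) (x : Words) :
    wordRels.mkQ (wordAct h c n (consWord k x)) = negCons k (wordRels.mkQ (wordAct h c n x)) +
      ((n : ℂ) + (k + 1)) • wordRels.mkQ (wordAct h c (n - (k + 1)) x) +
      wordCoc c n k • wordRels.mkQ x := by
  rcases le_or_gt 0 n with hn | hn
  · rw [wordAct_consWord h c hn, map_add, map_add, map_smul, map_smul]
    rfl
  · obtain ⟨m, rfl⟩ : ∃ m : ℕ, n = -((m : ℤ) + 1) := ⟨(-n - 1).toNat, by omega⟩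
    rw [show -((m : ℤ) + 1) - (k + 1) = -(((m + k + 1 : ℕ) : ℤ) + 1) by push_cast; ring,
      wordAct_neg, wordAct_neg, wordAct_neg, wordCoc, if_neg (by omega), ← negCons_mk,
      ← negCons_mk, ← negCons_mk, ← negCons_mk, negCons_comm]
    push_cast
    module

/-- Moving Lₙ past the two letters of a basic relation again gives zero modulo relations, by the
Jacobi identity of Vir. All n are treated together, since passing the letter yₖ creates L_{n-k-1}.
-/
lemma wordAct_mem (n : ℤ) {y : Words} (hy : y ∈ wordRels) : wordAct h c n y ∈ wordRels := by
  have key : ∀ y, IsWordRel y → ∀ n, wordRels.mkQ (wordAct h c n y) = 0 := by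
    intro y hy
    induction hy with
    | base j k x =>
      intro n
      simp only [wordRel, map_sub, map_smul, mk_wordAct_consWord, map_add]
      simp only [← negCons_mk]
      rw [negCons_comm j k, show n - (k + 1) - ((j : ℤ) + 1) = n - (j + k + 1 + 1) by ring,
        show n - (j + 1) - ((k : ℤ) + 1) = n - (j + k + 1 + 1) by ring]
      push_cast
      -- The multiples of `x` cancel by the cocycle identity for Lₙ, L₋ⱼ₋₁, L₋ₖ₋₁; every term
      -- vanishes unless n = j + k + 2.
      have hc : ((n : ℂ) + (j + 1)) * wordCoc c (n - (j + 1)) k -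
          ((n : ℂ) + (k + 1)) * wordCoc c (n - (k + 1)) j -
          ((k : ℂ) - j) * wordCoc c n (j + k + 1) = 0 := by
        unfold wordCoc
        by_cases e : n = j + k + 1 + 1
        · subst e
          rw [if_pos (by ring), if_pos (by ring), if_pos (by push_cast; ring)]
          push_cast
          ring
        · rw [if_neg (by omega), if_neg (by omega), if_neg (by push_cast; omega)]
          simp
      have hc' := congrArg (· • wordRels.mkQ x) hc
      simp only [zero_smul] at hc'
      rw [← hc']
      module
    | step k hy ih =>
      intro n
      rw [mk_wordAct_consWord, ih, ih]
      have : wordRels.mkQ _ = 0 :=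
        (Submodule.Quotient.mk_eq_zero _).mpr (Submodule.subset_span hy)
      rw [this]
      simp
  have : wordRels ≤ wordRels.comap (wordAct h c n) := by
    conv_lhs => rw [wordRels]
    rw [Submodule.span_le]
    intro y hy
    exact (Submodule.Quotient.mk_eq_zero wordRels).mp (key y hy n)
  exact this hy

/-- The action of `Lₙ` on the negative part. -/
def negAct (n : ℤ) : Module.End ℂ NegPart :=
  wordRels.mapQ wordRels (wordAct h c n) fun _ hy => wordAct_mem h c n hy

lemma negAct_mk (n : ℤ) (x : Words) :
    negAct h c n (wordRels.mkQ x) = wordRels.mkQ (wordAct h c n x) := rfl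

lemma negAct_negCons (n : ℤ) (k : ℕ) (q : NegPart) :
    negAct h c n (negCons k q) = negCons k (negAct h c n q) +
      ((n : ℂ) + (k + 1)) • negAct h c (n - (k + 1)) q + wordCoc c n k • q := by
  obtain ⟨x, rfl⟩ := wordRels.mkQ_surjective q
  rw [negCons_mk, negAct_mk, mk_wordAct_consWord]
  rfl

lemma negAct_neg (k : ℕ) (q : NegPart) : negAct h c (-(k + 1)) q = negCons k q := by
  obtain ⟨x, rfl⟩ := wordRels.mkQ_surjective q
  rw [negAct_mk, wordAct_neg]
  rfl

/-- The empty word. -/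
def negOne : NegPart := wordRels.mkQ (Finsupp.single [] 1)

lemma negPart_induction {p : NegPart → Prop} (h0 : p 0) (hadd : ∀ x y, p x → p y → p (x + y))
    (hsmul : ∀ (a : ℂ) x, p x → p (a • x)) (h1 : p negOne)
    (hcons : ∀ k x, p x → p (negCons k x)) (q : NegPart) : p q := by
  obtain ⟨x, rfl⟩ := wordRels.mkQ_surjective q
  have hb : ∀ t : List ℕ, p (wordRels.mkQ (Finsupp.single t 1)) := by
    intro t
    induction t with
    | nil => exact h1
    | cons k t ih =>
      have := hcons k _ ih
      rwa [negCons_mk, consWord_single] at this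
  induction x using Finsupp.induction_linear with
  | zero => rwa [map_zero]
  | add f g hf hg => rw [map_add]; exact hadd _ _ hf hg
  | single t a =>
    have := hsmul a _ (hb t)
    rwa [← map_smul, Finsupp.smul_single, smul_eq_mul, mul_one] at this

lemma negAct_negOne_pos {n : ℤ} (hn : 0 < n) : negAct h c n negOne = 0 := by
  rw [negOne, negAct_mk, wordAct_single, wordActBasis, if_neg (by omega), if_neg (by omega),
    map_zero]

lemma negAct_negOne_zero : negAct h c 0 negOne = h • negOne := by
  rw [negOne, negAct_mk, wordAct_single, wordActBasis, if_neg (by omega), if_pos rfl, ← map_smul,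
    Finsupp.smul_single, smul_eq_mul, mul_one]

/-- A negative mode is left multiplication by a letter, so this is `negAct_negCons` with the indices
rewritten. -/
lemma negAct_comm_neg (n : ℤ) {m : ℤ} (hm : m < 0) (q : NegPart) :
    negAct h c n (negAct h c m q) = negAct h c m (negAct h c n q) +
      ((n : ℂ) - m) • negAct h c (n + m) q +
      (if n + m = 0 then ((n : ℂ) ^ 3 - n) / 12 * c else 0) • q := by
  obtain ⟨k, rfl⟩ : ∃ k : ℕ, m = -((k : ℤ) + 1) := ⟨(-m - 1).toNat, by omega⟩
  rw [negAct_neg, negAct_neg, negAct_negCons, wordCoc]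
  have e : (n = k + 1) ↔ (n + -((k : ℤ) + 1) = 0) := by omega
  simp only [e]
  rw [← sub_eq_add_neg]
  push_cast
  module

/-- Induction on words, for all m and n at once. On the empty word the highest weight conditions
decide the nonnegative modes; passing a letter yₖ is the Jacobi identity for Lₘ, Lₙ, L₋ₖ₋₁. -/
lemma negAct_comm (m n : ℤ) (q : NegPart) :
    negAct h c m (negAct h c n q) = negAct h c n (negAct h c m q) +
      ((m : ℂ) - n) • negAct h c (m + n) q +
      (if m + n = 0 then ((m : ℂ) ^ 3 - m) / 12 * c else 0) • q := by
  revert m n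
  induction q using negPart_induction with
  | h0 => simp
  | hadd x y hx hy =>
    intro m n
    simp only [map_add, hx m n, hy m n, smul_add]
    abel
  | hsmul a x hx =>
    intro m n
    simp only [map_smul, hx m n, smul_add, smul_comm a]
  | h1 =>
    intro m n
    rcases lt_or_ge n 0 with hn | hn
    · exact negAct_comm_neg h c m hn _
    -- If m is negative, the relation is the previous case with the roles of m and n exchanged; the
    -- central terms agree because (m³ - m)/12 is odd in m.
    rcases lt_or_ge m 0 with hm | hm
    · rw [negAct_comm_neg h c n hm, add_comm n m]
      by_cases e : m + n = 0
      · obtain rfl : n = -m := by omega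
        simp only [if_pos e]
        push_cast
        module
      · simp only [if_neg e]
        module
    rcases hn.eq_or_lt with rfl | hn <;> rcases hm.eq_or_lt with rfl | hm
    · simp
    · rw [negAct_negOne_zero, map_smul, add_zero, negAct_negOne_pos h c hm, if_neg (by omega)]
      simp
    · rw [negAct_negOne_zero, map_smul, zero_add, negAct_negOne_pos h c hn, if_neg (by omega)]
      simp
    · rw [negAct_negOne_pos h c hn, negAct_negOne_pos h c hm,
        negAct_negOne_pos h c (by omega : 0 < m + n), if_neg (by omega)]
      simp
  | hcons k x ih =>
    intro m n
    simp only [negAct_negCons, map_add, map_smul]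
    rw [ih m n, ih (m - (k + 1)) n, ih m (n - (k + 1)), map_add, map_add, map_smul, map_smul,
      show m - (k + 1) + n = m + n - ((k : ℤ) + 1) by ring,
      show m + (n - (k + 1)) = m + n - ((k : ℤ) + 1) by ring]
    -- The central parts cancel by the cocycle identity, which is nontrivial only for m + n = k + 1.
    have hc : ((m : ℂ) + (k + 1)) *
          (if m + n - ((k : ℤ) + 1) = 0 then
            (((m - (k + 1) : ℤ) : ℂ) ^ 3 - (m - (k + 1) : ℤ)) / 12 * c else 0) +
        ((n : ℂ) + (k + 1)) *
          (if m + n - ((k : ℤ) + 1) = 0 then ((m : ℂ) ^ 3 - m) / 12 * c else 0) -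
        ((m : ℂ) - n) * wordCoc c (m + n) k = 0 := by
      unfold wordCoc
      by_cases e : m + n = k + 1
      · obtain rfl : n = k + 1 - m := by omega
        rw [if_pos (by ring), if_pos (by ring), if_pos (by ring)]
        push_cast
        ring
      · rw [if_neg (by omega), if_neg (by omega), if_neg e]
        simp
    have hc' := congrArg (· • x) hc
    simp only [zero_smul] at hc'
    rw [← sub_eq_zero, ← hc']
    push_cast
    module

lemma negAct_commutator (m n : ℤ) :
    negAct h c m * negAct h c n - negAct h c n * negAct h c m =
      ((m - n : ℤ) : ℂ) • negAct h c (m + n) +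
      (if m + n = 0 then (((m : ℂ) ^ 3 - m) / 12) else 0) •
        (c • (1 : Module.End ℂ NegPart)) := by
  refine LinearMap.ext fun q => ?_
  simp only [LinearMap.sub_apply, LinearMap.add_apply, LinearMap.smul_apply,
    Module.End.mul_apply, Module.End.one_apply]
  rw [negAct_comm]
  split_ifs
  · push_cast; module
  · push_cast; module

/-- The Verma module is free over the negative part of the Virasoro algebra: a vector `x` of
weight `h` in a module of the span of the `Lₙ` with `n ≤ 0` is the image of the highest weight
vector under a unique homomorphism. -/
lemma exists_verma_lift_nonpos {X : Type*} [AddCommGroup X] [Module ℂ X]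
    {a : ℤ → Module.End ℂ X} (ha : ∀ m n, m ≤ 0 → n ≤ 0 → ∀ y, a m (a n y) =
      a n (a m y) + ((m : ℂ) - n) • a (m + n) y) {x : X} (hx : a 0 x = h • x) :
    ∃ f : Verma h c →ₗ[ℂ] X, f (Verma.hwVector h c) = x ∧
      ∀ n ≤ 0, ∀ w, f (Lu n • w) = a n (f w) := by
  -- A word is evaluated by letting its letters act on `x`; the relations go to zero because the `a
  -- n` with n ≤ 0 satisfy the same commutation rule.
  set θ : Words →ₗ[ℂ] X := Finsupp.linearCombination ℂ
    fun t => t.foldr (fun k y => a (-(k + 1)) y) x with hθ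
  have hcons : ∀ k y, θ (consWord k y) = a (-(k + 1)) (θ y) := fun k => by
    refine LinearMap.congr_fun (f := θ ∘ₗ consWord k) (g := a (-(k + 1)) ∘ₗ θ)
      (words_ext fun t => ?_)
    simp [hθ, consWord_single]
  have hone : θ (Finsupp.single [] 1) = x := by simp [hθ]
  have hker : ∀ y, IsWordRel y → θ y = 0 := by
    intro y hy
    induction hy with
    | base j k y =>
      rw [wordRel, map_sub, map_sub, map_smul, hcons, hcons, hcons, hcons, hcons,
        ha _ _ (by omega) (by omega)]
      push_cast
      rw [show -((j : ℤ) + 1) + -((k : ℤ) + 1) = -(j + k + 1 + 1) by ring]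
      module
    | step k _ ih => rw [hcons, ih, map_zero]
  set g : NegPart →ₗ[ℂ] X := wordRels.liftQ θ (by
    rw [wordRels, Submodule.span_le]
    exact fun y hy => hker y hy) with hg
  have hgm : ∀ y, g (wordRels.mkQ y) = θ y := fun y => rfl
  have hgcons : ∀ k q, g (negCons k q) = a (-(k + 1)) (g q) := fun k q => by
    obtain ⟨y, rfl⟩ := wordRels.mkQ_surjective q
    rw [negCons_mk, hgm, hgm, hcons]
  -- L₀ is not a letter, so its compatibility is proved by induction on words, starting from the
  -- weight of `x`.
  have hg0 : ∀ q, g (negAct h c 0 q) = a 0 (g q) := by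
    intro q
    induction q using negPart_induction with
    | h0 => simp
    | hadd x y hx hy => rw [map_add, map_add, map_add, map_add, hx, hy]
    | hsmul b x hx => rw [map_smul, map_smul, map_smul, map_smul, hx]
    | h1 => rw [negAct_negOne_zero, map_smul, negOne, hgm, hone, hx]
    | hcons k q ih =>
      rw [negAct_negCons, map_add, map_add, map_smul, map_smul, hgcons, hgcons, ih, wordCoc,
        if_neg (by omega), ha 0 _ (by omega) (by omega), zero_add, zero_sub, negAct_neg, hgcons]
      push_cast
      module
  -- The words modulo relations form a Virasoro module with highest weight vector the empty word, so
  -- the Verma module maps to it; composing with `g` gives the lift without choosing a basis of the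
  -- Verma module.
  obtain ⟨f, hf1, hf⟩ := exists_verma_lift (h := h) (negAct_commutator h c)
    (fun n hn => negAct_negOne_pos h c hn) (negAct_negOne_zero h c)
  refine ⟨g ∘ₗ f, ?_, fun n hn w => ?_⟩
  · rw [LinearMap.comp_apply, hf1, negOne, hgm, hone]
  · rw [LinearMap.comp_apply, LinearMap.comp_apply, hf]
    rcases hn.eq_or_lt with rfl | hn
    · exact hg0 _
    · obtain ⟨k, rfl⟩ : ∃ k : ℕ, n = -((k : ℤ) + 1) := ⟨(-n - 1).toNat, by omega⟩
      rw [negAct_neg, hgcons]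

end VermaFree

/-! ### The three-point form on highest weight vectors -/

section PrimaryForm

/-- The space of Laurent polynomials, with basis `eₖ`. -/
def Density : Type := ℤ →₀ ℂ

instance : AddCommGroup Density := inferInstanceAs (AddCommGroup (ℤ →₀ ℂ))
instance : Module ℂ Density := inferInstanceAs (Module ℂ (ℤ →₀ ℂ))

/-- The Laurent polynomial `a eₖ`. -/
def densSingle (k : ℤ) : ℂ →ₗ[ℂ] Density := Finsupp.lsingle k

/-- The linear map with prescribed values on the basis `eₖ`. -/
def densLift {V : Type*} [AddCommGroup V] [Module ℂ V] (f : ℤ → V) : Density →ₗ[ℂ] V :=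
  Finsupp.linearCombination ℂ f

lemma densLift_single {V : Type*} [AddCommGroup V] [Module ℂ V] (f : ℤ → V) (k : ℤ) (a : ℂ) :
    densLift f (densSingle k a) = a • f k :=
  Finsupp.linearCombination_single ℂ a k

lemma density_induction {p : Density → Prop} (h0 : p 0) (hadd : ∀ x y, p x → p y → p (x + y))
    (hs : ∀ k a, p (densSingle k a)) (x : Density) : p x :=
  Finsupp.induction_linear x h0 (fun x y => hadd x y) hs

/-- The operator `eₖ ↦ (k + κ + n η) eₖ₊ₙ`. -/
def densAct (κ η : ℂ) (n : ℤ) : Module.End ℂ Density :=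
  densLift fun k : ℤ => densSingle (k + n) ((k : ℂ) + κ + n * η)

lemma densAct_single (κ η : ℂ) (n k : ℤ) (a : ℂ) :
    densAct κ η n (densSingle k a) = densSingle (k + n) (a * ((k : ℂ) + κ + n * η)) := by
  rw [densAct, densLift_single, ← map_smul, smul_eq_mul]

/-- If eₖ is read as z^(k+κ), the operator `densAct κ η n` is zⁿ (z d/dz + n η). These satisfy the
Witt relations with the opposite sign, which is why `densAct` is later used with index -n. -/
lemma densAct_comm (κ η : ℂ) (m n : ℤ) (y : Density) :
    densAct κ η m (densAct κ η n y) = densAct κ η n (densAct κ η m y) +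
      ((n : ℂ) - m) • densAct κ η (m + n) y := by
  induction y using density_induction with
  | h0 => simp
  | hadd x y hx hy => simp only [map_add, hx, hy, smul_add]; abel
  | hs k a =>
    simp only [densAct_single]
    rw [show k + n + m = k + (m + n) by ring, show k + m + n = k + (m + n) by ring,
      ← map_smul, ← map_add, smul_eq_mul]
    congr 1
    push_cast
    ring

/-- The evaluation of a Laurent polynomial at `1`. -/
def densEval : Density →ₗ[ℂ] ℂ := densLift fun _ => (1 : ℂ)

lemma densEval_single (k : ℤ) (a : ℂ) : densEval (densSingle k a) = a := by
  rw [densEval, densLift_single, smul_eq_mul, mul_one]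

/-- Evaluation at 1 forgets the shift of the exponent, so n enters only through the summand n η.
This becomes the term n h₁ of `exists_primary_form`. -/
lemma densEval_densAct (κ η : ℂ) (n : ℤ) (y : Density) :
    densEval (densAct κ η n y) = densEval (densAct κ η 0 y) + n * η * densEval y := by
  induction y using density_induction with
  | h0 => simp
  | hadd x y hx hy => simp only [map_add, hx, hy]; ring
  | hs k a =>
    simp only [densAct_single, densEval_single]
    push_cast
    ring

/-- The action of `Lₙ` on the linear maps from a Virasoro module to Laurent polynomials. -/
def densHomAct (W : Type*) [AddCommGroup W] [Module ℂ W] [Module UVir W] [IsScalarTower ℂ UVir W]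
    (κ η : ℂ) (n : ℤ) : Module.End ℂ (W →ₗ[ℂ] Density) where
  toFun ψ := ψ ∘ₗ opL W (-n) - densAct κ η n ∘ₗ ψ
  map_add' ψ φ := by
    refine LinearMap.ext fun u => ?_
    simp only [LinearMap.sub_apply, LinearMap.add_apply, LinearMap.comp_apply, map_add]
    abel
  map_smul' a ψ := by
    refine LinearMap.ext fun u => ?_
    simp only [LinearMap.sub_apply, LinearMap.smul_apply, LinearMap.comp_apply, map_smul,
      RingHom.id_apply, smul_sub]

lemma densHomAct_apply {W : Type*} [AddCommGroup W] [Module ℂ W] [Module UVir W]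
    [IsScalarTower ℂ UVir W] (κ η : ℂ) (n : ℤ) (ψ : W →ₗ[ℂ] Density) (u : W) :
    densHomAct W κ η n ψ u = ψ (Lu (-n) • u) - densAct κ η n (ψ u) := rfl

/-- Sending Lₙ to the transpose of L₋ₙ preserves the Virasoro relations with their central charge,
and the action on Laurent polynomials has central charge zero; hence the total charge is again c. -/
lemma densHomAct_commutator {W : Type*} [AddCommGroup W] [Module ℂ W] [Module UVir W]
    [IsScalarTower ℂ UVir W] {c : ℂ} [IsGradedVirModule c W] (κ η : ℂ) (m n : ℤ) :
    densHomAct W κ η m * densHomAct W κ η n - densHomAct W κ η n * densHomAct W κ η m =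
      ((m - n : ℤ) : ℂ) • densHomAct W κ η (m + n) +
      (if m + n = 0 then (((m : ℂ) ^ 3 - m) / 12) else 0) •
        (c • (1 : Module.End ℂ (W →ₗ[ℂ] Density))) := by
  refine LinearMap.ext fun ψ => LinearMap.ext fun u => ?_
  simp only [LinearMap.sub_apply, LinearMap.add_apply, LinearMap.smul_apply,
    Module.End.mul_apply, Module.End.one_apply, densHomAct_apply, map_sub]
  rw [Lu_smul_smul (-n) (-m), densAct_comm κ η m n, IsGradedVirModule.central (c := c) u,
    map_add, map_add, LinearMap.map_smul ψ, LinearMap.map_smul ψ, LinearMap.map_smul ψ,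
    show -n + -m = -(m + n) by ring]
  by_cases e : m + n = 0
  · obtain rfl : n = -m := by omega
    rw [if_pos (by omega), if_pos e]
    push_cast
    module
  · rw [if_neg (by omega), if_neg e]
    push_cast
    module

/-- There is a bilinear form on `M(h₂, c) × M(h₃, c)` that is semi-invariant under the vector
fields on `ℂ \ {0}` vanishing at `1`, normalized on highest weight vectors. -/
lemma exists_primary_form (h₁ h₂ h₃ c : ℂ) :
    ∃ B : Verma h₂ c →ₗ[ℂ] Verma h₃ c →ₗ[ℂ] ℂ,
      B (Verma.hwVector h₂ c) (Verma.hwVector h₃ c) = 1 ∧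
      ∀ (n : ℤ) (w : Verma h₂ c) (u : Verma h₃ c),
        B (Lu n • w) u - B (Lu 0 • w) u =
          B w (Lu (-n) • u) - B w (Lu 0 • u) - n * h₁ * B w u := by
  -- Up to the factor z^(h₁), the map `ψ` models u ↦ ⟨I(v₁, z) v₂, u⟩, whose value at v₃ is
  -- proportional to z^(h₃ - h₂). The conditions Lₙ v₂ = 0 for n > 0 and L₀ v₂ = h₂ v₂ dictate the
  -- operators `a n` by which L₀ and the negative modes must act.
  set κ := h₃ - h₂ with hκ
  set a : ℤ → Module.End ℂ Density := fun n => densAct κ h₁ (-n) +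
    (if n = 0 then h₂ else 0) • 1 with ha
  obtain ⟨ψ, hψ1, hψ⟩ := exists_verma_lift_nonpos h₃ c (a := a) (fun m n hm hn y => by
    simp only [ha, LinearMap.add_apply, LinearMap.smul_apply, Module.End.one_apply, map_add,
      map_smul]
    rw [densAct_comm, show -m + -n = -(m + n) by ring]
    by_cases e : m + n = 0
    · obtain rfl : m = 0 := by omega
      obtain rfl : n = 0 := by omega
      simp
    · rw [if_neg e]
      push_cast
      module) (x := densSingle 0 1) (by
    simp only [ha, LinearMap.add_apply, LinearMap.smul_apply, Module.End.one_apply, if_true,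
      densAct_single]
    rw [show (0 : ℤ) + -0 = 0 by ring, ← map_smul, ← map_smul, ← map_add, hκ, smul_eq_mul,
      smul_eq_mul]
    congr 1
    push_cast
    ring)
  -- The choice of `a` makes `ψ` a highest weight vector of weight h₂ among the maps from M(h₃) to
  -- Laurent polynomials.
  obtain ⟨f, hf1, hf⟩ := exists_verma_lift (h := h₂)
    (densHomAct_commutator (W := Verma h₃ c) (c := c) κ h₁) (v := ψ)
    (fun n hn => LinearMap.ext fun u => by
      rw [densHomAct_apply, hψ _ (by omega), ha]
      simp only [LinearMap.add_apply, LinearMap.smul_apply, Module.End.one_apply]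
      rw [if_neg (by omega), neg_neg]
      simp)
    (LinearMap.ext fun u => by
      rw [densHomAct_apply, hψ _ (by omega), ha]
      simp)
  refine ⟨f.compr₂ densEval, ?_, fun n w u => ?_⟩
  · rw [LinearMap.compr₂_apply, hf1, hψ1, densEval_single]
  · simp only [LinearMap.compr₂_apply, hf, densHomAct_apply, map_sub]
    rw [densEval_densAct κ h₁ n, neg_zero]
    ring

end PrimaryForm

/-! ### Invariant trilinear forms -/

section InvariantForm

variable {c : ℂ} {W₁ W₂ W₃ : Type*}
  [AddCommGroup W₁] [Module ℂ W₁] [Module UVir W₁] [IsScalarTower ℂ UVir W₁]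
  [AddCommGroup W₂] [Module ℂ W₂] [Module UVir W₂] [IsScalarTower ℂ UVir W₂]
  [AddCommGroup W₃] [Module ℂ W₃] [Module UVir W₃] [IsScalarTower ℂ UVir W₃]
  [IsGradedVirModule c W₁] [IsGradedVirModule c W₂] [IsGradedVirModule c W₃]

/-- The action of formal vector fields on a module of central charge `c`. -/
def virAct (c : ℂ) (W : Type*) [AddCommGroup W] [Module ℂ W] [Module UVir W]
    [IsScalarTower ℂ UVir W] [IsGradedVirModule c W] : Ser →ₗ[ℂ] Module.End ℂ W :=
  vecAct (isRestricted_opL c W)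

lemma virAct_mono (n : ℤ) (w : W₁) : virAct c W₁ (mono n) w = Lu (n - 1) • w := by
  rw [virAct, vecAct_mono, opL_apply]

lemma virAct_comm (f g : Ser) (w : W₁) :
    virAct c W₁ f (virAct c W₁ g w) = virAct c W₁ g (virAct c W₁ f w) +
      (virAct c W₁ (serBracket f g) w + (c / 12 * serCocycle f g) • w) := by
  rw [← sub_eq_iff_eq_add']
  exact vecAct_commutator (isRestricted_opL c W₁) (opL_commutator c W₁) f g w

/-- The bracket `f' g - f g'` of vector fields on the sphere. -/
def triBracket (f g : Tri) : Tri := dtri f * g - f * dtri g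

lemma triBracket_fst (f g : Tri) : (triBracket f g).1 = serBracket f.1 g.1 := rfl

lemma triBracket_snd (f g : Tri) : (triBracket f g).2.1 = serBracket f.2.1 g.2.1 := rfl

lemma triBracket_mem {f g : Tri} (hf : f ∈ ratSpan) (hg : g ∈ ratSpan) :
    triBracket f g ∈ ratSpan :=
  sub_mem (ratSpan_mul_mem (dtri_mem hf) hg) (ratSpan_mul_mem hf (dtri_mem hg))

/-- The bracket of vector fields does not depend on the chart; here it is compared in the coordinate
t = z⁻¹. -/
lemma vecInf_bracket (f g : Tri) :
    serBracket (vecInf f.2.2) (vecInf g.2.2) = vecInf (triBracket f g).2.2 := by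
  change _ = -(mono 2 * (-(mono 2 * dser f.2.2) * g.2.2 - f.2.2 * -(mono 2 * dser g.2.2)))
  rw [vecInf, vecInf, serBracket_apply, map_neg, map_neg, dser_mono_mul, dser_mono_mul,
    ← HahnSeries.C_mul_eq_smul, ← HahnSeries.C_mul_eq_smul]
  ring

/-- The third derivative turns vector fields into quadratic differentials equivariantly under Möbius
maps. For t = z⁻¹ the field becomes -t² f, and the quadratic differential acquires the factor
(dz/dt)² = t⁻⁴. -/
lemma dser_vecInf (f : Tri) :
    dser (dser (dser (vecInf f.2.2))) = mono (-4) * (dtri (dtri (dtri f))).2.2 := by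
  have h : ∀ g : Tri, (dtri g).2.2 = -(mono 2 * dser g.2.2) := fun _ => rfl
  ext k
  simp only [h, vecInf, mono_mul_coeff, ser_coeff_neg, dser_coeff]
  rw [show k + 1 + 1 + 1 - 2 = k + 1 by ring, show k - -4 - 2 + 1 - 2 + 1 - 2 + 1 = k + 1 by ring]
  push_cast
  ring

/-- Each cocycle is the residue of the global form f''' g dz at one of the three points, so the
residue theorem applies. -/
lemma serCocycle_sum {f g : Tri} (hf : f ∈ ratSpan) (hg : g ∈ ratSpan) :
    serCocycle f.1 g.1 + serCocycle f.2.1 g.2.1 +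
      serCocycle (vecInf f.2.2) (vecInf g.2.2) = 0 := by
  have h := resSum_eq_zero (ratSpan_mul_mem (dtri_mem (dtri_mem (dtri_mem hf))) hg)
  rw [resSum_apply] at h
  have e : serCocycle (vecInf f.2.2) (vecInf g.2.2) =
      -((dtri (dtri (dtri f))) * g).2.2.coeff 1 := by
    rw [serCocycle_apply, dser_vecInf, vecInf,
      show mono (-4) * (dtri (dtri (dtri f))).2.2 * -(mono 2 * g.2.2) =
        -((mono (-4) * mono 2) * ((dtri (dtri (dtri f))).2.2 * g.2.2)) by ring,
      mono_mul_mono, ser_coeff_neg, mono_mul_coeff]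
    rfl
  rw [e, ← h]
  change (_ : ℂ) + _ + _ = _ + (_ - _)
  rw [serCocycle_apply, serCocycle_apply]
  change (_ : ℂ) = (dser (dser (dser f.1)) * g.1).coeff (-1) +
    ((dser (dser (dser f.2.1)) * g.2.1).coeff (-1) - _)
  ring

/-- The action of the vector fields on the sphere on bilinear forms, where `0` corresponds to the
first and `∞` to the second argument. -/
def formAct (c : ℂ) (W₂ W₃ : Type*)
    [AddCommGroup W₂] [Module ℂ W₂] [Module UVir W₂] [IsScalarTower ℂ UVir W₂]
    [AddCommGroup W₃] [Module ℂ W₃] [Module UVir W₃] [IsScalarTower ℂ UVir W₃]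
    [IsGradedVirModule c W₂] [IsGradedVirModule c W₃] :
    Tri →ₗ[ℂ] Module.End ℂ (W₂ →ₗ[ℂ] W₃ →ₗ[ℂ] ℂ) :=
  LinearMap.mk₂ ℂ (fun g B => -(B ∘ₗ virAct c W₂ g.1) - B.compl₂ (virAct c W₃ (vecInf g.2.2)))
    (fun f g B => by
      refine LinearMap.ext₂ fun w u => ?_
      simp only [vecInf, Prod.fst_add, Prod.snd_add, mul_add, map_neg, map_add, LinearMap.sub_apply,
        LinearMap.add_apply, LinearMap.neg_apply, LinearMap.comp_apply, LinearMap.compl₂_apply]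
      ring)
    (fun a g B => by
      refine LinearMap.ext₂ fun w u => ?_
      simp only [vecInf, Prod.smul_fst, Prod.smul_snd, mul_smul_comm, map_neg, map_smul,
        LinearMap.sub_apply, LinearMap.smul_apply, LinearMap.neg_apply, LinearMap.comp_apply,
        LinearMap.compl₂_apply, smul_eq_mul]
      ring)
    (fun g B B' => by
      refine LinearMap.ext₂ fun w u => ?_
      simp only [LinearMap.sub_apply, LinearMap.add_apply, LinearMap.neg_apply,
        LinearMap.comp_apply, LinearMap.compl₂_apply]
      ring)
    (fun a g B => by
      refine LinearMap.ext₂ fun w u => ?_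
      simp only [LinearMap.sub_apply, LinearMap.smul_apply, LinearMap.neg_apply,
        LinearMap.comp_apply, LinearMap.compl₂_apply, smul_eq_mul]
      ring)

lemma formAct_apply (g : Tri) (B : W₂ →ₗ[ℂ] W₃ →ₗ[ℂ] ℂ) (w : W₂) (u : W₃) :
    formAct c W₂ W₃ g B w u = -B (virAct c W₂ g.1 w) u - B w (virAct c W₃ (vecInf g.2.2) u) :=
  rfl

/-- The central contributions at 0 and ∞ do not cancel each other. By `serCocycle_sum`, and because
of the minus signs of a dual action, they amount to the cocycle at 1, so forms behave like a module
of charge c sitting at 1. -/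
lemma formAct_comm {f g : Tri} (hf : f ∈ ratSpan) (hg : g ∈ ratSpan)
    (B : W₂ →ₗ[ℂ] W₃ →ₗ[ℂ] ℂ) :
    formAct c W₂ W₃ f (formAct c W₂ W₃ g B) = formAct c W₂ W₃ g (formAct c W₂ W₃ f B) +
      (formAct c W₂ W₃ (triBracket f g) B + (c / 12 * serCocycle f.2.1 g.2.1) • B) := by
  refine LinearMap.ext₂ fun w u => ?_
  have h := serCocycle_sum hf hg
  simp only [formAct_apply, LinearMap.add_apply, LinearMap.smul_apply, smul_eq_mul]
  rw [virAct_comm f.1 g.1, virAct_comm (vecInf f.2.2) (vecInf g.2.2), vecInf_bracket,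
    triBracket_fst]
  simp only [map_add, map_smul, LinearMap.add_apply, LinearMap.smul_apply, smul_eq_mul]
  linear_combination (-(c / 12) * B w u) * h

lemma triBracket_wfun (m n : ℤ) :
    triBracket (wfun (m + 1)) (wfun (n + 1)) = ((m - n : ℤ) : ℂ) • wfun (m + n + 1) := by
  have hs : ∀ (a : ℂ) (f g : Tri), a • f * g = a • (f * g) := fun a f g => smul_mul_assoc a f g
  have hs' : ∀ (a : ℂ) (f g : Tri), f * a • g = a • (f * g) := fun a f g => mul_smul_comm a f g
  rw [triBracket, dtri_wfun, dtri_wfun, hs, hs', wfun_mul, wfun_mul,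
    show m + 1 - 1 + (n + 1) = m + n + 1 by ring, show m + 1 + (n + 1 - 1) = m + n + 1 by ring]
  push_cast
  module

/-- In the coordinate z - 1 the field (z - 1)^(n+1) ∂_z is a monomial, so it plays the role of Lₙ.
This is the Virasoro action to which the universal property of M(h₁) is applied. -/
lemma formAct_commutator (m n : ℤ) :
    formAct c W₂ W₃ (wfun (m + 1)) * formAct c W₂ W₃ (wfun (n + 1)) -
      formAct c W₂ W₃ (wfun (n + 1)) * formAct c W₂ W₃ (wfun (m + 1)) =
      ((m - n : ℤ) : ℂ) • formAct c W₂ W₃ (wfun (m + n + 1)) +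
      (if m + n = 0 then (((m : ℂ) ^ 3 - m) / 12) else 0) •
        (c • (1 : Module.End ℂ (W₂ →ₗ[ℂ] W₃ →ₗ[ℂ] ℂ))) := by
  refine LinearMap.ext fun B => ?_
  simp only [LinearMap.sub_apply, LinearMap.add_apply, LinearMap.smul_apply,
    Module.End.mul_apply, Module.End.one_apply]
  rw [formAct_comm (wfun_mem _) (wfun_mem _), triBracket_wfun, map_smul, LinearMap.smul_apply]
  change _ + (_ + (c / 12 * serCocycle (mono (m + 1)) (mono (n + 1))) • B) - _ = _
  rw [serCocycle_mono]
  by_cases e : m + n = 0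
  · rw [if_pos (by omega), if_pos e]; push_cast; module
  · rw [if_neg (by omega), if_neg e]; module

/-- A trilinear form is invariant if it is annihilated by the vector fields on the sphere with
poles at `1`, `0`, `∞`, acting on the first, second and third argument, respectively. -/
def IsInvariantForm (c : ℂ) [IsGradedVirModule c W₁] [IsGradedVirModule c W₂]
    [IsGradedVirModule c W₃] (F : W₁ →ₗ[ℂ] W₂ →ₗ[ℂ] W₃ →ₗ[ℂ] ℂ) : Prop :=
  ∀ g ∈ ratSpan, ∀ v w u, F (virAct c W₁ g.2.1 v) w u + F v (virAct c W₂ g.1 w) u +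
    F v w (virAct c W₃ (vecInf g.2.2) u) = 0

lemma vecInf_zfun (n : ℤ) : vecInf (zfun n).2.2 = -mono (2 - n) := by
  rw [vecInf, zfun, mono_mul_mono, ← sub_eq_add_neg]

/-- The semi-invariant form B becomes F(v₁, ·, ·): it is a highest weight vector of weight h₁ for
the fields (z - 1)^(n+1) ∂_z. The resulting map is equivariant for these fields by construction;
equivariance for the remaining fields is checked on v₁ and carried along by commutators. -/
lemma exists_invariant_form (h₁ h₂ h₃ c : ℂ) :
    ∃ F : Verma h₁ c →ₗ[ℂ] Verma h₂ c →ₗ[ℂ] Verma h₃ c →ₗ[ℂ] ℂ, IsInvariantForm c F ∧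
      F (Verma.hwVector h₁ c) (Verma.hwVector h₂ c) (Verma.hwVector h₃ c) = 1 := by
  obtain ⟨B, hB1, hB⟩ := exists_primary_form h₁ h₂ h₃ c
  set ρ := formAct c (Verma h₂ c) (Verma h₃ c) with hρ
  -- The semi-invariance of `B` says that the action of zⁿ ∂_z on it is affine in n with slope h₁.
  have hz : ∀ n : ℤ, ρ (zfun n) B = ρ (zfun 0) B + (n * h₁) • B := by
    have : ∀ n : ℤ, ρ (zfun (n + 1)) B = ρ (zfun 1) B + (n * h₁) • B := by
      intro n
      refine LinearMap.ext₂ fun w u => ?_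
      have e : ∀ n : ℤ, 2 - n - 1 = -(n - 1) := fun n => by ring
      simp only [LinearMap.add_apply, LinearMap.smul_apply, smul_eq_mul, hρ, formAct_apply,
        vecInf_zfun, map_neg, LinearMap.neg_apply]
      simp only [zfun, virAct_mono, e, add_sub_cancel_right, sub_self, neg_zero]
      linear_combination -hB n w u
    intro n
    have h0 := this (-1)
    have hn := this (n - 1)
    rw [neg_add_cancel] at h0
    rw [sub_add_cancel] at hn
    rw [h0, hn]
    push_cast
    module
  -- Multiplication by z - 1 takes differences in the exponent `a`: the first difference of an
  -- affine function is its slope and all higher ones vanish.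
  have hzw : ∀ (k : ℕ) (a : ℤ), ρ (zfun a * wfun (k + 1)) B = if k = 0 then h₁ • B else 0 := by
    have step : ∀ (k : ℤ) (a : ℤ), zfun a * wfun (k + 1) = zfun (a + 1) * wfun k -
        zfun a * wfun k := by
      intro k a
      rw [add_comm k, ← wfun_mul, ← zfun_mul, zfun_one]
      ring
    intro k
    induction k with
    | zero =>
      intro a
      rw [Nat.cast_zero, step, wfun_zero, mul_one, mul_one, map_sub, LinearMap.sub_apply, hz,
        hz a, if_pos rfl]
      push_cast
      module
    | succ k ih =>
      intro a
      rw [step, map_sub, LinearMap.sub_apply]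
      push_cast
      rw [ih, ih, sub_self]
  have hw : ∀ k : ℕ, ρ (wfun (k + 1)) B = if k = 0 then h₁ • B else 0 := fun k => by
    have := hzw k 0
    rwa [zfun_zero, one_mul] at this
  obtain ⟨F, hF1, hF⟩ := exists_verma_lift (h := h₁)
    (formAct_commutator (c := c) (W₂ := Verma h₂ c) (W₃ := Verma h₃ c)) (v := B)
    (fun n hn => by
      obtain ⟨k, rfl⟩ := Int.eq_ofNat_of_zero_le hn.le
      exact (hw k).trans (if_neg (by omega)))
    ((hw 0).trans (if_pos rfl))
  have hFw : ∀ n v, F (virAct c _ (mono n) v) = ρ (wfun n) (F v) := fun n v => by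
    rw [virAct_mono, hF, sub_add_cancel]
  -- The vectors on which F intertwines all rational fields. Each Lₙ acts on M(h₁) as such a field,
  -- and brackets of rational fields are rational, so `S` is a submodule for Vir.
  let S : Submodule ℂ (Verma h₁ c) :=
    { carrier := {v | ∀ g ∈ ratSpan, F (virAct c _ g.2.1 v) = ρ g (F v)}
      zero_mem' := fun g _ => by simp
      add_mem' := fun {v v'} hv hv' g hg => by simp only [map_add, hv g hg, hv' g hg]
      smul_mem' := fun a v hv g hg => by simp only [map_smul, hv g hg] }
  have hS : ∀ v, v ∈ S := by
    intro v
    obtain ⟨u, rfl⟩ := Verma.exists_smul h₁ c v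
    refine smul_mem_of_stable S ?_ ?_ u ?_
    · intro n v hv g hg
      have e : Lu n • v = virAct c _ (wfun (n + 1)).2.1 v := by
        change _ = virAct c _ (mono (n + 1)) v
        rw [virAct_mono, add_sub_cancel_right]
      rw [e, virAct_comm, map_add, map_add, map_smul]
      rw [← triBracket_snd, hv _ (triBracket_mem hg (wfun_mem _))]
      change F (virAct c _ (mono (n + 1)) _) + _ = ρ g (F (virAct c _ (mono (n + 1)) v))
      rw [hFw, hFw, hv g hg, hρ, formAct_comm hg (wfun_mem _)]
    · intro v hv
      rw [IsGradedVirModule.central (c := c) v]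
      exact S.smul_mem _ hv
    · intro g hg
      have : ratSpan ≤ LinearMap.ker ((ρ.flip B) - F ∘ₗ
          ((virAct c (Verma h₁ c)).flip (Verma.hwVector h₁ c)) ∘ₗ
            (LinearMap.fst ℂ Ser Ser ∘ₗ LinearMap.snd ℂ Ser (Ser × Ser))) := by
        rw [ratSpan, Submodule.span_le]
        rintro _ (⟨n, rfl⟩ | ⟨n, rfl⟩)
        · rw [SetLike.mem_coe, LinearMap.mem_ker, LinearMap.sub_apply, sub_eq_zero]
          change ρ (zfun n) B = F (virAct c _ (bino 1 n) _)
          -- At 1 the field zⁿ ∂_z expands as (1 + t)ⁿ ∂_t; on a highest weight vector only L₋₁ + n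
          -- L₀ survives, matching `hz` and `hw 0`.
          have hb : virAct c _ (bino 1 n) (Verma.hwVector h₁ c) =
              ∑ i ∈ range 2, ((1 : ℂ) ^ i * cb n i) • Lu (0 + i - 1) • Verma.hwVector h₁ c := by
            rw [← one_mul (bino 1 n), ← mono_zero]
            exact vecAct_mono_mul_bino (isRestricted_opL c _) 1 0 n _ 2 fun i hi =>
              Verma.Lu_hw h₁ c (by omega)
          have h1 : cb n 1 = n := by simp [cb]
          rw [hb, sum_range_succ, sum_range_one, cb_zero, h1]
          simp only [pow_zero, one_pow, one_mul, one_smul, Nat.cast_zero, Nat.cast_one,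
            zero_add, sub_self, zero_sub]
          rw [map_add, LinearMap.map_smul F, hF, hF, hF1, hz]
          have h2 := hw 0
          rw [if_pos rfl] at h2
          change _ = ρ (wfun (-1 + 1)) B + (n : ℂ) • ρ (wfun ((0 : ℕ) + 1)) B
          rw [h2, neg_add_cancel, zfun_zero, wfun_zero, smul_smul]
        · rw [SetLike.mem_coe, LinearMap.mem_ker, LinearMap.sub_apply, sub_eq_zero]
          change ρ (wfun n) B = F (virAct c _ (mono n) _)
          rw [hFw, hF1]
      have h := this hg
      rw [LinearMap.mem_ker, LinearMap.sub_apply, sub_eq_zero] at h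
      rw [hF1]
      exact h.symm
  refine ⟨F, fun g hg v w u => ?_, by rw [hF1, hB1]⟩
  have h := LinearMap.congr_fun₂ (hS v g hg) w u
  rw [h, hρ, formAct_apply]
  ring

end InvariantForm

/-! ### Matrix coefficients of fields -/

section MatrixCoefficients

open VertexOperator

variable {W : Type*} [AddCommGroup W] [Module ℂ W]

/-- The Laurent series `∑ₙ ℓ(φₙ w) X ^ (-n - 1)`. -/
def mcoef (ℓ : W →ₗ[ℂ] ℂ) (φ : VertexOperator ℂ W) (w : W) : Ser :=
  HahnSeries.map ((HahnModule.of ℂ).symm (φ w)) ℓ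

lemma mcoef_coeff (ℓ : W →ₗ[ℂ] ℂ) (φ : VertexOperator ℂ W) (w : W) (k : ℤ) :
    (mcoef ℓ φ w).coeff k = ℓ (ncoeff φ (-k - 1) w) := by
  rw [← VertexOperator.coeff_eq_ncoeff]
  rfl

lemma mcoef_coeff' (ℓ : W →ₗ[ℂ] ℂ) (φ : VertexOperator ℂ W) (w : W) (n : ℤ) :
    (mcoef ℓ φ w).coeff (-n - 1) = ℓ (ncoeff φ n w) := by
  rw [mcoef_coeff, show -(-n - 1) - 1 = n by ring]

lemma finsum_eq_sum_range {V : Type*} [AddCommMonoid V] {f : ℕ → V} {N : ℕ}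
    (h : ∀ j, N ≤ j → f j = 0) : ∑ᶠ j, f j = ∑ j ∈ range N, f j := by
  refine finsum_eq_sum_of_support_subset _ fun j hj => ?_
  rw [mem_coe, mem_range]
  by_contra hlt
  exact hj (h j (not_lt.mp hlt))

lemma sum_range_eq_of_zero {V : Type*} [AddCommMonoid V] {f : ℕ → V} {M N : ℕ}
    (hM : ∀ j, M ≤ j → f j = 0) (hN : ∀ j, N ≤ j → f j = 0) :
    ∑ j ∈ range M, f j = ∑ j ∈ range N, f j := by
  rw [← finsum_eq_sum_range hM, finsum_eq_sum_range hN]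

lemma sum_range_shift {V : Type*} [AddCommMonoid V] {f : ℕ → V} {N : ℕ} (j : ℕ)
    (h0 : ∀ i, i < j → f i = 0) (hN : ∀ i, N ≤ i → f i = 0) :
    ∑ i ∈ range N, f i = ∑ i ∈ range N, f (j + i) := by
  rw [sum_range_eq_of_zero hN (fun i hi => hN i (le_trans (Nat.le_add_left N j) hi)),
    sum_range_add, sum_eq_zero (fun i hi => h0 i (mem_range.mp hi)), zero_add]

/-- Both sides are the trinomial coefficient of m. Its symmetry in i and j lets two successive
binomial expansions be interchanged. -/
lemma cb_trinomial (m : ℤ) (i j : ℕ) :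
    cb m i * cb (m - i) j = ((i + j).choose i : ℂ) * cb m (i + j) := by
  have h := Ring.choose_smul_choose m (n := i + j) (k := i) (by omega)
  rw [Nat.add_sub_cancel_left, nsmul_eq_mul] at h
  unfold cb
  exact_mod_cast h.symm

lemma cb_trinomial_comm (m : ℤ) (i j : ℕ) :
    cb m i * cb (m - i) j = cb m j * cb (m - j) i := by
  rw [cb_trinomial, cb_trinomial, Nat.choose_symm_add, add_comm i j]

lemma cb_natCast (i j : ℕ) : cb (i : ℤ) j = (i.choose j : ℂ) := by
  rw [cb, Ring.choose_natCast]
  simp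

lemma neg_one_zpow_sub (m : ℤ) (i : ℕ) : (-1 : ℂ) ^ (m - i) = (-1) ^ m * (-1) ^ i := by
  rw [zpow_sub₀ (by norm_num), zpow_natCast, div_eq_mul_inv, ← inv_pow]
  norm_num

end MatrixCoefficients

/-! ### Contour deformation for matrix coefficients at 0 and 1 -/

section Propagation

open VertexOperator

variable {c : ℂ} {W₁ W₂ W₃ : Type*}
  [AddCommGroup W₁] [Module ℂ W₁] [Module UVir W₁] [IsScalarTower ℂ UVir W₁]
  [AddCommGroup W₂] [Module ℂ W₂] [Module UVir W₂] [IsScalarTower ℂ UVir W₂]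
  [AddCommGroup W₃] [Module ℂ W₃] [Module UVir W₃] [IsScalarTower ℂ UVir W₃]
  [IsGradedVirModule c W₁] [IsGradedVirModule c W₂] [IsGradedVirModule c W₃]

/-- The modes of `fieldL c W m φ` as finite sums. -/
lemma ncoeff_fieldL (m n : ℤ) (φ : VertexOperator ℂ W₁) (w : W₁) {J N : ℕ}
    (hJ : ∀ j : ℕ, J ≤ j → ncoeff φ (n + j) w = 0)
    (hN : ∀ i : ℕ, N ≤ i → Lu ((i : ℤ) - 1) • w = 0) :
    ncoeff (fieldL c W₁ m φ) n w =
      ∑ j ∈ range J, ((-1) ^ j * cb (m + 1) j) • Lu (m - j) • ncoeff φ (n + j) w -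
      ∑ i ∈ range N, ((-1) ^ (m + 1) * ((-1) ^ i * cb (m + 1) i)) •
        ncoeff φ (m + 1 + n - i) (Lu ((i : ℤ) - 1) • w) := by
  simp only [fieldL, LinearMap.sub_apply, map_sub, Pi.sub_apply, leftProd_apply, rightProd_apply]
  rw [finsum_eq_sum_range (N := J), finsum_eq_sum_range (N := N)]
  · simp only [opL_apply, add_sub_cancel_right]
  · intro i hi
    rw [opL_apply, hN i hi, map_zero, smul_zero]
  · intro j hj
    rw [hJ j hj, map_zero, smul_zero]

lemma exists_Lu_bound (c : ℂ) [IsGradedVirModule c W₁] (w : W₁) (m : ℤ) :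
    ∃ N : ℕ, ∀ i : ℕ, N ≤ i → Lu (m + i) • w = 0 := by
  obtain ⟨N, hN⟩ := isRestricted_opL c W₁ w
  exact ⟨(N - m).toNat, fun i hi => hN _ (by omega)⟩

lemma exists_Lu_bound' (c : ℂ) [IsGradedVirModule c W₁] (w : W₁) :
    ∃ N : ℕ, ∀ i : ℕ, N ≤ i → Lu ((i : ℤ) - 1) • w = 0 := by
  obtain ⟨N, hN⟩ := exists_Lu_bound c w (-1)
  refine ⟨N, fun i hi => ?_⟩
  rw [← neg_add_eq_sub]
  exact hN i hi

lemma exists_mode_bound (φ : VertexOperator ℂ W₁) (w : W₁) (n : ℤ) :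
    ∃ J : ℕ, ∀ j : ℕ, J ≤ j → ncoeff φ (n + j) w = 0 := by
  obtain ⟨N, hN⟩ := field_trunc φ w
  exact ⟨(N - n).toNat, fun j hj => hN _ (by omega)⟩

variable {F : W₁ →ₗ[ℂ] W₂ →ₗ[ℂ] W₃ →ₗ[ℂ] ℂ}

lemma virAct_bino (s : ℂ) (m n : ℤ) (w : W₁) (N : ℕ)
    (hN : ∀ i : ℕ, N ≤ i → Lu (m + i - 1) • w = 0) :
    virAct c W₁ (mono m * bino s n) w =
      ∑ i ∈ range N, (s ^ i * cb n i) • Lu (m + i - 1) • w :=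
  vecAct_mono_mul_bino (isRestricted_opL c W₁) s m n w N hN

/-- The invariance under `z ^ n ∂_z`. -/
lemma IsInvariantForm.zfun (hF : IsInvariantForm c F) (n : ℤ) (v : W₁) (w : W₂) (u : W₃) {N : ℕ}
    (hN : ∀ i : ℕ, N ≤ i → Lu ((i : ℤ) - 1) • v = 0) :
    F v (Lu (n - 1) • w) u = F v w (Lu (1 - n) • u) -
      ∑ i ∈ range N, cb n i * F (Lu ((i : ℤ) - 1) • v) w u := by
  have h := hF _ (zfun_mem n) v w u
  have hb : virAct c W₁ (bino 1 n) v = ∑ i ∈ range N, cb n i • Lu ((i : ℤ) - 1) • v := by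
    have := virAct_bino (c := c) 1 0 n v N (fun i hi => by rw [zero_add]; exact hN i hi)
    simpa only [mono_zero, one_mul, one_pow, zero_add] using this
  rw [vecInf_zfun] at h
  simp only [VirasoroFusion.zfun] at h
  rw [hb, virAct_mono, map_neg, LinearMap.neg_apply, virAct_mono, map_neg, map_sum,
    LinearMap.sum_apply, LinearMap.sum_apply] at h
  simp only [LinearMap.map_smul F, LinearMap.smul_apply, smul_eq_mul] at h
  rw [show 2 - n - 1 = 1 - n by ring] at h
  linear_combination h

/-- The invariance under `(z - 1) ^ n ∂_z`. -/
lemma IsInvariantForm.wfun (hF : IsInvariantForm c F) (n : ℤ) (v : W₁) (w : W₂) (u : W₃)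
    {N N' : ℕ} (hN : ∀ i : ℕ, N ≤ i → Lu ((i : ℤ) - 1) • w = 0)
    (hN' : ∀ i : ℕ, N' ≤ i → Lu (1 - n + i) • u = 0) :
    F (Lu (n - 1) • v) w u =
      ∑ i ∈ range N', ((-1) ^ i * cb n i) * F v w (Lu (1 - n + i) • u) -
      ∑ i ∈ range N, ((-1) ^ n * ((-1) ^ i * cb n i)) * F v (Lu ((i : ℤ) - 1) • w) u := by
  have h := hF _ (wfun_mem n) v w u
  have hb : virAct c W₂ (bino (-1) n) w =
      ∑ i ∈ range N, ((-1) ^ i * cb n i) • Lu ((i : ℤ) - 1) • w := by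
    have := virAct_bino (c := c) (-1) 0 n w N (fun i hi => by rw [zero_add]; exact hN i hi)
    simpa only [mono_zero, one_mul, zero_add] using this
  have hb' : virAct c W₃ (mono (2 - n) * bino (-1) n) u =
      ∑ i ∈ range N', ((-1) ^ i * cb n i) • Lu (1 - n + i) • u := by
    have e : ∀ i : ℕ, 2 - n + (i : ℤ) - 1 = 1 - n + i := fun i => by ring
    have := virAct_bino (c := c) (-1) (2 - n) n u N' (fun i hi => by rw [e]; exact hN' i hi)
    simpa only [e] using this
  have hv : vecInf (VirasoroFusion.wfun n).2.2 = -(mono (2 - n) * bino (-1) n) := by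
    rw [vecInf, VirasoroFusion.wfun, ← mul_assoc, mono_mul_mono, ← sub_eq_add_neg]
  rw [hv, map_neg, LinearMap.neg_apply, hb'] at h
  simp only [VirasoroFusion.wfun, virAct_mono] at h
  rw [LinearMap.map_smul (virAct c W₂), LinearMap.smul_apply, hb] at h
  simp only [map_neg, map_sum, LinearMap.map_smul (F v), LinearMap.map_smul (F v w),
    LinearMap.smul_apply, LinearMap.sum_apply, smul_eq_mul, mul_sum] at h
  simp only [mul_assoc] at h ⊢
  linear_combination h

/-- The functional `w ↦ F(v, w, u)`. -/
def formMid (F : W₁ →ₗ[ℂ] W₂ →ₗ[ℂ] W₃ →ₗ[ℂ] ℂ) (v : W₁) (u : W₃) : W₂ →ₗ[ℂ] ℂ := (F v).flip u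

/-- The functional `v ↦ F(v, w, u)`. -/
def formLeft (F : W₁ →ₗ[ℂ] W₂ →ₗ[ℂ] W₃ →ₗ[ℂ] ℂ) (w : W₂) (u : W₃) : W₁ →ₗ[ℂ] ℂ :=
  (F.flip w).flip u

@[simp] lemma formMid_apply (v : W₁) (w : W₂) (u : W₃) : formMid F v u w = F v w u := rfl
@[simp] lemma formLeft_apply (v : W₁) (w : W₂) (u : W₃) : formLeft F w u v = F v w u := rfl

/-- The matrix coefficients of `Res_z (z - x) ^ (1 - q) [T(z), φ(x)]` at `0`. -/
lemma mcoef_fieldL_mid (hF : IsInvariantForm c F) (q : ℤ) (φ : VertexOperator ℂ W₂)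
    (v : W₁) (w : W₂) (u : W₃) {N₁ N₂ N₃ : ℕ}
    (h1 : ∀ i : ℕ, N₁ ≤ i → Lu ((i : ℤ) - 1) • v = 0)
    (h2 : ∀ i : ℕ, N₂ ≤ i → Lu ((i : ℤ) - 1) • w = 0)
    (h3 : ∀ i : ℕ, N₃ ≤ i → Lu (q + i) • u = 0) :
    mcoef (formMid F v u) (fieldL c W₂ (-q) φ) w =
      ∑ i ∈ range N₃, (cb (1 - q) i * (-1) ^ i) •
          (mono i * mcoef (formMid F v (Lu (q + i) • u)) φ w) -
        ∑ i ∈ range N₂, (cb (1 - q) i * (-1) ^ (1 - q - i)) •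
          (mono (1 - q - i) * mcoef (formMid F v u) φ (Lu ((i : ℤ) - 1) • w)) -
        ∑ i ∈ range N₁, cb (1 - q) i •
          (bino (-1) (1 - q - i) * mcoef (formMid F (Lu ((i : ℤ) - 1) • v) u) φ w) := by
  ext k
  obtain ⟨n, rfl⟩ : ∃ n : ℤ, k = -n - 1 := ⟨-k - 1, by ring⟩
  obtain ⟨J, hJ⟩ := exists_mode_bound φ w n
  rw [mcoef_coeff', ncoeff_fieldL (-q) n φ w hJ h2, formMid_apply, map_sub, map_sum, map_sum,
    LinearMap.sub_apply, LinearMap.sum_apply, LinearMap.sum_apply, ser_coeff_sub, ser_coeff_sub,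
    HahnSeries.coeff_sum, HahnSeries.coeff_sum, HahnSeries.coeff_sum]
  have e : ∀ j : ℕ, -n - 1 - (j : ℤ) = -(n + j) - 1 := fun j => by ring
  have hb : ∀ i : ℕ, (bino (-1) (1 - q - i) *
      mcoef (formMid F (Lu ((i : ℤ) - 1) • v) u) φ w).coeff (-n - 1) =
      ∑ j ∈ range J, (-1) ^ j * cb (1 - q - i) j *
        F (Lu ((i : ℤ) - 1) • v) (ncoeff φ (n + j) w) u := by
    intro i
    rw [bino_mul_coeff _ _ _ _ J]
    · refine sum_congr rfl fun j _ => ?_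
      rw [e, mcoef_coeff', formMid_apply]
    · intro j hj
      rw [e, mcoef_coeff', hJ j hj, map_zero]
  -- Invariance under z^(1-q-j) ∂_z moves the outer Virasoro mode from the point 0 to the points ∞
  -- and 1.
  have hL : ∀ j : ℕ, F v (Lu (-q - j) • ncoeff φ (n + j) w) u =
      F v (ncoeff φ (n + j) w) (Lu (q + j) • u) -
        ∑ i ∈ range N₁, cb (1 - q - j) i * F (Lu ((i : ℤ) - 1) • v) (ncoeff φ (n + j) w) u := by
    intro j
    have := hF.zfun (1 - q - j) v (ncoeff φ (n + j) w) u h1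
    rwa [show 1 - q - (j : ℤ) - 1 = -q - j by ring, show 1 - (1 - q - (j : ℤ)) = q + j by ring]
      at this
  simp only [ser_coeff_smul, mono_mul_coeff, hb, LinearMap.map_smul (F v), LinearMap.smul_apply,
    smul_eq_mul, hL, mul_sub, sum_sub_distrib]
  rw [show -q + 1 = 1 - q by ring]
  have A1 : ∑ j ∈ range J, (-1) ^ j * cb (1 - q) j *
      F v (ncoeff φ (n + j) w) (Lu (q + j) • u) =
      ∑ i ∈ range N₃, cb (1 - q) i * (-1) ^ i *
        (mcoef (formMid F v (Lu (q + i) • u)) φ w).coeff (-n - 1 - i) := by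
    rw [sum_range_eq_of_zero (N := N₃)]
    · refine sum_congr rfl fun j _ => ?_
      rw [e, mcoef_coeff', formMid_apply]
      ring
    · intro j hj
      rw [hJ j hj]
      simp
    · intro j hj
      rw [h3 j hj]
      simp
  have A2 : ∑ i ∈ range N₂, (-1) ^ (1 - q) * ((-1) ^ i * cb (1 - q) i) *
      F v (ncoeff φ (1 - q + n - i) (Lu ((i : ℤ) - 1) • w)) u =
      ∑ i ∈ range N₂, cb (1 - q) i * (-1) ^ (1 - q - (i : ℤ)) *
        (mcoef (formMid F v u) φ (Lu ((i : ℤ) - 1) • w)).coeff (-n - 1 - (1 - q - i)) := by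
    refine sum_congr rfl fun i _ => ?_
    rw [show -n - 1 - (1 - q - (i : ℤ)) = -(1 - q + n - i) - 1 by ring, mcoef_coeff',
      formMid_apply, neg_one_zpow_sub]
    ring
  -- The contribution at 1: with z = 1 + t, the function (1 + t - x)^(1-q) is expanded first in x
  -- and then in t, or in the opposite order.
  have A3 : ∑ j ∈ range J, (-1) ^ j * cb (1 - q) j * ∑ i ∈ range N₁, cb (1 - q - j) i *
      F (Lu ((i : ℤ) - 1) • v) (ncoeff φ (n + j) w) u =
      ∑ i ∈ range N₁, cb (1 - q) i * ∑ j ∈ range J, (-1) ^ j * cb (1 - q - i) j *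
        F (Lu ((i : ℤ) - 1) • v) (ncoeff φ (n + j) w) u := by
    simp only [mul_sum]
    rw [sum_comm]
    refine sum_congr rfl fun i _ => sum_congr rfl fun j _ => ?_
    linear_combination (-1) ^ j * F (Lu ((i : ℤ) - 1) • v) (ncoeff φ (n + j) w) u *
      cb_trinomial_comm (1 - q) j i
  rw [A1, A2, A3]
  ring

/-- The matrix coefficients of `Res_z (z - x) ^ (1 - q) [T(z), φ(x)]` at `1`. -/
lemma mcoef_fieldL_left (hF : IsInvariantForm c F) (q : ℤ) (φ : VertexOperator ℂ W₁)
    (v : W₁) (w : W₂) (u : W₃) {N₁ N₂ N₃ : ℕ}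
    (h1 : ∀ i : ℕ, N₁ ≤ i → Lu ((i : ℤ) - 1) • v = 0)
    (h2 : ∀ i : ℕ, N₂ ≤ i → Lu ((i : ℤ) - 1) • w = 0)
    (h3 : ∀ i : ℕ, N₃ ≤ i → Lu (q + i) • u = 0) :
    mcoef (formLeft F w u) (fieldL c W₁ (-q) φ) v =
      ∑ i ∈ range N₃, (cb (1 - q) i * (-1) ^ i) •
          (bino 1 i * mcoef (formLeft F w (Lu (q + i) • u)) φ v) -
        ∑ i ∈ range N₂, (cb (1 - q) i * (-1) ^ (1 - q - i)) •
          (bino 1 (1 - q - i) * mcoef (formLeft F (Lu ((i : ℤ) - 1) • w) u) φ v) -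
        ∑ i ∈ range N₁, (cb (1 - q) i * (-1) ^ (1 - q - i)) •
          (mono (1 - q - i) * mcoef (formLeft F w u) φ (Lu ((i : ℤ) - 1) • v)) := by
  ext k
  obtain ⟨n, rfl⟩ : ∃ n : ℤ, k = -n - 1 := ⟨-k - 1, by ring⟩
  obtain ⟨J, hJ⟩ := exists_mode_bound φ v n
  rw [mcoef_coeff', ncoeff_fieldL (-q) n φ v hJ h1, map_sub, map_sum, map_sum, ser_coeff_sub,
    ser_coeff_sub, HahnSeries.coeff_sum, HahnSeries.coeff_sum, HahnSeries.coeff_sum]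
  have e : ∀ j : ℕ, -n - 1 - (j : ℤ) = -(n + j) - 1 := fun j => by ring
  have hb : ∀ (m : ℤ) (w : W₂) (u : W₃), (bino 1 m * mcoef (formLeft F w u) φ v).coeff (-n - 1) =
      ∑ j ∈ range J, cb m j * F (ncoeff φ (n + j) v) w u := by
    intro m w u
    rw [bino_mul_coeff _ _ _ _ J]
    · refine sum_congr rfl fun j _ => ?_
      rw [e, mcoef_coeff', formLeft_apply, one_pow, one_mul]
    · intro j hj
      rw [e, mcoef_coeff', hJ j hj, map_zero]
  have e' : ∀ i j : ℕ, 1 - (1 - q - (j : ℤ)) + i = q + (j + i : ℕ) := fun i j => by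
    push_cast; ring
  have hL : ∀ j : ℕ, F (Lu (-q - j) • ncoeff φ (n + j) v) w u =
      ∑ i ∈ range N₃, ((-1) ^ i * cb (1 - q - j) i) *
          F (ncoeff φ (n + j) v) w (Lu (q + (j + i : ℕ)) • u) -
        ∑ i ∈ range N₂, ((-1) ^ (1 - q - (j : ℤ)) * ((-1) ^ i * cb (1 - q - j) i)) *
          F (ncoeff φ (n + j) v) (Lu ((i : ℤ) - 1) • w) u := by
    intro j
    have := hF.wfun (1 - q - j) (ncoeff φ (n + j) v) w u h2 (N' := N₃) (fun i hi => by
      rw [e']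
      exact h3 _ (by omega))
    rw [show 1 - q - (j : ℤ) - 1 = -q - j by ring] at this
    simpa only [e'] using this
  simp only [ser_coeff_smul, mono_mul_coeff, hb, map_smul, formLeft_apply,
    smul_eq_mul, hL, mul_sub, sum_sub_distrib]
  rw [show -q + 1 = 1 - q by ring]
  have A1 : ∑ j ∈ range J, (-1) ^ j * cb (1 - q) j * ∑ i ∈ range N₃,
      ((-1) ^ i * cb (1 - q - j) i) * F (ncoeff φ (n + j) v) w (Lu (q + (j + i : ℕ)) • u) =
      ∑ i ∈ range N₃, cb (1 - q) i * (-1) ^ i * ∑ j ∈ range J, cb i j *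
        F (ncoeff φ (n + j) v) w (Lu (q + i) • u) := by
    simp only [mul_sum]
    rw [sum_comm (s := range N₃)]
    refine sum_congr rfl fun j _ => ?_
    symm
    -- The new index is the total exponent i + j; terms below j vanish since the binomial
    -- coefficient does, and terms from N₃ on vanish on `u`.
    rw [sum_range_shift (N := N₃) j]
    · refine sum_congr rfl fun i _ => ?_
      rw [cb_natCast, pow_add]
      linear_combination -(-1) ^ j * (-1) ^ i *
        F (ncoeff φ (n + j) v) w (Lu (q + (j + i : ℕ)) • u) * cb_trinomial (1 - q) j i
    · intro i hi
      rw [cb_natCast, Nat.choose_eq_zero_of_lt hi]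
      simp
    · intro i hi
      rw [h3 i hi]
      simp
  have A2 : ∑ j ∈ range J, (-1) ^ j * cb (1 - q) j * ∑ i ∈ range N₂,
      ((-1) ^ (1 - q - (j : ℤ)) * ((-1) ^ i * cb (1 - q - j) i)) *
          F (ncoeff φ (n + j) v) (Lu ((i : ℤ) - 1) • w) u =
      ∑ i ∈ range N₂, cb (1 - q) i * (-1) ^ (1 - q - (i : ℤ)) *
        ∑ j ∈ range J, cb (1 - q - i) j * F (ncoeff φ (n + j) v) (Lu ((i : ℤ) - 1) • w) u := by
    simp only [mul_sum]
    rw [sum_comm]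
    refine sum_congr rfl fun i _ => sum_congr rfl fun j _ => ?_
    rw [neg_one_zpow_sub, neg_one_zpow_sub]
    have hj : (-1 : ℂ) ^ j * (-1) ^ j = 1 := by rw [← mul_pow]; norm_num
    linear_combination (-1) ^ (1 - q) * (-1) ^ i *
      F (ncoeff φ (n + j) v) (Lu ((i : ℤ) - 1) • w) u * (cb_trinomial_comm (1 - q) j i +
        cb (1 - q) j * cb (1 - q - j) i * hj)
  have A3 : ∑ i ∈ range N₁, (-1) ^ (1 - q) * ((-1) ^ i * cb (1 - q) i) *
      F (ncoeff φ (1 - q + n - i) (Lu ((i : ℤ) - 1) • v)) w u =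
      ∑ i ∈ range N₁, cb (1 - q) i * (-1) ^ (1 - q - (i : ℤ)) *
        (mcoef (formLeft F w u) φ (Lu ((i : ℤ) - 1) • v)).coeff (-n - 1 - (1 - q - i)) := by
    refine sum_congr rfl fun i _ => ?_
    rw [show -n - 1 - (1 - q - (i : ℤ)) = -(1 - q + n - i) - 1 by ring, mcoef_coeff',
      formLeft_apply, neg_one_zpow_sub]
    ring
  rw [A1, A2, A3]

end Propagation

/-! ### Matrix coefficients at infinity -/

section Infinity

open VertexOperator

variable {c : ℂ} {W₁ W₂ W₃ : Type*}
  [AddCommGroup W₁] [Module ℂ W₁] [Module UVir W₁] [IsScalarTower ℂ UVir W₁]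
  [AddCommGroup W₂] [Module ℂ W₂] [Module UVir W₂] [IsScalarTower ℂ UVir W₂]
  [AddCommGroup W₃] [Module ℂ W₃] [Module UVir W₃] [IsScalarTower ℂ UVir W₃]
  [IsGradedVirModule c W₁] [IsGradedVirModule c W₂] [IsGradedVirModule c W₃]
  {F : W₁ →ₗ[ℂ] W₂ →ₗ[ℂ] W₃ →ₗ[ℂ] ℂ}

lemma cb_pascal (m : ℤ) (j : ℕ) : cb (m + 1) (j + 1) = cb m j + cb m (j + 1) := by
  unfold cb
  rw [Ring.choose_succ_succ]
  push_cast
  rfl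

/-- Here R a m n stands for a residue with kernel z^a (z - x)^m, read off at mode n. The hypothesis
expresses z = (z - x) + x, multiplication by x being a shift of the mode, and N iterations are the
binomial expansion of z^N. -/
lemma sum_choose_shift {V : Type*} [AddCommMonoid V] {R : ℤ → ℤ → ℤ → V}
    (h : ∀ a m n, R (a + 1) m n = R a (m + 1) n + R a m (n + 1)) (N : ℕ) (a m n : ℤ) :
    ∑ i ∈ range (N + 1), N.choose i • R a (m + i) (n - i) = R (a + N) m (n - N) := by
  induction N generalizing m n with
  | zero => simp
  | succ N ih =>
    rw [sum_choose_succ_nsmul (fun i _ => R a (m + i) (n - i)), ih m n]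
    have e : ∀ i : ℕ, R a (m + (i + 1 : ℕ)) (n - (i + 1 : ℕ)) = R a (m + 1 + i) (n - 1 - i) :=
      fun i => by
        congr 1 <;> push_cast <;> ring
    simp only [e]
    rw [ih (m + 1) (n - 1)]
    push_cast
    rw [← add_assoc a, h, add_comm, show n - 1 - (N : ℤ) = n - (N + 1) by ring,
      show n - ((N : ℤ) + 1) + 1 = n - N by ring]

/-- The modes of `Res_z z ^ a (z - x) ^ m T(z) φ(x)`. -/
def resLeft (φ : VertexOperator ℂ W₃) (u : W₃) (a m n : ℤ) : W₃ :=
  ∑ᶠ j : ℕ, ((-1) ^ j * cb m j : ℂ) • Lu (a + m - 1 - j) • ncoeff φ (n + j) u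

/-- The modes of `Res_z z ^ a (-x + z) ^ m φ(x) T(z)`. -/
def resRight (φ : VertexOperator ℂ W₃) (u : W₃) (a m n : ℤ) : W₃ :=
  ∑ᶠ j : ℕ, ((-1) ^ m * ((-1) ^ j * cb m j) : ℂ) • ncoeff φ (m + n - j) (Lu (a + j - 1) • u)

lemma resLeft_eq_sum (φ : VertexOperator ℂ W₃) (u : W₃) (a m n : ℤ) {J : ℕ}
    (hJ : ∀ j : ℕ, J ≤ j → ncoeff φ (n + j) u = 0) :
    resLeft φ u a m n =
      ∑ j ∈ range J, ((-1) ^ j * cb m j : ℂ) • Lu (a + m - 1 - j) • ncoeff φ (n + j) u :=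
  finsum_eq_sum_range fun j hj => by rw [hJ j hj, smul_zero, smul_zero]

lemma resRight_eq_sum (φ : VertexOperator ℂ W₃) (u : W₃) (a m n : ℤ) {N : ℕ}
    (hN : ∀ j : ℕ, N ≤ j → Lu (a + j - 1) • u = 0) :
    resRight φ u a m n = ∑ j ∈ range N,
      ((-1) ^ m * ((-1) ^ j * cb m j) : ℂ) • ncoeff φ (m + n - j) (Lu (a + j - 1) • u) :=
  finsum_eq_sum_range fun j hj => by rw [hN j hj, map_zero, smul_zero]

lemma ncoeff_fieldL_eq_res (m n : ℤ) (φ : VertexOperator ℂ W₃) (u : W₃) :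
    ncoeff (fieldL c W₃ m φ) n u = resLeft φ u 0 (m + 1) n - resRight φ u 0 (m + 1) n := by
  simp only [fieldL, LinearMap.sub_apply, map_sub, Pi.sub_apply, leftProd_apply, rightProd_apply,
    resLeft, resRight, opL_apply, zero_add]

/-- The splitting z = (z - x) + x under the residue; on coefficients it is Pascal's rule. -/
lemma resLeft_succ (φ : VertexOperator ℂ W₃) (u : W₃) (a m n : ℤ) :
    resLeft φ u (a + 1) m n = resLeft φ u a (m + 1) n + resLeft φ u a m (n + 1) := by
  obtain ⟨J, hJ⟩ := exists_mode_bound φ u n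
  rw [resLeft_eq_sum φ u (a + 1) m n (J := J + 1) (fun j hj => hJ j (by omega)),
    resLeft_eq_sum φ u a (m + 1) n (J := J + 1) (fun j hj => hJ j (by omega)),
    resLeft_eq_sum φ u a m (n + 1) (J := J) (fun j hj => by
      rw [add_assoc, add_comm 1 (j : ℤ)]; exact hJ (j + 1) (by omega)),
    sum_range_succ', sum_range_succ', add_right_comm (∑ j ∈ range J, _), ← sum_add_distrib]
  congr 1
  · refine sum_congr rfl fun j _ => ?_
    rw [cb_pascal, show n + 1 + (j : ℤ) = n + (j + 1 : ℕ) by push_cast; ring,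
      show a + 1 + m - 1 - ((j + 1 : ℕ) : ℤ) = a + m - 1 - j by push_cast; ring,
      show a + (m + 1) - 1 - ((j + 1 : ℕ) : ℤ) = a + m - 1 - j by push_cast; ring, ← add_smul]
    congr 1
    ring
  · rw [cb_zero, cb_zero, show a + 1 + m = a + (m + 1) by ring]

lemma resRight_succ (c : ℂ) [IsGradedVirModule c W₃] (φ : VertexOperator ℂ W₃) (u : W₃) (a m n : ℤ) :
    resRight φ u (a + 1) m n = resRight φ u a (m + 1) n + resRight φ u a m (n + 1) := by
  obtain ⟨N, hN⟩ := exists_Lu_bound c u (a - 1)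
  have hN' : ∀ j : ℕ, N ≤ j → Lu (a + j - 1) • u = 0 := fun j hj => by
    rw [← sub_add_eq_add_sub]; exact hN j hj
  rw [resRight_eq_sum φ u (a + 1) m n (N := N) (fun j hj => by
      rw [show a + 1 + (j : ℤ) - 1 = a + (j + 1 : ℕ) - 1 by push_cast; ring]
      exact hN' (j + 1) (by omega)),
    resRight_eq_sum φ u a (m + 1) n (N := N + 1) (fun j hj => hN' j (by omega)),
    resRight_eq_sum φ u a m (n + 1) (N := N + 1) (fun j hj => hN' j (by omega)),
    sum_range_succ', sum_range_succ', add_add_add_comm, ← sum_add_distrib]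
  have hz : (-1 : ℂ) ^ (m + 1) = -(-1) ^ m := by
    rw [zpow_add_one₀ (by norm_num), mul_neg_one]
  rw [← add_zero (∑ j ∈ range N, _)]
  congr 1
  · refine sum_congr rfl fun j _ => ?_
    rw [cb_pascal, show a + 1 + (j : ℤ) - 1 = a + (j + 1 : ℕ) - 1 by push_cast; ring,
      show m + 1 + n - ((j + 1 : ℕ) : ℤ) = m + n - j by push_cast; ring,
      show m + (n + 1) - ((j + 1 : ℕ) : ℤ) = m + n - j by push_cast; ring, ← add_smul, hz]
    congr 1
    ring
  · rw [cb_zero, cb_zero, hz, show m + 1 + n = m + (n + 1) by ring, ← add_smul]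
    simp

/-- The matrix coefficients of `Res_z z ^ (1 + q) (z - x) ^ (1 - q) [T(z), φ(x)]` at infinity. -/
lemma mcoef_fieldL_inf (hF : IsInvariantForm c F) (q : ℕ) (φ : VertexOperator ℂ W₃)
    (v : W₁) (w : W₂) (u : W₃) {N₁ N₂ N₃ : ℕ}
    (h1 : ∀ i : ℕ, N₁ ≤ i → Lu ((i : ℤ) - 1) • v = 0)
    (h2 : ∀ i : ℕ, N₂ ≤ i → Lu ((i : ℤ) - 1) • w = 0)
    (h3 : ∀ i : ℕ, N₃ ≤ i → Lu ((q : ℤ) + i) • u = 0) :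
    (-1 : ℂ) ^ q • (mono (2 * q) * ∑ i ∈ range (q + 2), ((q + 1).choose i : ℂ) •
        (mono (-i) * mcoef (F v w) (fieldL c W₃ (i - q) φ) u)) =
      ∑ i ∈ range N₃, (cb (1 - q) i * (-1) ^ i) •
          (mono (-i) * mcoef (F v w) φ (Lu (q + i) • u)) -
        ∑ i ∈ range N₂, (cb (1 - q) i * (-1) ^ (1 - (q : ℤ) - i)) •
          (mono (-(1 - q - i)) * mcoef (F v (Lu ((i : ℤ) - 1) • w)) φ u) -
        ∑ i ∈ range N₁, (cb (1 - q) i * (-1) ^ (1 - (q : ℤ) - i)) •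
          (mono (-(1 - q - i)) *
            (bino (-1) (1 - q - i) * mcoef (F (Lu ((i : ℤ) - 1) • v) w) φ u)) := by
  ext k
  obtain ⟨n, rfl⟩ : ∃ n : ℤ, k = q - 2 - n := ⟨q - 2 - k, by ring⟩
  obtain ⟨J, hJ⟩ := exists_mode_bound φ u n
  set m : ℤ := 1 - q with hm
  have hq : (q : ℤ) = 1 - m := by rw [hm]; ring
  -- The combination of the modes L_{i-q} collapses to a single residue with kernel z^(1+q) (z -
  -- x)^(1-q), by expanding z^(q+1) around x. Up to sign and a power of x this kernel is the image
  -- of the field with kernel (z - x)^(1-q) under inversion of both variables.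
  have hL : (mono (2 * q) * ∑ i ∈ range (q + 2), ((q + 1).choose i : ℂ) •
      (mono (-i) * mcoef (F v w) (fieldL c W₃ (i - q) φ) u)).coeff (q - 2 - n) =
      F v w (resLeft φ u (1 + q) m n - resRight φ u (1 + q) m n) := by
    rw [mono_mul_coeff, HahnSeries.coeff_sum]
    have e : ∀ i : ℕ, (((q + 1).choose i : ℂ) •
        (mono (-i) * mcoef (F v w) (fieldL c W₃ (i - q) φ) u)).coeff (q - 2 - n - 2 * q) =
        F v w ((q + 1).choose i • (fun a m n => resLeft φ u a m n - resRight φ u a m n) 0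
          (m + i) (n + 1 + q - i)) := by
      intro i
      rw [ser_coeff_smul, mono_mul_coeff,
        show (q : ℤ) - 2 - n - 2 * q - -i = -(n + 1 + q - i) - 1 by ring, mcoef_coeff',
        ncoeff_fieldL_eq_res, show (i : ℤ) - q + 1 = m + i by rw [hm]; ring, map_nsmul,
        nsmul_eq_mul]
    rw [sum_congr rfl fun i _ => e i, ← map_sum,
      sum_choose_shift (R := fun a m n => resLeft φ u a m n - resRight φ u a m n)
        (fun a m n => ?_) (q + 1)]
    · congr 1
      rw [show (0 : ℤ) + (q + 1 : ℕ) = 1 + q by push_cast; ring,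
        show n + 1 + q - ((q + 1 : ℕ) : ℤ) = n by push_cast; ring]
    · rw [resLeft_succ, resRight_succ c]
      abel
  rw [ser_coeff_smul, hL, resLeft_eq_sum φ u (1 + q) m n hJ,
    resRight_eq_sum φ u (1 + q) m n (N := N₃) (fun j hj => by
      rw [show 1 + (q : ℤ) + j - 1 = q + j by ring]; exact h3 j hj), map_sub, map_sum, map_sum,
    ser_coeff_sub, ser_coeff_sub, HahnSeries.coeff_sum, HahnSeries.coeff_sum,
    HahnSeries.coeff_sum]
  have hb : ∀ (i : ℕ) (x : ℤ) (v : W₁), x = i →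
      (mono (-(m - i)) * (bino (-1) (m - i) * mcoef (F v w) φ u)).coeff (q - 2 - n) =
      ∑ j ∈ range J, (-1) ^ j * cb (m - i) j * F v w (ncoeff φ (n + (i + j : ℕ)) u) := by
    rintro i x v -
    have e : ∀ j : ℕ, (q : ℤ) - 2 - n - -(m - i) - j = -(n + (i + j : ℕ)) - 1 := fun j => by
      rw [hm]; push_cast; ring
    rw [mono_mul_coeff, bino_mul_coeff _ _ _ _ J]
    · refine sum_congr rfl fun j _ => ?_
      rw [e, mcoef_coeff']
    · intro j hj
      rw [e, mcoef_coeff', hJ _ (by omega), map_zero]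
  -- Since q + m = 1 the mode is L_{1-j}, and invariance under z^j ∂_z moves it from ∞ to 0 and 1.
  have hz : ∀ j : ℕ, F v w (Lu (1 + q + m - 1 - j) • ncoeff φ (n + j) u) =
      F v (Lu ((j : ℤ) - 1) • w) (ncoeff φ (n + j) u) +
        ∑ i ∈ range N₁, cb j i * F (Lu ((i : ℤ) - 1) • v) w (ncoeff φ (n + j) u) := by
    intro j
    rw [hF.zfun j v w (ncoeff φ (n + j) u) h1, show 1 + (q : ℤ) + m - 1 - j = 1 - j by
      rw [hm]; ring]
    ring
  have hs : (-1 : ℂ) ^ q * (-1) ^ m = -1 := by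
    rw [← zpow_natCast, ← zpow_add₀ (by norm_num), hm]
    simp
  have hs' : (-1 : ℂ) ^ m = -(-1) ^ q := by
    have h : (-1 : ℂ) ^ q * (-1) ^ q = 1 := by rw [← mul_pow]; norm_num
    linear_combination (-1 : ℂ) ^ q * hs - (-1) ^ m * h
  simp only [hb _ _ _ rfl, ser_coeff_smul, LinearMap.map_smul (F v w), smul_eq_mul, hz, mul_add,
    sum_add_distrib, mul_sub]
  have A1 : (-1 : ℂ) ^ q * ∑ j ∈ range N₃, (-1) ^ m * ((-1) ^ j * cb m j) *
      F v w (ncoeff φ (m + n - j) (Lu (1 + q + j - 1) • u)) =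
      -∑ i ∈ range N₃, cb m i * (-1) ^ i *
        (mono (-i) * mcoef (F v w) φ (Lu (q + i) • u)).coeff (q - 2 - n) := by
    rw [mul_sum, ← sum_neg_distrib]
    refine sum_congr rfl fun j _ => ?_
    rw [mono_mul_coeff, show (q : ℤ) - 2 - n - -j = -(m + n - j) - 1 by rw [hm]; ring,
      mcoef_coeff', show 1 + (q : ℤ) + j - 1 = q + j by ring]
    linear_combination (-1) ^ j * cb m j * F v w (ncoeff φ (m + n - j) (Lu (q + j) • u)) * hs
  have A2 : (-1 : ℂ) ^ q * ∑ j ∈ range J, (-1) ^ j * cb m j *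
      F v (Lu ((j : ℤ) - 1) • w) (ncoeff φ (n + j) u) =
      -∑ i ∈ range N₂, cb m i * (-1) ^ (m - (i : ℤ)) *
        (mono (-(m - i)) * mcoef (F v (Lu ((i : ℤ) - 1) • w)) φ u).coeff (q - 2 - n) := by
    rw [mul_sum, ← sum_neg_distrib, sum_range_eq_of_zero (N := N₂)]
    · refine sum_congr rfl fun j _ => ?_
      rw [mono_mul_coeff, show (q : ℤ) - 2 - n - -(m - j) = -(n + j) - 1 by rw [hm]; ring,
        mcoef_coeff', neg_one_zpow_sub, hs']
      ring
    · intro j hj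
      rw [hJ j hj]
      simp
    · intro j hj
      rw [h2 j hj]
      simp
  have A3 : (-1 : ℂ) ^ q * ∑ j ∈ range J, (-1) ^ j * cb m j * ∑ i ∈ range N₁,
      cb j i * F (Lu ((i : ℤ) - 1) • v) w (ncoeff φ (n + j) u) =
      -∑ i ∈ range N₁, cb m i * (-1) ^ (m - (i : ℤ)) * ∑ j ∈ range J,
        (-1) ^ j * cb (m - i) j *
          F (Lu ((i : ℤ) - 1) • v) w (ncoeff φ (n + (i + j : ℕ)) u) := by
    simp only [mul_sum]
    rw [sum_comm, ← sum_neg_distrib]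
    refine sum_congr rfl fun i _ => ?_
    rw [sum_range_shift (N := J) i, ← sum_neg_distrib]
    · refine sum_congr rfl fun j _ => ?_
      have ht := cb_trinomial m i j
      rw [cb_natCast, neg_one_zpow_sub, hs', pow_add]
      linear_combination -(-1) ^ q * (-1) ^ i * (-1) ^ j *
        F (Lu ((i : ℤ) - 1) • v) w (ncoeff φ (n + (i + j : ℕ)) u) * ht
    · intro j hj
      rw [cb_natCast, Nat.choose_eq_zero_of_lt hj]
      simp
    · intro j hj
      rw [hJ j hj]
      simp
  rw [A1, A2, A3]
  ring

end Infinity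

/-! ### Matrix coefficients of the vertex operator algebra -/

section MatrixCoefficientsVOA

open VertexOperator

/-- Rearrangement of a Cauchy product: the support lies in a box, which the diagonals with index
below A + B cover. -/
lemma sum_triangle {V : Type*} [AddCommGroup V] {f : ℕ → ℕ → V} {A B : ℕ}
    (hA : ∀ i j, A ≤ i → f i j = 0) (hB : ∀ i j, B ≤ j → f i j = 0) :
    ∑ s ∈ range (A + B), ∑ i ∈ range (s + 1), f i (s - i) =
      ∑ i ∈ range A, ∑ j ∈ range B, f i j := by
  have h : ∀ s, A + B ≤ s → ∑ i ∈ range (s + 1), f i (s - i) = 0 := fun s hs => by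
    refine sum_eq_zero fun i _ => ?_
    rcases le_or_gt A i with hi | hi
    · exact hA _ _ hi
    · exact hB _ _ (by omega)
  rw [← finsum_eq_sum_range h, ← finsum_eq_sum_range (N := A)]
  · simp only [← Nat.sum_antidiagonal_eq_sum_range_succ f]
    rw [← finsum_antidiagonal f]
    · exact finsum_congr fun i => finsum_eq_sum_range (hB i)
    · exact finite_support_prod (fun _ => B) A hA hB
  · exact fun i hi => sum_eq_zero fun j _ => hA i j hi

/-- `mcoef` as a linear function of the field. -/
def mcoefL {W : Type*} [AddCommGroup W] [Module ℂ W] (ℓ : W →ₗ[ℂ] ℂ) (w : W) :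
    VertexOperator ℂ W →ₗ[ℂ] Ser where
  toFun φ := mcoef ℓ φ w
  map_add' φ ψ := by
    ext k
    simp only [ser_coeff_add, mcoef_coeff, map_add, Pi.add_apply, LinearMap.add_apply]
  map_smul' a φ := by
    ext k
    simp only [RingHom.id_apply, ser_coeff_smul, mcoef_coeff, map_smul, Pi.smul_apply,
      LinearMap.smul_apply, smul_eq_mul]

lemma mcoefL_apply {W : Type*} [AddCommGroup W] [Module ℂ W] (ℓ : W →ₗ[ℂ] ℂ) (w : W)
    (φ : VertexOperator ℂ W) : mcoefL ℓ w φ = mcoef ℓ φ w := rfl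

lemma mcoef_idField {W : Type*} [AddCommGroup W] [Module ℂ W] (ℓ : W →ₗ[ℂ] ℂ) (w : W) :
    mcoef ℓ (idField W) w = ℓ w • (1 : Ser) := by
  ext k
  rw [mcoef_coeff, idField, ncoeff_mkField, ser_coeff_smul, ← mono_zero, mono_coeff]
  by_cases h : k = 0
  · subst h; simp
  · rw [if_neg (by omega), if_neg h]; simp

/-! ### Powers of L₁ on Virasoro modules and on M_c -/

section

variable {c : ℂ} {W : Type*} [AddCommGroup W] [Module ℂ W] [Module UVir W] [IsScalarTower ℂ UVir W]

lemma opL_pow_succ (j : ℕ) (w : W) : (opL W 1 ^ (j + 1)) w = Lu 1 • (opL W 1 ^ j) w := by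
  rw [pow_succ', Module.End.mul_apply, opL_apply]

lemma opL_pow_mem_weightSpace {μ : ℂ} {w : W} (hw : w ∈ weightSpace W μ) (j : ℕ) :
    (opL W 1 ^ j) w ∈ weightSpace W (μ - j) := by
  induction j with
  | zero => simpa using hw
  | succ j ih =>
    rw [opL_pow_succ]
    have := Lu_mem_weightSpace 1 ih
    convert this using 2
    push_cast
    ring

/-- L₁ lowers the weight by one and M_c has no negative weights. -/
lemma VirVOA.opL_pow_eq_zero {k : ℕ} {b : VirVOA c} (hb : b ∈ weightSpace (VirVOA c) (k : ℂ))
    {j : ℕ} (hj : k < j) : (opL (VirVOA c) 1 ^ j) b = 0 := by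
  have h := opL_pow_mem_weightSpace hb j
  rwa [weightSpace_eq_bot (h := 0) (by simpa using VirVOA.iSup_weightSpace c), Submodule.mem_bot]
    at h
  intro n h
  have h' : (k : ℂ) = (n + j : ℕ) := by push_cast; linear_combination h
  have := Nat.cast_injective h'
  omega

/-- The Leibniz rule together with ad(L₁)^i L₋q = i! C(q+1, i) L_{i-q}. No central term occurs
because m³ - m vanishes at m = 1. -/
lemma opL_pow_Lu_smul (q : ℕ) (s : ℕ) (b : W) :
    (opL W 1 ^ s) (Lu (-q) • b) = ∑ i ∈ range (s + 1), s.choose i •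
      ((i.factorial * ((q + 1).choose i : ℂ)) • Lu (i - q) • (opL W 1 ^ (s - i)) b) := by
  induction s with
  | zero => simp
  | succ s ih =>
    rw [sum_choose_succ_nsmul (fun i j =>
      (i.factorial * ((q + 1).choose i : ℂ)) • Lu (i - q) • (opL W 1 ^ j) b), opL_pow_succ, ih,
      ← opL_apply, map_sum, ← sum_add_distrib]
    refine sum_congr rfl fun i hi => ?_
    have hi' : i ≤ s := by rw [mem_range] at hi; omega
    rw [map_nsmul, ← nsmul_add, LinearMap.map_smul, opL_apply, Lu_smul_smul, ← opL_pow_succ,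
      Nat.sub_add_comm hi', show (1 : ℤ) + (i - q) = (i + 1 : ℕ) - q by push_cast; ring]
    have hc : (if ((i + 1 : ℕ) : ℤ) - q = 0 then ((((1 : ℤ) : ℂ) ^ 3 - (1 : ℤ)) / 12) else 0) = 0 := by
      simp
    have hch : (((q + 1).choose (i + 1) : ℕ) : ℂ) * (i + 1) = ((q + 1).choose i : ℕ) * (q + 1 - i) := by
      have := cb_succ_right ((q + 1 : ℕ) : ℤ) i
      rw [cb_natCast, cb_natCast] at this
      push_cast at this
      linear_combination this
    rw [hc, zero_smul, add_zero, smul_add, Nat.factorial_succ, smul_smul]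
    congr 3
    push_cast
    linear_combination -(i.factorial : ℂ) * hch

end

/-! ### Rationality of the matrix coefficients of M_c -/

section

variable {c : ℂ} {W₁ W₂ W₃ : Type*}
  [AddCommGroup W₁] [Module ℂ W₁] [Module UVir W₁] [IsScalarTower ℂ UVir W₁]
  [AddCommGroup W₂] [Module ℂ W₂] [Module UVir W₂] [IsScalarTower ℂ UVir W₂]
  [AddCommGroup W₃] [Module ℂ W₃] [Module UVir W₃] [IsScalarTower ℂ UVir W₃]
  [IsGradedVirModule c W₁] [IsGradedVirModule c W₂] [IsGradedVirModule c W₃]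
  {F : W₁ →ₗ[ℂ] W₂ →ₗ[ℂ] W₃ →ₗ[ℂ] ℂ}

/-- For `b` of weight `k`, the matrix coefficients of `Y(e ^ (z L₁) (-z⁻²) ^ L₀ b, z⁻¹)` as a
Laurent series in `z⁻¹`. -/
def mcoefInf (ℓ : W₃ →ₗ[ℂ] ℂ) (k : ℕ) (b : VirVOA c) (u : W₃) : Ser :=
  ∑ j ∈ range (k + 1), ((-1) ^ k / (j.factorial : ℂ)) •
    (mono (2 * k - j) * mcoef ℓ (vertexMap c W₃ ((opL (VirVOA c) 1 ^ j) b)) u)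

/-- Conjugating L₋q by e^(z L₁) gives a finite combination of the L_{i-q}. After division by s! the
formula for L₁^s L₋q b separates into independent sums, and the inner one is the expression
evaluated in `mcoef_fieldL_inf`. -/
lemma mcoefInf_Lu (ℓ : W₃ →ₗ[ℂ] ℂ) {k : ℕ} {b : VirVOA c}
    (hb : b ∈ weightSpace (VirVOA c) (k : ℂ)) (q : ℕ) (u : W₃) :
    mcoefInf ℓ (k + q) (Lu (-q) • b) u =
      ∑ j ∈ range (k + 1), ((-1) ^ k / (j.factorial : ℂ)) • (mono (2 * k - j) *
        ((-1 : ℂ) ^ q • (mono (2 * q) * ∑ i ∈ range (q + 2), ((q + 1).choose i : ℂ) •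
          (mono (-i) * mcoef ℓ (fieldL c W₃ (i - q)
            (vertexMap c W₃ ((opL (VirVOA c) 1 ^ j) b))) u)))) := by
  -- Of the s = i + j factors L₁, the index i counts those absorbed by L₋q and j those acting on
  -- `b`; the term vanishes for i > q + 1 or j > k.
  set f : ℕ → ℕ → Ser := fun i j => ((-1) ^ (k + q) * ((q + 1).choose i) / (j.factorial : ℂ)) •
    (mono (2 * (k + q) - (i + j)) * mcoef ℓ (fieldL c W₃ (i - q)
      (vertexMap c W₃ ((opL (VirVOA c) 1 ^ j) b))) u) with hf
  have hA : ∀ i j, q + 2 ≤ i → f i j = 0 := fun i j hi => by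
    rw [hf]
    simp only
    rw [Nat.choose_eq_zero_of_lt (by omega), Nat.cast_zero, mul_zero, zero_div]
    exact zero_smul ℂ (_ : Ser)
  have hB : ∀ i j, k + 1 ≤ j → f i j = 0 := fun i j hj => by
    rw [hf]
    simp only
    rw [VirVOA.opL_pow_eq_zero hb (by omega), map_zero, map_zero, ← mcoefL_apply, map_zero,
      mul_zero, smul_zero]
  have hLb : Lu (-q) • b ∈ weightSpace (VirVOA c) ((k + q : ℕ) : ℂ) := by
    have := Lu_mem_weightSpace (-q) hb
    convert this using 2
    push_cast
    ring
  have hs : ∀ s : ℕ, ((-1) ^ (k + q) / (s.factorial : ℂ)) • (mono (2 * (k + q : ℕ) - s) *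
      mcoef ℓ (vertexMap c W₃ ((opL (VirVOA c) 1 ^ s) (Lu (-q) • b))) u) =
      ∑ i ∈ range (s + 1), f i (s - i) := fun s => by
    rw [opL_pow_Lu_smul, map_sum, ← mcoefL_apply, map_sum, mul_sum, smul_sum]
    refine sum_congr rfl fun i hi => ?_
    have hi' : i ≤ s := by rw [mem_range] at hi; omega
    have hfac : (s.factorial : ℂ) = (s.choose i : ℂ) * i.factorial * (s - i).factorial := by
      exact_mod_cast (Nat.choose_mul_factorial_mul_factorial hi').symm
    have h1 : (i.factorial : ℂ) ≠ 0 := Nat.cast_ne_zero.mpr i.factorial_ne_zero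
    have h2 : ((s - i).factorial : ℂ) ≠ 0 := Nat.cast_ne_zero.mpr (s - i).factorial_ne_zero
    have h3 : (s.choose i : ℂ) ≠ 0 := Nat.cast_ne_zero.mpr (Nat.choose_pos hi').ne'
    rw [map_nsmul, map_nsmul, LinearMap.map_smul (vertexMap c W₃), LinearMap.map_smul (mcoefL ℓ u),
      vertexMap_Lu, ← Nat.cast_smul_eq_nsmul ℂ, smul_smul, mul_smul_comm, smul_smul, mcoefL_apply,
      hf]
    refine congrArg₂ (· • ·) ?_ (congrArg₂ (· * ·) (congrArg mono ?_) rfl)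
    · rw [hfac]
      field_simp
    · push_cast [hi']
      ring
  rw [mcoefInf, sum_congr rfl fun s _ => hs s,
    sum_range_eq_of_zero (N := q + 2 + (k + 1)), sum_triangle hA hB, sum_comm]
  · refine sum_congr rfl fun j _ => ?_
    rw [mul_smul_comm, smul_smul, ← mul_assoc, mono_mul_mono, mul_sum, smul_sum]
    refine sum_congr rfl fun i _ => ?_
    rw [mul_smul_comm, smul_smul, ← mul_assoc, mono_mul_mono]
    refine congrArg₂ (· • ·) ?_ (congrArg₂ (· * ·) (congrArg mono ?_) rfl)
    · ring
    · ring
  · intro s hs'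
    rw [← hs, VirVOA.opL_pow_eq_zero hLb (by omega), map_zero, ← mcoefL_apply, map_zero, mul_zero,
      smul_zero]
  · intro s hs'
    refine sum_eq_zero fun i _ => ?_
    rcases le_or_gt (q + 2) i with hi | hi
    · exact hA _ _ hi
    · exact hB _ _ (by omega)

/-- The expansions at `0`, `1`, `∞` of the matrix coefficients of an element `b` of weight `k`
with respect to a trilinear form. -/
def triCoef (F : W₁ →ₗ[ℂ] W₂ →ₗ[ℂ] W₃ →ₗ[ℂ] ℂ) (k : ℕ) (b : VirVOA c) (v : W₁) (w : W₂)
    (u : W₃) : Tri :=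
  (mcoef (formMid F v u) (vertexMap c W₂ b) w, mcoef (formLeft F w u) (vertexMap c W₁ b) v,
    mcoefInf (F v w) k b u)

/-- Inserting L₋q is a contour integral around the position x of `b`, which invariance moves to ∞, 0
and 1. The point is that the three expansions obey one and the same recursion, whose coefficients
are powers of x and x - 1. -/
lemma triCoef_Lu (hF : IsInvariantForm c F) {k : ℕ} {b : VirVOA c}
    (hb : b ∈ weightSpace (VirVOA c) (k : ℂ)) (q : ℕ) (v : W₁) (w : W₂) (u : W₃) {N₁ N₂ N₃ : ℕ}
    (h1 : ∀ i : ℕ, N₁ ≤ i → Lu ((i : ℤ) - 1) • v = 0)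
    (h2 : ∀ i : ℕ, N₂ ≤ i → Lu ((i : ℤ) - 1) • w = 0)
    (h3 : ∀ i : ℕ, N₃ ≤ i → Lu ((q : ℤ) + i) • u = 0) :
    triCoef F (k + q) (Lu (-q) • b) v w u =
      ∑ i ∈ range N₃, (cb (1 - q) i * (-1) ^ i) •
          (zfun i * triCoef F k b v w (Lu (q + i) • u)) -
        ∑ i ∈ range N₂, (cb (1 - q) i * (-1) ^ (1 - (q : ℤ) - i)) •
          (zfun (1 - q - i) * triCoef F k b v (Lu ((i : ℤ) - 1) • w) u) -
        ∑ i ∈ range N₁, (cb (1 - q) i * (-1) ^ (1 - (q : ℤ) - i)) •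
          (wfun (1 - q - i) * triCoef F k b (Lu ((i : ℤ) - 1) • v) w u) := by
  have hsq : ∀ n : ℤ, (-1 : ℂ) ^ n * (-1) ^ n = 1 := fun n => by
    rw [← mul_zpow]; norm_num
  refine Prod.ext ?_ (Prod.ext ?_ ?_)
  · simp only [triCoef, Prod.fst_sub, Prod.fst_sum, Prod.smul_fst, Prod.fst_mul, vertexMap_Lu]
    rw [mcoef_fieldL_mid hF q _ v w u h1 h2 h3]
    congr 1
    refine sum_congr rfl fun i _ => ?_
    -- The expansion of (z - 1)ⁿ at 0 carries the sign (-1)ⁿ, which cancels the sign in the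
    -- coefficient.
    rw [wfun, smul_mul_assoc, smul_smul, mul_assoc, hsq, mul_one]
  · simp only [triCoef, Prod.fst_sub, Prod.fst_sum, Prod.smul_fst, Prod.fst_mul, Prod.snd_sub,
      Prod.snd_sum, Prod.smul_snd, Prod.snd_mul, vertexMap_Lu]
    exact mcoef_fieldL_left hF q _ v w u h1 h2 h3
  · simp only [triCoef, Prod.snd_sub, Prod.snd_sum, Prod.smul_snd, Prod.snd_mul]
    rw [mcoefInf_Lu _ hb]
    simp only [mcoef_fieldL_inf hF q _ v w u h1 h2 h3]
    simp only [mul_sub, smul_sub, sum_sub_distrib, mcoefInf, mul_sum, smul_sum]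
    congr 1
    · congr 1
      · rw [sum_comm]
        refine sum_congr rfl fun i _ => sum_congr rfl fun j _ => ?_
        simp only [zfun, mul_smul_comm]
        rw [smul_comm, mul_left_comm]
      · rw [sum_comm]
        refine sum_congr rfl fun i _ => sum_congr rfl fun j _ => ?_
        simp only [zfun, mul_smul_comm]
        rw [smul_comm, mul_left_comm]
    · rw [sum_comm]
      refine sum_congr rfl fun i _ => sum_congr rfl fun j _ => ?_
      simp only [wfun, mul_smul_comm]
      rw [smul_comm, mul_left_comm, mul_assoc (mono _) (bino _ _),
        mul_left_comm (bino _ _) (mono _)]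

/-- The matrix coefficients of `M_c` with respect to an invariant form are rational functions with
poles at `0`, `1`, `∞`. -/
lemma triCoef_mem (hF : IsInvariantForm c F) {k : ℤ} {b : VirVOA c}
    (hb : Monomial (VirVOA.vacuum c) k b) (v : W₁) (w : W₂) (u : W₃) :
    triCoef F k.toNat b v w u ∈ ratSpan := by
  have h0 : Lu 0 • VirVOA.vacuum c = (0 : ℂ) • VirVOA.vacuum c := by
    rw [VirVOA.smul_vacuum, Verma.Lu_zero_hw, zero_smul, map_zero, zero_smul]
  induction hb generalizing v w u with
  | base =>
    have : triCoef F 0 (VirVOA.vacuum c) v w u = F v w u • zfun 0 := by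
      refine Prod.ext ?_ (Prod.ext ?_ ?_)
      · simp only [triCoef, vertexMap_vacuum, mcoef_idField, zfun_zero]
        rfl
      · simp only [triCoef, vertexMap_vacuum, mcoef_idField, zfun_zero]
        rfl
      · simp [triCoef, mcoefInf, vertexMap_vacuum, mcoef_idField, zfun_zero, mono_zero]
    rw [Int.toNat_zero, this]
    exact Submodule.smul_mem _ _ (zfun_mem 0)
  | @step k b j hb hj ih =>
    obtain ⟨q, rfl⟩ := Int.eq_ofNat_of_zero_le hj.le
    obtain ⟨k, rfl⟩ := Int.eq_ofNat_of_zero_le hb.nonneg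
    have hk : b ∈ weightSpace (VirVOA c) (k : ℂ) := by
      have := hb.mem_weightSpace h0
      simpa using this
    obtain ⟨N₁, h1⟩ := exists_Lu_bound' c v
    obtain ⟨N₂, h2⟩ := exists_Lu_bound' c w
    obtain ⟨N₃, h3⟩ := exists_Lu_bound c u q
    have e : ((k : ℤ) + q).toNat = k + q := by omega
    rw [e, triCoef_Lu hF hk q v w u h1 h2 h3]
    simp only [Int.toNat_natCast] at ih
    exact sub_mem (sub_mem
      (sum_mem fun i _ => Submodule.smul_mem _ _ (ratSpan_mul_mem (zfun_mem _) (ih _ _ _)))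
      (sum_mem fun i _ => Submodule.smul_mem _ _ (ratSpan_mul_mem (zfun_mem _) (ih _ _ _))))
      (sum_mem fun i _ => Submodule.smul_mem _ _ (ratSpan_mul_mem (wfun_mem _) (ih _ _ _)))

end

end MatrixCoefficientsVOA

/-! ### Weight decompositions -/

section Weights

variable (c : ℂ) {W : Type*} [AddCommGroup W] [Module ℂ W] [Module UVir W] [IsScalarTower ℂ UVir W]
  [IsGradedVirModule c W]

lemma iSup_weightSpace_eq_top (c : ℂ) [IsGradedVirModule c W] : ⨆ μ : ℂ, weightSpace W μ = ⊤ := by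
  obtain ⟨h, hW⟩ := IsGradedVirModule.graded (c := c) (W := W)
  rw [eq_top_iff, ← hW]
  exact iSup_le fun n => le_iSup (weightSpace W) (h + n)

lemma isInternal_weightSpace_complex (c : ℂ) [IsGradedVirModule c W] : DirectSum.IsInternal (weightSpace W) :=
  DirectSum.isInternal_submodule_of_iSupIndep_of_iSup_eq_top iSupIndep_weightSpace
    (iSup_weightSpace_eq_top c)

lemma mem_of_weight_mem (c : ℂ) [IsGradedVirModule c W] (p : Submodule ℂ W) (hom : ∀ μ : ℂ, ∀ w ∈ weightSpace W μ, w ∈ p) (w : W) :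
    w ∈ p := by
  have h : ⨆ μ : ℂ, weightSpace W μ ≤ p := iSup_le hom
  rw [iSup_weightSpace_eq_top c] at h
  exact h trivial

/-- The linear map that agrees with `f μ` on the weight space `W_μ`. -/
def weightLift {V : Type*} [AddCommGroup V] [Module ℂ V] (f : ℂ → W →ₗ[ℂ] V) : W →ₗ[ℂ] V :=
  DirectSum.toModule ℂ ℂ V (fun μ => f μ ∘ₗ (weightSpace W μ).subtype) ∘ₗ
    (LinearEquiv.ofBijective (DirectSum.coeLinearMap (weightSpace W))
      (isInternal_weightSpace_complex c)).symm.toLinearMap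

lemma weightLift_apply {V : Type*} [AddCommGroup V] [Module ℂ V] (f : ℂ → W →ₗ[ℂ] V) {μ : ℂ}
    {w : W} (hw : w ∈ weightSpace W μ) : weightLift c f w = f μ w := by
  have h : (LinearEquiv.ofBijective (DirectSum.coeLinearMap (weightSpace W))
      (isInternal_weightSpace_complex c)).symm w =
      DirectSum.lof ℂ ℂ (fun μ => weightSpace W μ) μ ⟨w, hw⟩ := by
    refine (LinearEquiv.symm_apply_eq _).mpr ?_
    exact (DirectSum.coeLinearMap_lof (weightSpace W) μ ⟨w, hw⟩).symm
  rw [weightLift, LinearMap.comp_apply, LinearEquiv.coe_coe, h, DirectSum.toModule_lof]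
  rfl

variable (W) in
/-- The projection onto the weight space `W_μ`. -/
def weightProj (μ : ℂ) : W →ₗ[ℂ] W := weightLift c fun ν => if ν = μ then LinearMap.id else 0

lemma weightProj_apply {μ ν : ℂ} {w : W} (hw : w ∈ weightSpace W ν) :
    weightProj c W μ w = if ν = μ then w else 0 := by
  rw [weightProj, weightLift_apply c _ hw]
  split_ifs <;> rfl

open VertexOperator

lemma Monomial.hasDegree {k : ℤ} {b : VirVOA c} (hb : Monomial (VirVOA.vacuum c) k b) :
    HasDegree k (vertexMap c W b) := by
  induction hb with
  | base =>
    rw [vertexMap_vacuum]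
    exact HasDegree.idField
  | @step k b j _ _ ih =>
    rw [vertexMap_Lu]
    have := ih.fieldL (c := c) (-j)
    rwa [sub_neg_eq_add] at this

lemma HasDegree.vertexMap_opL_pow {k : ℤ} {b : VirVOA c} (hb : HasDegree k (vertexMap c W b))
    (j : ℕ) : HasDegree (k - j) (vertexMap c W ((opL (VirVOA c) 1 ^ j) b)) := by
  induction j with
  | zero => simpa using hb
  | succ j ih =>
    rw [opL_pow_succ, vertexMap_Lu]
    have := ih.fieldL (c := c) 1
    rwa [show k - j - 1 = k - (j + 1 : ℕ) by push_cast; ring] at this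

lemma span_monomial_eq_top {h : ℂ} {v : W} (hC : ∀ w : W, Cu • w = c • w)
    (h0 : Lu 0 • v = h • v) (hpos : ∀ n : ℤ, 0 < n → Lu n • v = 0)
    (hcyc : ∀ w : W, ∃ u : UVir, u • v = w) :
    Submodule.span ℂ {b | ∃ k, Monomial v k b} = ⊤ := by
  rw [eq_top_iff]
  rintro b -
  obtain ⟨u, rfl⟩ := hcyc b
  refine smul_mem_of_stable _ ?_ ?_ u (Submodule.subset_span ⟨0, Monomial.base⟩)
  · intro n b hb
    have : Submodule.span ℂ {b | ∃ k, Monomial v k b} ≤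
        (Submodule.span ℂ {b | ∃ k, Monomial v k b}).comap (opL W n) := by
      rw [Submodule.span_le]
      rintro y ⟨k, hy⟩
      have hsub : {x | Monomial v (k - n) x} ⊆ {x | ∃ k, Monomial v k x} :=
        fun x hx => ⟨k - n, hx⟩
      exact Submodule.span_mono hsub (hy.Lu_mem hC h0 hpos n)
    exact this hb
  · intro b hb
    rw [hC]
    exact Submodule.smul_mem _ _ hb

lemma VirVOA.Lu_vacuum_eq_zero {n : ℤ} (hn : -1 ≤ n) : Lu n • VirVOA.vacuum c = 0 := by
  rw [VirVOA.smul_vacuum]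
  rcases eq_or_lt_of_le hn with rfl | hn
  · exact (Submodule.Quotient.mk_eq_zero _).mpr (Submodule.subset_span rfl)
  · rcases eq_or_lt_of_le (show 0 ≤ n by omega) with rfl | hn
    · rw [Verma.Lu_zero_hw, zero_smul, map_zero]
    · rw [Verma.Lu_hw 0 c hn, map_zero]

lemma VirVOA.Lu_zero_vacuum : Lu 0 • VirVOA.vacuum c = (0 : ℂ) • VirVOA.vacuum c := by
  rw [VirVOA.Lu_vacuum_eq_zero c (by omega), zero_smul]

lemma VirVOA.span_monomial :
    Submodule.span ℂ {b | ∃ k, Monomial (VirVOA.vacuum c) k b} = ⊤ :=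
  span_monomial_eq_top c (VirVOA.central c) (VirVOA.Lu_zero_vacuum c)
    (fun _ hn => VirVOA.Lu_vacuum_eq_zero c (by omega)) (VirVOA.exists_smul c)

lemma VirVOA.monomial_mem_weightSpace {k : ℤ} {b : VirVOA c}
    (hb : Monomial (VirVOA.vacuum c) k b) : b ∈ weightSpace (VirVOA c) (k : ℂ) := by
  simpa using hb.mem_weightSpace (VirVOA.Lu_zero_vacuum c)

/-- In z^(j-2k) Y(L₁^j a, z⁻¹) the mode of index n comes with z^(j-2k+n+1); equating the exponent
with -p - 1 gives n = 2k - j - 2 - p. -/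
lemma contragredientMap_apply {k : ℕ} {a : VirVOA c} (ha : a ∈ weightSpace (VirVOA c) (k : ℂ))
    (p : ℤ) (f : restrictedDual W) (u : W) :
    (ncoeff (contragredientMap c W a) p f).1 u = ∑ j ∈ range (k + 1),
      ((-1) ^ k / (j.factorial : ℂ)) *
        f.1 (ncoeff (vertexMap c W ((opL (VirVOA c) 1 ^ j) a)) (2 * k - j - 2 - p) u) := by
  have h : (LinearEquiv.ofBijective
      (DirectSum.coeLinearMap fun k : ℕ => weightSpace (VirVOA c) (k : ℂ))
      (isInternal_weightSpace c)).symm a =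
      DirectSum.lof ℂ ℕ (fun k : ℕ => weightSpace (VirVOA c) (k : ℂ)) k ⟨a, ha⟩ := by
    refine (LinearEquiv.symm_apply_eq _).mpr ?_
    exact (DirectSum.coeLinearMap_lof (fun k : ℕ => weightSpace (VirVOA c) (k : ℂ)) k
      ⟨a, ha⟩).symm
  rw [contragredientMap, LinearMap.comp_apply, LinearEquiv.coe_coe, h, DirectSum.toModule_lof,
    contragredientHom]
  simp only [LinearMap.sum_apply, LinearMap.smul_apply, map_sum, map_smul, Finset.sum_apply,
    Pi.smul_apply, Submodule.coe_sum, Submodule.coe_smul, smul_eq_mul]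
  refine sum_congr rfl fun j _ => ?_
  rw [LinearMap.comp_apply, transposeField]
  simp only [LinearMap.coe_mk, AddHom.coe_mk, ncoeff_mkField]
  rfl

/-- The modes of `Y(ω, z)` are the operators `Lₙ`. -/
lemma ncoeff_vertexMap_omega (n : ℤ) (w : W) :
    ncoeff (vertexMap c W (VirVOA.omega c)) n w = Lu (n - 1) • w := by
  obtain ⟨N, hN⟩ := exists_Lu_bound c w (-1)
  -- Since ω = L₋₂ 1, the kernel is (z - x)⁻¹, a geometric series.
  have hc : ∀ j : ℕ, (-1 : ℂ) ^ j * cb (-1) j = 1 := fun j => by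
    induction j with
    | zero => simp [cb_zero]
    | succ j ih =>
      have h := cb_succ_right (-1) j
      have hj : (j : ℂ) + 1 ≠ 0 := Nat.cast_add_one_ne_zero j
      refine mul_left_cancel₀ hj ?_
      rw [pow_succ]
      push_cast at h
      linear_combination -(-1) ^ j * h + ((j : ℂ) + 1) * ih
  rw [VirVOA.omega, vertexMap_Lu, vertexMap_vacuum, ncoeff_fieldL_eq_res, resLeft, resRight]
  simp only [idField, ncoeff_mkField, show (-2 : ℤ) + 1 = -1 by norm_num, hc, mul_one, one_smul]
  -- The modes with n < 0 come from the expansion in powers of x, those with n ≥ 0 from the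
  -- expansion in powers of z.
  rcases lt_or_ge n 0 with hn | hn
  · rw [finsum_eq_single _ (-1 - n).toNat, finsum_eq_zero_of_forall_eq_zero, sub_zero,
      if_pos (by omega), Module.End.one_apply]
    · congr 2
      omega
    · intro j
      rw [if_neg (by omega), LinearMap.zero_apply, smul_zero]
    · intro j hj
      rw [if_neg (by omega), LinearMap.zero_apply, smul_zero]
  · rw [finsum_eq_zero_of_forall_eq_zero, finsum_eq_single _ n.toNat, zero_sub,
      if_pos (by omega), Module.End.one_apply]
    · rw [zpow_neg_one, inv_neg, inv_one, neg_smul, one_smul, neg_neg]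
      congr 2
      omega
    · intro j hj
      rw [if_neg (by omega), LinearMap.zero_apply, smul_zero]
    · intro j
      rw [if_neg (by omega), LinearMap.zero_apply, smul_zero]

end Weights

/-! ### The intertwining operator of an invariant form -/

section Intertwiner

open VertexOperator

variable (c : ℂ) {W₁ W₂ W₃ : Type*}
  [AddCommGroup W₁] [Module ℂ W₁] [Module UVir W₁] [IsScalarTower ℂ UVir W₁]
  [AddCommGroup W₂] [Module ℂ W₂] [Module UVir W₂] [IsScalarTower ℂ UVir W₂]
  [AddCommGroup W₃] [Module ℂ W₃] [Module UVir W₃] [IsScalarTower ℂ UVir W₃]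
  [IsGradedVirModule c W₁] [IsGradedVirModule c W₂] [IsGradedVirModule c W₃]
  (F : W₁ →ₗ[ℂ] W₂ →ₗ[ℂ] W₃ →ₗ[ℂ] ℂ)

/-- The component of degree `n` of a trilinear form. -/
def formMode (n : ℂ) : W₁ →ₗ[ℂ] W₂ →ₗ[ℂ] Module.Dual ℂ W₃ :=
  weightLift c fun μ => (weightLift c fun ν =>
    (F.compr₂ (LinearMap.lcomp ℂ ℂ (weightProj c W₃ (μ + ν - n - 1)))).flip).flip

variable {μ ν κ : ℂ} {v : W₁} {w : W₂} {u : W₃}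

lemma formMode_apply (n : ℂ) (hv : v ∈ weightSpace W₁ μ) (hw : w ∈ weightSpace W₂ ν)
    (hu : u ∈ weightSpace W₃ κ) :
    formMode c F n v w u = if κ = μ + ν - n - 1 then F v w u else 0 := by
  rw [formMode, weightLift_apply c _ hv, LinearMap.flip_apply, weightLift_apply c _ hw,
    LinearMap.flip_apply, LinearMap.compr₂_apply, LinearMap.lcomp_apply, weightProj_apply c hu]
  split_ifs
  · rfl
  · rw [map_zero]

lemma formMode_mem (n : ℂ) (v : W₁) (w : W₂) : formMode c F n v w ∈ restrictedDual W₃ := by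
  refine mem_of_weight_mem c ((restrictedDual W₃).comap ((formMode c F n).flip w)) ?_ v
  intro μ v hv
  refine mem_of_weight_mem c ((restrictedDual W₃).comap (formMode c F n v)) ?_ w
  intro ν w hw
  rw [Submodule.mem_comap, mem_restrictedDual]
  refine (Set.finite_singleton (μ + ν - n - 1)).subset ?_
  rintro κ ⟨u, hu, hne⟩
  rw [formMode_apply c F n hv hw hu] at hne
  by_contra h
  exact hne (if_neg h)

/-- The intertwining operator whose modes are the homogeneous components of a trilinear form. -/
def formIntertwiner : W₁ →ₗ[ℂ] (ℂ → (W₂ →ₗ[ℂ] restrictedDual W₃)) where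
  toFun v n := (formMode c F n v).codRestrict _ (formMode_mem c F n v)
  map_add' v v' := by
    funext n
    refine LinearMap.ext fun w => Subtype.ext ?_
    simp
  map_smul' a v := by
    funext n
    refine LinearMap.ext fun w => Subtype.ext ?_
    simp

lemma formIntertwiner_apply (n : ℂ) (v : W₁) (w : W₂) :
    (formIntertwiner c F v n w).1 = formMode c F n v w := rfl

variable {F}

/-- The field z ∂_z acts at 1 through L₋₁ + L₀ and at 0 and ∞ through L₀ with opposite signs. On the
weights selected by mode n of L₋₁ v the factor equals -n, which is the derivative property. -/
lemma IsInvariantForm.translation (hF : IsInvariantForm c F) (hv : v ∈ weightSpace W₁ μ)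
    (hw : w ∈ weightSpace W₂ ν) (hu : u ∈ weightSpace W₃ κ) :
    F (Lu (-1) • v) w u = (κ - ν - μ) * F v w u := by
  obtain ⟨N, hN⟩ := exists_Lu_bound' c v
  have h := hF.zfun 1 v w u hN
  have hc : ∀ i, 2 ≤ i → cb 1 i = 0 := fun i hi => by
    have := cb_natCast 1 i
    rw [Nat.cast_one] at this
    rw [this, Nat.choose_eq_zero_of_lt (by omega), Nat.cast_zero]
  rw [sum_range_eq_of_zero (N := 2) (fun i hi => by rw [hN i hi]; simp)
    (fun i hi => by rw [hc i hi, zero_mul]), sum_range_succ, sum_range_one] at h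
  rw [mem_weightSpace] at hv hw hu
  have h1 : cb 1 1 = 1 := by simp [cb]
  norm_num [cb_zero, h1, hv, hw, hu] at h
  linear_combination h

lemma formIntertwiner_trunc (v : W₁) (w : W₂) :
    ∃ N : ℝ, ∀ n : ℂ, N ≤ n.re → formIntertwiner c F v n w = 0 := by
  obtain ⟨h, hW⟩ := IsGradedVirModule.graded (c := c) (W := W₃)
  let p (v : W₁) : Submodule ℂ W₂ :=
    { carrier := {w | ∃ N : ℝ, ∀ n : ℂ, N ≤ n.re → formIntertwiner c F v n w = 0}
      zero_mem' := ⟨0, fun n _ => map_zero _⟩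
      add_mem' := by
        rintro w w' ⟨N, hN⟩ ⟨M, hM⟩
        refine ⟨max N M, fun n hn => ?_⟩
        rw [map_add, hN n (le_trans (le_max_left _ _) hn), hM n (le_trans (le_max_right _ _) hn),
          add_zero]
      smul_mem' := by
        rintro a w ⟨N, hN⟩
        exact ⟨N, fun n hn => by rw [map_smul, hN n hn, smul_zero]⟩ }
  let q : Submodule ℂ W₁ :=
    { carrier := {v | ∀ w, ∃ N : ℝ, ∀ n : ℂ, N ≤ n.re → formIntertwiner c F v n w = 0}
      zero_mem' := fun w => ⟨0, fun n _ => by rw [map_zero]; rfl⟩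
      add_mem' := by
        intro v v' hv hv' w
        obtain ⟨N, hN⟩ := hv w
        obtain ⟨M, hM⟩ := hv' w
        refine ⟨max N M, fun n hn => ?_⟩
        rw [map_add, Pi.add_apply, LinearMap.add_apply, hN n (le_trans (le_max_left _ _) hn),
          hM n (le_trans (le_max_right _ _) hn), add_zero]
      smul_mem' := by
        intro a v hv w
        obtain ⟨N, hN⟩ := hv w
        exact ⟨N, fun n hn => by
          rw [map_smul, Pi.smul_apply, LinearMap.smul_apply, hN n hn, smul_zero]⟩ }
  refine mem_of_weight_mem c q (fun μ v hv => ?_) v w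
  intro w
  refine mem_of_weight_mem c (p v) (fun ν w hw => ?_) w
  -- Beyond this bound the selected weight μ + ν - n - 1 has real part at most Re h - 1, below all
  -- weights of W₃.
  refine ⟨μ.re + ν.re - h.re, fun n hn => Subtype.ext (LinearMap.ext fun u => ?_)⟩
  refine mem_of_weight_mem c (LinearMap.ker (formMode c F n v w)) (fun κ u hu => ?_) u
  rw [LinearMap.mem_ker, formMode_apply c F n hv hw hu]
  split_ifs with e
  · rw [weightSpace_eq_bot hW, Submodule.mem_bot] at hu
    · rw [hu, map_zero]
    · intro j hj
      have := congrArg Complex.re (e.symm.trans hj)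
      simp at this
      have hj' : (0 : ℝ) ≤ j := Nat.cast_nonneg j
      linarith
  · rfl

lemma formIntertwiner_derivative (hF : IsInvariantForm c F) (v : W₁) (n : ℂ) :
    formIntertwiner c F (ncoeff (vertexMap c W₁ (VirVOA.omega c)) 0 v) n =
      -n • formIntertwiner c F v (n - 1) := by
  refine LinearMap.ext fun w => Subtype.ext (LinearMap.ext fun u => ?_)
  rw [ncoeff_vertexMap_omega, zero_sub, formIntertwiner_apply]
  change _ = -n * formMode c F (n - 1) v w u
  rw [← sub_eq_zero]
  refine mem_of_weight_mem c (LinearMap.ker ((((formMode c F n).flip w).flip u) ∘ₗ opL W₁ (-1) -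
    (-n) • (((formMode c F (n - 1)).flip w).flip u))) (fun μ v hv => ?_) v
  refine mem_of_weight_mem c (LinearMap.ker ((formMode c F n (Lu (-1) • v)).flip u -
    (-n) • ((formMode c F (n - 1) v).flip u))) (fun ν w hw => ?_) w
  refine mem_of_weight_mem c (LinearMap.ker (formMode c F n (Lu (-1) • v) w -
    (-n) • (formMode c F (n - 1) v w))) (fun κ u hu => ?_) u
  rw [LinearMap.mem_ker, LinearMap.sub_apply, LinearMap.smul_apply,
    formMode_apply c F n (Lu_mem_weightSpace (-1) hv) hw hu, formMode_apply c F (n - 1) hv hw hu,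
    hF.translation c hv hw hu]
  have e : κ = μ - ((-1 : ℤ) : ℂ) + ν - n - 1 ↔ κ = μ + ν - (n - 1) - 1 := by
    rw [show μ - ((-1 : ℤ) : ℂ) + ν - n - 1 = μ + ν - (n - 1) - 1 by push_cast; ring]
  simp only [e]
  split_ifs with h
  · rw [smul_eq_mul]
    linear_combination F v w u * h
  · rw [smul_zero, sub_zero]

end Intertwiner

/-! ### The Jacobi identity -/

section Jacobi

open VertexOperator

/-- The pointwise finite sum of a sequence of linear maps. -/
def finsumLinear {A D : Type*} [AddCommGroup A] [Module ℂ A] [AddCommGroup D] [Module ℂ D]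
    (T : ℕ → A → D) (hT : ∀ j, IsLinearMap ℂ (T j))
    (h : ∀ a, (Function.support fun j => T j a).Finite) : A →ₗ[ℂ] D where
  toFun a := ∑ᶠ j, T j a
  map_add' a b := by
    simp only [(hT _).map_add]
    exact finsum_add_distrib (h a) (h b)
  map_smul' t a := by
    simp only [(hT _).map_smul, RingHom.id_apply]
    exact (smul_finsum' t (h a)).symm

lemma finsumLinear_apply {A D : Type*} [AddCommGroup A] [Module ℂ A] [AddCommGroup D] [Module ℂ D]
    (T : ℕ → A → D) (hT : ∀ j, IsLinearMap ℂ (T j))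
    (h : ∀ a, (Function.support fun j => T j a).Finite) (a : A) :
    finsumLinear T hT h a = ∑ᶠ j, T j a := rfl

variable {c : ℂ} {W₁ W₂ W₃ : Type*}
  [AddCommGroup W₁] [Module ℂ W₁] [Module UVir W₁] [IsScalarTower ℂ UVir W₁]
  [AddCommGroup W₂] [Module ℂ W₂] [Module UVir W₂] [IsScalarTower ℂ UVir W₂]
  [AddCommGroup W₃] [Module ℂ W₃] [Module UVir W₃] [IsScalarTower ℂ UVir W₃]
  [IsGradedVirModule c W₁] [IsGradedVirModule c W₂] [IsGradedVirModule c W₃]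
  {F : W₁ →ₗ[ℂ] W₂ →ₗ[ℂ] W₃ →ₗ[ℂ] ℂ}

/-- The residue theorem for `z ^ m (z - 1) ^ l` times the matrix coefficients. -/
lemma IsInvariantForm.sum_residues (hF : IsInvariantForm c F) {k : ℕ} {b : VirVOA c}
    (hb : Monomial (VirVOA.vacuum c) k b) (l m : ℤ) (v : W₁) (w : W₂) (u : W₃) {J : ℕ}
    (h1 : ∀ j : ℕ, J ≤ j → ncoeff (vertexMap c W₁ b) (l + j) v = 0)
    (h2 : ∀ j : ℕ, J ≤ j → ncoeff (vertexMap c W₂ b) (m + j) w = 0)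
    (h3 : ∀ j : ℕ, J ≤ j → (mcoefInf (F v w) k b u).coeff (m + l + 1 - j) = 0) :
    ∑ j ∈ range J, (((-1) ^ j * cb l j) * ((mcoefInf (F v w) k b u).coeff (m + l + 1 - j) -
        (-1) ^ l * F v (ncoeff (vertexMap c W₂ b) (m + j) w) u) -
      cb m j * F (ncoeff (vertexMap c W₁ b) (l + j) v) w u) = 0 := by
  have hmem := triCoef_mem hF hb v w u
  rw [Int.toNat_natCast] at hmem
  have h := resSum_eq_zero (ratSpan_mul_mem (ratSpan_mul_mem (zfun_mem m) (wfun_mem l)) hmem)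
  rw [resSum_apply] at h
  simp only [VirasoroFusion.zfun, VirasoroFusion.wfun, triCoef, Prod.mk_mul_mk] at h
  -- At each point the product is arranged as monomials times one binomial series times a matrix
  -- coefficient, so that `bino_mul_coeff` with the common bound J applies to all three residues.
  rw [mul_smul_comm, smul_mul_assoc, mul_assoc, ser_coeff_smul, mono_mul_coeff, mul_comm (bino 1 m),
    mul_assoc, mono_mul_coeff, mul_assoc, mono_mul_coeff, mul_assoc, mono_mul_coeff,
    bino_mul_coeff _ _ _ _ J, bino_mul_coeff _ _ _ _ J, bino_mul_coeff _ _ _ _ J] at h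
  · have e1 : ∀ j : ℕ, -1 - m - (j : ℤ) = -(m + j) - 1 := fun j => by ring
    have e2 : ∀ j : ℕ, -1 - l - (j : ℤ) = -(l + j) - 1 := fun j => by ring
    have e3 : ∀ j : ℕ, 1 - -m - -l - (j : ℤ) = m + l + 1 - j := fun j => by ring
    simp only [e1, e2, e3, mcoef_coeff', formMid_apply, formLeft_apply, one_pow, one_mul] at h
    rw [mul_sum] at h
    simp only [mul_sub, sum_sub_distrib]
    have e : ∑ j ∈ range J, (-1) ^ j * cb l j *
        ((-1) ^ l * F v (ncoeff (vertexMap c W₂ b) (m + j) w) u) =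
        ∑ j ∈ range J, (-1) ^ l * ((-1) ^ j * cb l j *
          F v (ncoeff (vertexMap c W₂ b) (m + j) w) u) :=
      sum_congr rfl fun j _ => by ring
    rw [e]
    linear_combination -h
  · intro j hj
    rw [show 1 - -m - -l - (j : ℤ) = m + l + 1 - j by ring]
    exact h3 j hj
  · intro j hj
    rw [show -1 - l - (j : ℤ) = -(l + j) - 1 by ring, mcoef_coeff', h1 j hj, map_zero]
  · intro j hj
    rw [show -1 - m - (j : ℤ) = -(m + j) - 1 by ring, mcoef_coeff', h2 j hj, map_zero]

variable {μ ν κ : ℂ} {v : W₁} {w : W₂} {u : W₃}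

/-- The degree k - j of the field of L₁^j b compensates the mode index, so every j imposes the same
weight condition; it factors out and leaves a coefficient of the expansion at infinity. -/
lemma contragredientMap_formIntertwiner {k : ℕ} {b : VirVOA c}
    (hb : Monomial (VirVOA.vacuum c) k b) (p : ℤ) (n : ℂ) (hv : v ∈ weightSpace W₁ μ)
    (hw : w ∈ weightSpace W₂ ν) (hu : u ∈ weightSpace W₃ κ) :
    (ncoeff (contragredientMap c W₃ b) p (formIntertwiner c F v n w)).1 u =
      if κ = μ + ν + k - n - p - 2 then (mcoefInf (F v w) k b u).coeff (p + 1) else 0 := by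
  have hk : b ∈ weightSpace (VirVOA c) (k : ℂ) := by
    have := VirVOA.monomial_mem_weightSpace c hb
    simpa using this
  rw [contragredientMap_apply c hk, mcoefInf, HahnSeries.coeff_sum]
  have h : ∀ j : ℕ, (formIntertwiner c F v n w).1 (ncoeff (vertexMap c W₃
      ((opL (VirVOA c) 1 ^ j) b)) (2 * k - j - 2 - p) u) =
      if κ = μ + ν + k - n - p - 2 then F v w (ncoeff (vertexMap c W₃
        ((opL (VirVOA c) 1 ^ j) b)) (2 * k - j - 2 - p) u) else 0 := by
    intro j
    rw [formIntertwiner_apply, formMode_apply c F n hv hw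
      ((Monomial.hasDegree c hb).vertexMap_opL_pow c j (2 * k - j - 2 - p) κ u hu)]
    refine if_congr ?_ rfl rfl
    push_cast
    constructor
    · intro h; linear_combination h
    · intro h; linear_combination h
  simp only [h]
  split_ifs with e
  · refine sum_congr rfl fun j _ => ?_
    rw [ser_coeff_smul, mono_mul_coeff,
      show p + 1 - (2 * (k : ℤ) - j) = -(2 * k - j - 2 - p) - 1 by ring, mcoef_coeff']
  · simp

/-- The `j`-th term of the Jacobi identity for `formIntertwiner`. -/
def jacobiTerm (F : W₁ →ₗ[ℂ] W₂ →ₗ[ℂ] W₃ →ₗ[ℂ] ℂ) (a : VirVOA c) (v : W₁) (w : W₂) (l m : ℤ)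
    (n : ℂ) (j : ℕ) : restrictedDual W₃ :=
  ((-1) ^ j * cb l j) •
      (ncoeff (contragredientMap c W₃ a) (m + l - j) (formIntertwiner c F v (n + j) w) -
        (-1 : ℂ) ^ l •
          formIntertwiner c F v (n + l - j) (ncoeff (vertexMap c W₂ a) (m + j) w)) -
    cb m j • formIntertwiner c F (ncoeff (vertexMap c W₁ a) (l + j) v) (m + n - j) w

lemma jacobiTerm_finite_left (a : VirVOA c) (v : W₁) (w : W₂) (l m : ℤ) (n : ℂ) :
    (Function.support fun j : ℕ => ((-1) ^ j * cb l j) •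
      (ncoeff (contragredientMap c W₃ a) (m + l - j) (formIntertwiner c F v (n + j) w) -
        (-1 : ℂ) ^ l •
          formIntertwiner c F v (n + l - j) (ncoeff (vertexMap c W₂ a) (m + j) w))).Finite := by
  obtain ⟨N, hN⟩ := bounded_mode (formIntertwiner_trunc c (F := F) v w) n
  obtain ⟨M, hM⟩ := exists_mode_bound (vertexMap c W₂ a) w m
  refine finite_support_of_bound (max N M) fun j hj => ?_
  rw [hN j (le_trans (le_max_left _ _) hj), hM j (le_trans (le_max_right _ _) hj)]
  simp

lemma jacobiTerm_finite (a : VirVOA c) (v : W₁) (w : W₂) (l m : ℤ) (n : ℂ) :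
    (Function.support (jacobiTerm F a v w l m n)).Finite :=
  ((jacobiTerm_finite_left a v w l m n).union
    (IsIntertwining.finite_right (vertexMap c W₁) (formIntertwiner c F) a v w l m n)).subset
      (Function.support_sub _ _)

/-- All three pieces select the same weight of u, and that weight does not depend on j. The
projection onto weights therefore drops out of the Jacobi identity, which becomes a statement about
F alone. -/
lemma jacobiTerm_homogeneous {k : ℕ} {b : VirVOA c} (hb : Monomial (VirVOA.vacuum c) k b)
    (l m : ℤ) (n : ℂ) (j : ℕ) (hv : v ∈ weightSpace W₁ μ) (hw : w ∈ weightSpace W₂ ν)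
    (hu : u ∈ weightSpace W₃ κ) :
    (jacobiTerm F b v w l m n j).1 u = if κ = μ + ν + k - n - m - l - 2 then
      (((-1) ^ j * cb l j) * ((mcoefInf (F v w) k b u).coeff (m + l + 1 - j) -
        (-1) ^ l * F v (ncoeff (vertexMap c W₂ b) (m + j) w) u) -
      cb m j * F (ncoeff (vertexMap c W₁ b) (l + j) v) w u) else 0 := by
  have h1 := contragredientMap_formIntertwiner (F := F) hb (m + l - j) (n + j) hv hw hu
  have h2 := formMode_apply c F (n + l - j) hv
    (Monomial.hasDegree c hb (m + j) ν w hw) hu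
  have h3 := formMode_apply c F (m + n - j)
    (Monomial.hasDegree c hb (l + j) μ v hv) hw hu
  have e1 : μ + ν + k - (n + j) - ((m + l - j : ℤ) : ℂ) - 2 = μ + ν + k - n - m - l - 2 := by
    push_cast; ring
  have e2 : μ + (ν + ((k : ℤ) : ℂ) - ((m + j : ℤ) : ℂ) - 1) - (n + l - j) - 1 =
      μ + ν + k - n - m - l - 2 := by push_cast; ring
  have e3 : (μ + ((k : ℤ) : ℂ) - ((l + j : ℤ) : ℂ) - 1) + ν - (m + n - j) - 1 =
      μ + ν + k - n - m - l - 2 := by push_cast; ring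
  rw [e1, show m + l - (j : ℤ) + 1 = m + l + 1 - j by ring] at h1
  rw [e2] at h2
  rw [e3] at h3
  change ((-1) ^ j * cb l j) * ((ncoeff (contragredientMap c W₃ b) (m + l - j)
    (formIntertwiner c F v (n + j) w)).1 u - (-1 : ℂ) ^ l * formMode c F (n + l - j) v
      (ncoeff (vertexMap c W₂ b) (m + j) w) u) -
    cb m j * formMode c F (m + n - j) (ncoeff (vertexMap c W₁ b) (l + j) v) w u = _
  rw [h1, h2, h3]
  split_ifs
  · rfl
  · ring

lemma finsum_jacobiTerm_monomial (hF : IsInvariantForm c F) {k : ℕ} {b : VirVOA c}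
    (hb : Monomial (VirVOA.vacuum c) k b) (l m : ℤ) (n : ℂ) (hv : v ∈ weightSpace W₁ μ)
    (hw : w ∈ weightSpace W₂ ν) : ∑ᶠ j, jacobiTerm F b v w l m n j = 0 := by
  refine Subtype.ext (LinearMap.ext fun u => ?_)
  refine mem_of_weight_mem c (LinearMap.ker (∑ᶠ j, jacobiTerm F b v w l m n j).1)
    (fun κ u hu => ?_) u
  rw [LinearMap.mem_ker]
  have hmap := map_finsum ((LinearMap.applyₗ u : Module.Dual ℂ W₃ →ₗ[ℂ] ℂ) ∘ₗ
    (restrictedDual W₃).subtype) (jacobiTerm_finite (F := F) b v w l m n)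
  refine hmap.trans ?_
  change ∑ᶠ j, (jacobiTerm F b v w l m n j).1 u = 0
  simp only [jacobiTerm_homogeneous hb l m n _ hv hw hu]
  split_ifs with e
  · obtain ⟨J₁, h1⟩ := exists_mode_bound (vertexMap c W₁ b) v l
    obtain ⟨J₂, h2⟩ := exists_mode_bound (vertexMap c W₂ b) w m
    obtain ⟨M, hM⟩ := ser_bounded (mcoefInf (F v w) k b u)
    set J := max (max J₁ J₂) (m + l + 2 - M).toNat with hJ
    have h1' : ∀ j : ℕ, J ≤ j → ncoeff (vertexMap c W₁ b) (l + j) v = 0 :=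
      fun j hj => h1 j (by omega)
    have h2' : ∀ j : ℕ, J ≤ j → ncoeff (vertexMap c W₂ b) (m + j) w = 0 :=
      fun j hj => h2 j (by omega)
    have h3' : ∀ j : ℕ, J ≤ j → (mcoefInf (F v w) k b u).coeff (m + l + 1 - j) = 0 :=
      fun j hj => hM _ (by omega)
    rw [finsum_eq_sum_range (N := J)]
    · exact hF.sum_residues hb l m v w u h1' h2' h3'
    · intro j hj
      rw [h1' j hj, h2' j hj, h3' j hj]
      simp
  · exact finsum_zero

lemma isLinearMap_jacobiTerm_left (a : VirVOA c) (w : W₂) (l m : ℤ) (n : ℂ) (j : ℕ) :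
    IsLinearMap ℂ fun v => jacobiTerm F a v w l m n j where
  map_add x y := by
    simp only [jacobiTerm, map_add, LinearMap.add_apply, Pi.add_apply]
    module
  map_smul t x := by
    simp only [jacobiTerm, map_smul, LinearMap.smul_apply, Pi.smul_apply]
    module

lemma isLinearMap_jacobiTerm_right (a : VirVOA c) (v : W₁) (l m : ℤ) (n : ℂ) (j : ℕ) :
    IsLinearMap ℂ fun w => jacobiTerm F a v w l m n j where
  map_add x y := by
    simp only [jacobiTerm, map_add]
    module
  map_smul t x := by
    simp only [jacobiTerm, map_smul]
    module

lemma isLinearMap_jacobiTerm (v : W₁) (w : W₂) (l m : ℤ) (n : ℂ) (j : ℕ) :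
    IsLinearMap ℂ fun a : VirVOA c => jacobiTerm F a v w l m n j where
  map_add x y := by
    simp only [jacobiTerm, map_add, LinearMap.add_apply, Pi.add_apply]
    module
  map_smul t x := by
    simp only [jacobiTerm, map_smul, LinearMap.smul_apply, Pi.smul_apply]
    module

/-- Finiteness of the support for each choice of arguments makes the sum linear in v, w and a
separately, so homogeneous vectors and monomials suffice. -/
lemma finsum_jacobiTerm (hF : IsInvariantForm c F) (a : VirVOA c) (v : W₁) (w : W₂) (l m : ℤ)
    (n : ℂ) : ∑ᶠ j, jacobiTerm F a v w l m n j = 0 := by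
  refine mem_of_weight_mem c (LinearMap.ker (finsumLinear _
    (isLinearMap_jacobiTerm_left (F := F) a w l m n) fun v => jacobiTerm_finite a v w l m n))
    (fun μ v hv => ?_) v
  rw [LinearMap.mem_ker, finsumLinear_apply]
  refine mem_of_weight_mem c (LinearMap.ker (finsumLinear _
    (isLinearMap_jacobiTerm_right (F := F) a v l m n) fun w => jacobiTerm_finite a v w l m n))
    (fun ν w hw => ?_) w
  rw [LinearMap.mem_ker, finsumLinear_apply]
  have h : Submodule.span ℂ {b | ∃ k, Monomial (VirVOA.vacuum c) k b} ≤
      LinearMap.ker (finsumLinear _ (isLinearMap_jacobiTerm (F := F) v w l m n)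
        fun a => jacobiTerm_finite a v w l m n) := by
    rw [Submodule.span_le]
    rintro b ⟨k, hb⟩
    obtain ⟨k, rfl⟩ := Int.eq_ofNat_of_zero_le hb.nonneg
    rw [SetLike.mem_coe, LinearMap.mem_ker, finsumLinear_apply]
    exact finsum_jacobiTerm_monomial hF hb l m n hv hw
  rw [VirVOA.span_monomial] at h
  exact LinearMap.mem_ker.mp (h (x := a) trivial)

lemma isIntertwining_formIntertwiner (hF : IsInvariantForm c F) :
    IsIntertwining (VirVOA.omega c) (vertexMap c W₁) (vertexMap c W₂) (contragredientMap c W₃)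
      (formIntertwiner c F) where
  trunc := formIntertwiner_trunc c
  derivative := formIntertwiner_derivative c hF
  jacobi a v w l m n := by
    rw [← sub_eq_zero, ← finsum_sub_distrib (jacobiTerm_finite_left a v w l m n)
      (IsIntertwining.finite_right (vertexMap c W₁) (formIntertwiner c F) a v w l m n)]
    exact finsum_jacobiTerm hF a v w l m n

end Jacobi

/-! ### Intertwining operators are determined by one matrix coefficient -/

section Uniqueness

open VertexOperator

/-- Since L₁ ω = 0, only the summand j = 0 of the contragredient formula remains; it says that Lₙ on
the dual is the transpose of L₋ₙ, with n = p - 1. -/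
lemma contragredientMap_omega (c : ℂ) {W : Type*} [AddCommGroup W] [Module ℂ W] [Module UVir W]
    [IsScalarTower ℂ UVir W] [IsGradedVirModule c W] (p : ℤ) (f : restrictedDual W) (u : W) :
    (ncoeff (contragredientMap c W (VirVOA.omega c)) p f).1 u = f.1 (Lu (1 - p) • u) := by
  have hω : VirVOA.omega c ∈ weightSpace (VirVOA c) ((2 : ℕ) : ℂ) := by
    have := VirVOA.monomial_mem_weightSpace c
      (Monomial.step (j := 2) (Monomial.base (v := VirVOA.vacuum c)) (by omega))
    simpa [VirVOA.omega] using this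
  have h1 : Lu 1 • VirVOA.omega c = 0 := by
    rw [VirVOA.omega, Lu_smul_smul, VirVOA.Lu_vacuum_eq_zero c (by omega),
      VirVOA.Lu_vacuum_eq_zero c (by omega)]
    simp
  have e1 : (opL (VirVOA c) 1 ^ 1) (VirVOA.omega c) = 0 := by rw [pow_one, opL_apply, h1]
  have e2 : (opL (VirVOA c) 1 ^ 2) (VirVOA.omega c) = 0 := by
    rw [opL_pow_succ, e1, ← opL_apply, map_zero]
  rw [contragredientMap_apply c hω, sum_range_succ, sum_range_succ, sum_range_one, e1, e2,
    pow_zero, Module.End.one_apply, map_zero, ncoeff_vertexMap_omega,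
    show 2 * ((2 : ℕ) : ℤ) - (0 : ℕ) - 2 - p - 1 = 1 - p by push_cast; ring]
  simp

variable {c : ℂ} {W₁ W₂ W₃ : Type*}
  [AddCommGroup W₁] [Module ℂ W₁] [Module UVir W₁] [IsScalarTower ℂ UVir W₁]
  [AddCommGroup W₂] [Module ℂ W₂] [Module UVir W₂] [IsScalarTower ℂ UVir W₂]
  [AddCommGroup W₃] [Module ℂ W₃] [Module UVir W₃] [IsScalarTower ℂ UVir W₃]
  [IsGradedVirModule c W₁] [IsGradedVirModule c W₂] [IsGradedVirModule c W₃]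
  {I : W₁ →ₗ[ℂ] (ℂ → (W₂ →ₗ[ℂ] restrictedDual W₃))}

lemma cb_zero_left {j : ℕ} (hj : j ≠ 0) : cb 0 j = 0 := by
  rw [← Nat.cast_zero, cb_natCast, Nat.choose_eq_zero_of_lt (by omega), Nat.cast_zero]

lemma IsIntertwining.omega_derivative (hI : IsIntertwining (VirVOA.omega c) (vertexMap c W₁)
    (vertexMap c W₂) (contragredientMap c W₃) I) (n : ℂ) (v : W₁) (w : W₂) (u : W₃) :
    (I (Lu (-1) • v) n w).1 u = -n * (I v (n - 1) w).1 u := by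
  have h := hI.derivative v n
  rw [ncoeff_vertexMap_omega, zero_sub] at h
  rw [h]
  rfl

/-- The commutator formula for the Virasoro element. -/
lemma IsIntertwining.omega_commutator (hI : IsIntertwining (VirVOA.omega c) (vertexMap c W₁)
    (vertexMap c W₂) (contragredientMap c W₃) I) (m : ℤ) (n : ℂ) (v : W₁) (w : W₂) (u : W₃) :
    (I v n w).1 (Lu (1 - m) • u) - (I v n (Lu (m - 1) • w)).1 u =
      (∑ᶠ j : ℕ, cb m j • I (Lu ((j : ℤ) - 1) • v) (m + n - j) w).1 u := by
  have h := hI.jacobi (VirVOA.omega c) v w 0 m n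
  -- For l = 0 only j = 0 contributes on the left of the Jacobi identity, leaving a commutator.
  rw [finsum_eq_single _ 0 (fun j hj => by rw [cb_zero_left hj, mul_zero, zero_smul])] at h
  simp only [ncoeff_vertexMap_omega, zero_add, cb_zero, pow_zero, one_smul, mul_one, zpow_zero,
    Nat.cast_zero, add_zero, sub_zero, Int.cast_zero] at h
  rw [← h, ← contragredientMap_omega c]
  rfl

/-- The associator formula for the Virasoro element. -/
lemma IsIntertwining.omega_associator (hI : IsIntertwining (VirVOA.omega c) (vertexMap c W₁)
    (vertexMap c W₂) (contragredientMap c W₃) I) (l : ℤ) (n : ℂ) (v : W₁) (w : W₂) :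
    I (Lu (l - 1) • v) n w = ∑ᶠ j : ℕ, ((-1) ^ j * cb l j) •
      (ncoeff (contragredientMap c W₃ (VirVOA.omega c)) (l - j) (I v (n + j) w) -
        (-1 : ℂ) ^ l • I v (n + l - j) (Lu ((j : ℤ) - 1) • w)) := by
  have h := hI.jacobi (VirVOA.omega c) v w l 0 n
  -- For m = 0 only j = 0 contributes on the right, leaving the mode of a single L_{l-1} v.
  rw [finsum_eq_single (fun j : ℕ => cb 0 j • _) 0
    (fun j hj => by rw [cb_zero_left hj, zero_smul])] at h
  simp only [ncoeff_vertexMap_omega, zero_add, cb_zero, one_smul,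
    Nat.cast_zero, add_zero, sub_zero, Int.cast_zero] at h
  exact h.symm

/-- The commutator with L₀, the case m = 1, involves L₋₁ v and L₀ v. The derivative property
evaluates the first, and the coefficient is then multiplied by n - (μ + ν - κ - 1) to give zero. -/
lemma IsIntertwining.weight (hI : IsIntertwining (VirVOA.omega c) (vertexMap c W₁)
    (vertexMap c W₂) (contragredientMap c W₃) I) {μ ν κ : ℂ} {v : W₁} {w : W₂} {u : W₃}
    (hv : v ∈ weightSpace W₁ μ) (hw : w ∈ weightSpace W₂ ν) (hu : u ∈ weightSpace W₃ κ) {n : ℂ}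
    (hn : n ≠ μ + ν - κ - 1) : (I v n w).1 u = 0 := by
  have h := hI.omega_commutator 1 n v w u
  have hc : ∀ j, 2 ≤ j → cb 1 j = 0 := fun j hj => by
    rw [← Nat.cast_one, cb_natCast, Nat.choose_eq_zero_of_lt (by omega), Nat.cast_zero]
  have h1 : cb 1 1 = 1 := by simp [cb]
  rw [mem_weightSpace] at hv hw hu
  rw [finsum_eq_sum_range (N := 2) (fun j hj => by rw [hc j hj, zero_smul]), sum_range_succ,
    sum_range_one, cb_zero, h1, one_smul, one_smul, sub_self, hu, hw] at h
  change _ = (I (Lu (((0 : ℕ) : ℤ) - 1) • v) _ w).1 u + (I (Lu (((1 : ℕ) : ℤ) - 1) • v) _ w).1 u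
    at h
  rw [Nat.cast_zero, zero_sub, hI.omega_derivative, Nat.cast_one, sub_self, hv, map_smul, map_smul,
    map_smul] at h
  change κ * _ - ν * _ = _ + μ * _ at h
  rw [show ((1 : ℤ) : ℂ) + n - ((0 : ℕ) : ℂ) - 1 = n by push_cast; ring,
    show ((1 : ℤ) : ℂ) + n - ((1 : ℕ) : ℂ) = n by push_cast; ring] at h
  push_cast at h
  have h' : (n - (μ + ν - κ - 1)) * (I v n w).1 u = 0 := by linear_combination h
  exact (mul_eq_zero.mp h').resolve_left (sub_ne_zero.mpr hn)

/-- The linear functional `f ↦ f u` on the restricted dual. -/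
def evalDual (u : W₃) : restrictedDual W₃ →ₗ[ℂ] ℂ :=
  (LinearMap.applyₗ u : Module.Dual ℂ W₃ →ₗ[ℂ] ℂ) ∘ₗ (restrictedDual W₃).subtype

lemma evalDual_apply (u : W₃) (f : restrictedDual W₃) : evalDual u f = f.1 u := rfl

lemma finsum_apply_eq_zero {f : ℕ → restrictedDual W₃} {u : W₃} (h : ∀ j, (f j).1 u = 0) :
    (∑ᶠ j, f j).1 u = 0 :=
  LinearMap.mem_ker.mp (finsum_mem_submodule (LinearMap.ker (evalDual u)) f h)

lemma mem_of_monomial {W : Type*} [AddCommGroup W] [Module UVir W] {v : W} (p : Set W)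
    (hv : v ∈ p) (hL : ∀ k : ℤ, 0 < k → ∀ w ∈ p, Lu (-k) • w ∈ p) {k : ℤ} {w : W}
    (hw : Monomial v k w) : w ∈ p := by
  induction hw with
  | base => exact hv
  | step _ hj ih => exact hL _ hj _ ih

lemma Verma.mem_of_Lu_neg_stable {h c : ℂ} (p : Submodule ℂ (Verma h c))
    (hv : Verma.hwVector h c ∈ p) (hL : ∀ k : ℤ, 0 < k → ∀ w ∈ p, Lu (-k) • w ∈ p)
    (w : Verma h c) : w ∈ p := by
  have hle : Submodule.span ℂ {b | ∃ k, Monomial (Verma.hwVector h c) k b} ≤ p := by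
    rw [Submodule.span_le]
    rintro b ⟨k, hb⟩
    exact mem_of_monomial p hv hL hb
  rw [span_monomial_eq_top c (IsGradedVirModule.central (c := c)) (Verma.Lu_zero_hw h c)
    (fun _ => Verma.Lu_hw h c) (Verma.exists_smul h c)] at hle
  exact hle trivial

/-- An intertwining operator of Verma modules vanishes if its leading matrix coefficient does. -/
lemma IsIntertwining.eq_zero {h₁ h₂ h₃ : ℂ}
    {I : Verma h₁ c →ₗ[ℂ] (ℂ → (Verma h₂ c →ₗ[ℂ] restrictedDual (Verma h₃ c)))}
    (hI : IsIntertwining (VirVOA.omega c) (vertexMap c (Verma h₁ c))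
      (vertexMap c (Verma h₂ c)) (contragredientMap c (Verma h₃ c)) I)
    (h0 : (I (Verma.hwVector h₁ c) (h₁ + h₂ - h₃ - 1) (Verma.hwVector h₂ c)).1
      (Verma.hwVector h₃ c) = 0) : I = 0 := by
  set v₁ := Verma.hwVector h₁ c with hv₁
  set v₂ := Verma.hwVector h₂ c with hv₂
  set v₃ := Verma.hwVector h₃ c with hv₃
  -- Only one mode can be nonzero between highest weight vectors, and that one vanishes by
  -- hypothesis.
  have s1 : ∀ n, (I v₁ n v₂).1 v₃ = 0 := fun n => by
    by_cases hn : n = h₁ + h₂ - h₃ - 1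
    · rw [hn, h0]
    · exact hI.weight (mem_weightSpace.mpr (Verma.Lu_zero_hw h₁ c))
        (mem_weightSpace.mpr (Verma.Lu_zero_hw h₂ c))
        (mem_weightSpace.mpr (Verma.Lu_zero_hw h₃ c)) hn
  have s2 : ∀ v n, (I v n v₂).1 v₃ = 0 := by
    let p : Submodule ℂ (Verma h₁ c) :=
      { carrier := {v | ∀ n, (I v n v₂).1 v₃ = 0}
        zero_mem' := fun n => by rw [map_zero]; rfl
        add_mem' := fun {v v'} hv hv' n => by
          change evalDual v₃ _ = 0
          rw [map_add, Pi.add_apply, LinearMap.add_apply, map_add, evalDual_apply, evalDual_apply,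
            hv, hv', add_zero]
        smul_mem' := fun a v hv n => by
          change evalDual v₃ _ = 0
          rw [map_smul, Pi.smul_apply, LinearMap.smul_apply, map_smul, evalDual_apply, hv,
            smul_zero] }
    refine Verma.mem_of_Lu_neg_stable p s1 fun k hk v hv n => ?_
    -- The case m = 0 of the commutator: L₁ v₃ = 0, and the mode of L₋₁ v is a multiple of a mode of
    -- v, already known to vanish.
    have hd : ∀ n, (I v n (Lu (-1) • v₂)).1 v₃ = 0 := fun n => by
      have h := hI.omega_commutator 0 n v v₂ v₃
      rw [sub_zero, zero_sub, Verma.Lu_hw h₃ c (by omega), map_zero, zero_sub,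
        finsum_eq_single _ 0 (fun j hj => by rw [cb_zero_left hj, zero_smul]), cb_zero, one_smul,
        Nat.cast_zero, zero_sub, hI.omega_derivative, hv, mul_zero, neg_eq_zero] at h
      exact h
    -- The associator expresses L₋ₖ v through L_{k+j} v₃ = 0 and L_{j-1} v₂, where j = 0 is `hd`, j
    -- = 1 is the weight and the remaining terms vanish.
    have h := hI.omega_associator (1 - k) n v v₂
    rw [sub_sub_cancel_left] at h
    rw [h]
    refine finsum_apply_eq_zero fun j => ?_
    rw [← evalDual_apply, map_smul, map_sub, map_smul, evalDual_apply, contragredientMap_omega,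
      Verma.Lu_hw h₃ c (by omega), map_zero, evalDual_apply]
    have : (I v (n + (1 - k : ℤ) - j) (Lu ((j : ℤ) - 1) • v₂)).1 v₃ = 0 := by
      rcases Nat.lt_or_ge j 1 with hj | hj
      · obtain rfl : j = 0 := by omega
        rw [Nat.cast_zero (R := ℤ), zero_sub]
        exact hd _
      · rcases eq_or_lt_of_le hj with rfl | hj
        · rw [Nat.cast_one (R := ℤ), sub_self, Verma.Lu_zero_hw, map_smul]
          change h₂ * _ = 0
          rw [hv, mul_zero]
        · rw [Verma.Lu_hw h₂ c (by omega), map_zero]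
          rfl
    rw [this]
    simp
  have s3 : ∀ w n v, (I v n w).1 v₃ = 0 := by
    let p : Submodule ℂ (Verma h₂ c) :=
      { carrier := {w | ∀ n v, (I v n w).1 v₃ = 0}
        zero_mem' := fun n v => by rw [map_zero]; rfl
        add_mem' := fun {w w'} hw hw' n v => by
          change evalDual v₃ _ = 0
          rw [map_add, map_add, evalDual_apply, evalDual_apply, hw, hw', add_zero]
        smul_mem' := fun a w hw n v => by
          change evalDual v₃ _ = 0
          rw [map_smul, map_smul, evalDual_apply, hw, smul_zero] }
    refine Verma.mem_of_Lu_neg_stable p (fun n v => s2 v n) fun k hk w hw n v => ?_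
    -- Here Lₖ v₃ = 0, so L₋ₖ w is traded for modes of other vectors against the same w.
    have h := hI.omega_commutator (1 - k) n v w v₃
    rw [sub_sub_cancel, sub_sub_cancel_left, Verma.Lu_hw h₃ c hk, map_zero, zero_sub,
      finsum_apply_eq_zero, neg_eq_zero] at h
    · exact h
    · intro j
      rw [← evalDual_apply, map_smul, evalDual_apply, hw, smul_zero]
  have s4 : ∀ u n v w, (I v n w).1 u = 0 := by
    let p : Submodule ℂ (Verma h₃ c) :=
      { carrier := {u | ∀ n v w, (I v n w).1 u = 0}
        zero_mem' := fun n v w => map_zero _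
        add_mem' := fun {u u'} hu hu' n v w => by rw [map_add, hu, hu', add_zero]
        smul_mem' := fun a u hu n v w => by rw [map_smul, hu, smul_zero] }
    refine Verma.mem_of_Lu_neg_stable p (fun n v w => s3 w n v) fun k hk u hu n v w => ?_
    -- The index is chosen so that L₋ₖ lands on u; every other term is evaluated on u itself, for
    -- arbitrary v and w.
    have h := hI.omega_commutator (1 + k) n v w u
    rw [sub_add_cancel_left, hu, sub_zero, finsum_apply_eq_zero] at h
    · exact h
    · intro j
      rw [← evalDual_apply, map_smul, evalDual_apply, hu, smul_zero]
  refine LinearMap.ext fun v => funext fun n => LinearMap.ext fun w => Subtype.ext ?_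
  exact LinearMap.ext fun u => s4 u n v w

/-- The leading matrix coefficient of an intertwining operator of Verma modules. -/
def leadingCoeff (h₁ h₂ h₃ c : ℂ) :
    intertwiningOperators (VirVOA.omega c) (vertexMap c (Verma h₁ c)) (vertexMap c (Verma h₂ c))
      (contragredientMap c (Verma h₃ c)) →ₗ[ℂ] ℂ where
  toFun I := (I.1 (Verma.hwVector h₁ c) (h₁ + h₂ - h₃ - 1) (Verma.hwVector h₂ c)).1
    (Verma.hwVector h₃ c)
  map_add' _ _ := rfl
  map_smul' _ _ := rfl

lemma leadingCoeff_injective (h₁ h₂ h₃ c : ℂ) : Function.Injective (leadingCoeff h₁ h₂ h₃ c) := by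
  intro I J hIJ
  have h0 : leadingCoeff h₁ h₂ h₃ c (I + (-1 : ℂ) • J) = 0 := by
    rw [map_add, map_smul, hIJ, smul_eq_mul]
    ring
  have h := IsIntertwining.eq_zero (I + (-1 : ℂ) • J).2 h0
  refine Subtype.ext (LinearMap.ext fun v => funext fun n => LinearMap.ext fun w => ?_)
  have h' : I.1 v n w + (-1 : ℂ) • J.1 v n w = 0 :=
    congrArg (fun K : Verma h₁ c →ₗ[ℂ] (ℂ → (Verma h₂ c →ₗ[ℂ] restrictedDual (Verma h₃ c))) =>
      K v n w) h
  refine Subtype.ext (LinearMap.ext fun u => ?_)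
  have hu : (I.1 v n w).1 u + -1 * (J.1 v n w).1 u = 0 := congrArg (evalDual u) h'
  linear_combination hu

lemma leadingCoeff_surjective (h₁ h₂ h₃ c : ℂ) :
    Function.Surjective (leadingCoeff h₁ h₂ h₃ c) := by
  obtain ⟨F, hF, hF1⟩ := exists_invariant_form h₁ h₂ h₃ c
  have h1 : leadingCoeff h₁ h₂ h₃ c
      ⟨formIntertwiner c F, isIntertwining_formIntertwiner hF⟩ = 1 := by
    have h := formMode_apply c F (h₁ + h₂ - h₃ - 1)
      (mem_weightSpace.mpr (Verma.Lu_zero_hw h₁ c)) (mem_weightSpace.mpr (Verma.Lu_zero_hw h₂ c))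
      (mem_weightSpace.mpr (Verma.Lu_zero_hw h₃ c))
    -- For n = h₁ + h₂ - h₃ - 1 the selected weight h₁ + h₂ - n - 1 is h₃, so the mode returns the
    -- normalized value of F.
    rw [if_pos (by ring), hF1] at h
    exact h
  intro t
  exact ⟨t • ⟨formIntertwiner c F, isIntertwining_formIntertwiner hF⟩, by
    rw [map_smul, h1, smul_eq_mul, mul_one]⟩

end Uniqueness

end

end VirasoroFusion

theorem mainTheorem10 (h₁ h₂ h₃ c : ℂ) :
    Module.finrank ℂ
      (VirasoroFusion.intertwiningOperators (VirasoroFusion.VirVOA.omega c)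
        (VirasoroFusion.vertexMap c (VirasoroFusion.Verma h₁ c))
        (VirasoroFusion.vertexMap c (VirasoroFusion.Verma h₂ c))
        (VirasoroFusion.contragredientMap c (VirasoroFusion.Verma h₃ c))) = 1 := by
  rw [(LinearEquiv.ofBijective (VirasoroFusion.leadingCoeff h₁ h₂ h₃ c)
    ⟨VirasoroFusion.leadingCoeff_injective h₁ h₂ h₃ c,
      VirasoroFusion.leadingCoeff_surjective h₁ h₂ h₃ c⟩).finrank_eq, Module.finrank_self]
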